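/- Let $T\in M(n;\mathbb C)$ be a singular matrix whose imaginary part is positive definite, and let $\delta\in M(n;\mathbb Z)$ be such that $T-\delta$ is non-singular. Put $T'=(-T+\delta)^{-1}$, and let $\varphi:\mathbb C^n/2\pi(\mathbb Z^n\oplus T\mathbb Z^n)\to\mathbb C^n/2\pi(\mathbb Z^n\oplus T'\mathbb Z^n)$ be the biholomorphic map $\varphi(z)=(-T+\delta)^{-1}z$. In the real coordinates given by $z=x+Ty$ and $Z=X+T'Y$ it is $(x,y)\mapsto(X,Y)=(-y,x+\delta y)$. *Complex side.* Let $r\in\mathbb N$ be positive, $A=(a_{kj})\in M(n;\mathbb Z)$, $p,q\in\mathbb R^n$, $\mu=p+T'^tq$. If $d_1\mid d_2\mid\cdots\mid d_n$ are the elementary divisors of $A$ (zeros included), put $r'=\prod_i r/\gcd(r,d_i)$. Let $\mathcal U$ consist of $V_j,U_k\in U(r')$ $(1\le j,k\le n)$ with $V_jV_k=V_kV_j$, $U_jU_k=U_kU_j$, $\zeta^{-a_{kj}}U_kV_j=V_jU_k$, where $\zeta=e^{2\pi\mathbf i/r}$. The bundle $E_{(r,A,\mu,\mathcal U)}$ of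 rank $r'$ on $\mathbb C^n/2\pi(\mathbb Z^n\oplus T'\mathbb Z^n)$ has the transition functions $e^{\frac{\mathbf i}{r}\sum_i a_{ij}Y_i}V_j$ along $X_j\mapsto X_j+2\pi$ and $U_k$ along $Y_k\mapsto Y_k+2\pi$, and the connection $d-\frac{\mathbf i}{2\pi}\bigl(\frac1rX^tA^t+\frac1r\mu^t\bigr)dY\cdot I_{r'}$. The objects of the DG-category $\mathcal{DG}^{\varphi}_{T^{2n}_{J=T}}$ are the bundles with connection $\varphi^*E_{(r,A,\mu,\mathcal U)}$ which are holomorphic (the $(0,2)$-part of the curvature vanishes) and simple. Two objects are isomorphic if they are isomorphic as holomorphic vector bundles, i.e. by closed morphisms of degree $0$. *Symplectic side.* Let $\check T^{2n}_{J=T}$ be the torus $\mathbb R^{2n}/2\pi\mathbb Z^{2n}$ with coordinates $(\check x,\check y)$ and the complexified symplectic form $d\check x^t(T-\delta)d\check y$ (the symplectic form is $d\check x^t\,\mathrm{Im}(T-\delta)\,d\check y$, the B-field is $d\check x^t\,\mathrm{Re}(T-\delta)\,d\check y$). The objects of $Fuk_{\rm aff}(\check T^{2n}_{J=T})$ are the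 pairs $(\tilde L_{(r,A,p)},\tilde{\mathcal L}_{(r,A,p,q)})$, where $\tilde L_{(r,A,p)}=\{\check x=-\frac1rA\check y+\frac1rp\}$ is Lagrangian and $\tilde{\mathcal L}_{(r,A,p,q)}$ is the trivial line bundle on it with the connection $d+\frac{\mathbf i}{2\pi}\frac1rq^td\check y$, whose curvature has to be $2\pi\mathbf i$ times the restriction of the B-field. Two such pairs are isomorphic if the submanifolds are equal and the line bundles with connection are isomorphic. *Angles.* Choose for every triple $(r,A,\mathcal U)$ real vectors $\xi=\xi(r,A,\mathcal U)$, $\theta=\theta(r,A,\mathcal U)\in\mathbb R^n$ with $e^{\mathbf i\xi_j}=\det V_j$ and $e^{\mathbf i\theta_k}=\det U_k$, and put $p(\theta)=p-\frac r{r'}\theta$, $q(\xi)=q+\frac r{r'}\xi$. Call the choice consistent if for any two triples $(r,A,\mathcal U)$, $(s,B,\hat{\mathcal U})$ with $\frac1rA=\frac1sB$ (which have the same $r'$), with matrices $V_j,U_k$ and $\hat V_j,\hat U_k$ and angles $\xi,\theta$ and $\hat\xi,\hat\theta$, there is an invertible matrix $g$ with $$\hat V_j=e^{\mathbf i(\hat\xi_j-\xi_j)/r'}\,gV_jg^{-1},\qquad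 \hat U_k=e^{\mathbf i(\hat\theta_k-\theta_k)/r'}\,gU_kg^{-1}\qquad(1\le j,k\le n).$$ **Theorem.** For every choice of angles, the pair $(\tilde L_{(r,A,p(\theta))},\tilde{\mathcal L}_{(r,A,p(\theta),q(\xi))})$ attached to an object $\varphi^*E_{(r,A,\mu,\mathcal U)}$ of $\mathcal{DG}^{\varphi}_{T^{2n}_{J=T}}$ is an object of $Fuk_{\rm aff}(\check T^{2n}_{J=T})$. Consistent choices of angles exist, and for every consistent choice the map $$\varphi^*E_{(r,A,\mu,\mathcal U)}\longmapsto(\tilde L_{(r,A,p(\theta))},\tilde{\mathcal L}_{(r,A,p(\theta),q(\xi))})$$ is well defined on isomorphism classes and induces a bijection between the isomorphism classes of objects of $\mathcal{DG}^{\varphi}_{T^{2n}_{J=T}}$ and the isomorphism classes of objects of $Fuk_{\rm aff}(\check T^{2n}_{J=T})$. -/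

import Mathlib

open Matrix
open scoped ContDiff Real

noncomputable section

namespace TorusMirror

/-! ### Real tori, complex structures, vector bundles with connection -/

/-- The universal cover `ℝⁿ × ℝⁿ` (coordinates `(x, y)`) of the torus `ℝ²ⁿ / 2πℤ²ⁿ`. -/
abbrev Cover (n : ℕ) : Type := (Fin n → ℝ) × (Fin n → ℝ)

/-- Deck transformations of the universal cover. -/
abbrev Deck (n : ℕ) : Type := (Fin n → ℤ) × (Fin n → ℤ)

/-- The torus `ℝ²ⁿ / 2πℤ²ⁿ`. -/
abbrev Torus (n : ℕ) : Type := (Fin n → AddCircle (2 * π)) × (Fin n → AddCircle (2 * π))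

/-- The translation vector `2πk` of a deck transformation `k`. -/
def period {n : ℕ} (k : Deck n) : Cover n :=
  (fun i => 2 * π * (k.1 i : ℝ), fun i => 2 * π * (k.2 i : ℝ))

/-- An integer matrix as a real matrix. -/
abbrev toR {n : ℕ} (A : Matrix (Fin n) (Fin n) ℤ) : Matrix (Fin n) (Fin n) ℝ :=
  A.map (fun a => (a : ℝ))

/-- An integer matrix as a complex matrix. -/
abbrev toC {n : ℕ} (A : Matrix (Fin n) (Fin n) ℤ) : Matrix (Fin n) (Fin n) ℂ :=
  A.map (fun a => (a : ℂ))

/-- The complex coordinate `z = x + T y`. It identifies `ℝ²ⁿ / 2πℤ²ⁿ` with the complex torus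
`ℂⁿ / 2π(ℤⁿ ⊕ Tℤⁿ)`. Being linear, it is also the `ℂⁿ`-valued one-form `dz = dx + T dy`. -/
def zcoord {n : ℕ} (T : Matrix (Fin n) (Fin n) ℂ) (u : Cover n) : Fin n → ℂ :=
  (fun i => (u.1 i : ℂ)) + T *ᵥ (fun i => (u.2 i : ℂ))

/-- The complexified tangent vector `v + 𝐢 w` is of type `(0,1)`, i.e. `dz` vanishes on it. -/
def IsType01 {n : ℕ} (T : Matrix (Fin n) (Fin n) ℂ) (v w : Cover n) : Prop :=
  zcoord T v + Complex.I • zcoord T w = 0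

/-- A complex vector bundle on `ℝ²ⁿ / 2πℤ²ⁿ` together with a connection `d + ω · Id`, `ω` a scalar
one-form on the cover. The bundle is given by transition functions: its smooth sections are the
smooth vector valued functions `s` on the cover with `s (u + 2πk) = mult k u * s u`. -/
structure TorusBundle (n : ℕ) where
  /-- the rank of the bundle -/
  rank : ℕ
  /-- the transition functions -/
  mult : Deck n → Cover n → Matrix (Fin rank) (Fin rank) ℂ
  /-- the scalar one-form `ω`: `form u v` is its value at `u` on the tangent vector `v` -/
  form : Cover n → Cover n →ₗ[ℝ] ℂ
  mult_zero : ∀ u, mult 0 u = 1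
  /-- the cocycle condition -/
  mult_add : ∀ k l u, mult (k + l) u = mult k (u + period l) * mult l u
  mult_smooth : ∀ k a b, ContDiff ℝ ∞ (fun u => mult k u a b)
  form_smooth : ∀ v, ContDiff ℝ ∞ (fun u => form u v)
  /-- `d + ω · Id` is compatible with the transition functions -/
  compat : ∀ k u v a b, fderiv ℝ (fun x => mult k x a b) u v
    + (form (u + period k) v - form u v) * mult k u a b = 0

namespace TorusBundle

variable {n : ℕ}

/-- The curvature of the connection `d + ω · Id` is `curvature · Id`, where `curvature = dω`. -/
def curvature (B : TorusBundle n) (u v w : Cover n) : ℂ :=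
  fderiv ℝ (fun x => B.form x w) u v - fderiv ℝ (fun x => B.form x v) u w

/-- The bundle with its connection is holomorphic on `ℂⁿ / 2π(ℤⁿ ⊕ Tℤⁿ)`: the `(0,2)`-part of the
curvature form vanishes, i.e. the complex bilinear extension of the curvature form vanishes on all
pairs of vectors `v₁ + 𝐢 w₁`, `v₂ + 𝐢 w₂` of type `(0,1)`. -/
def IsHolomorphic (T : Matrix (Fin n) (Fin n) ℂ) (B : TorusBundle n) : Prop :=
  ∀ u v₁ w₁ v₂ w₂ : Cover n, IsType01 T v₁ w₁ → IsType01 T v₂ w₂ →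
    (B.curvature u v₁ v₂ - B.curvature u w₁ w₂
      + Complex.I * (B.curvature u v₁ w₂ + B.curvature u w₁ v₂))
      • (1 : Matrix (Fin B.rank) (Fin B.rank) ℂ) = 0

/-- The covariant derivative `dψ + ω' ψ - ψ ω` of a section `ψ` of `Hom(B, B')`. -/
def covDeriv (B B' : TorusBundle n) (ψ : Cover n → Matrix (Fin B'.rank) (Fin B.rank) ℂ)
    (u v : Cover n) : Matrix (Fin B'.rank) (Fin B.rank) ℂ :=
  Matrix.of fun a b =>
    fderiv ℝ (fun x => ψ x a b) u v + (B'.form u v - B.form u v) * ψ u a b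

/-- `ψ` is a holomorphic bundle map `B → B'`, i.e. a closed morphism of degree `0` of the
DG-category whose morphism complexes are the `Hom(B, B')`-valued `(0,•)`-forms with the
differential induced by the `(0,1)`-parts of the connections: `ψ` is a smooth section of
`Hom(B, B')` and the `(0,1)`-part of its covariant derivative vanishes. -/
structure IsHolHom (T : Matrix (Fin n) (Fin n) ℂ) (B B' : TorusBundle n)
    (ψ : Cover n → Matrix (Fin B'.rank) (Fin B.rank) ℂ) : Prop where
  smooth : ∀ a b, ContDiff ℝ ∞ (fun u => ψ u a b)
  equivariant : ∀ k u, ψ (u + period k) * B.mult k u = B'.mult k u * ψ u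
  dbar_closed : ∀ u v w, IsType01 T v w →
    covDeriv B B' ψ u v + Complex.I • covDeriv B B' ψ u w = 0

/-- `B` and `B'` are isomorphic (as holomorphic vector bundles; equivalently in the degree `0`
cohomology of the DG-category). -/
def Isomorphic (T : Matrix (Fin n) (Fin n) ℂ) (B B' : TorusBundle n) : Prop :=
  ∃ (ψ : Cover n → Matrix (Fin B'.rank) (Fin B.rank) ℂ)
    (χ : Cover n → Matrix (Fin B.rank) (Fin B'.rank) ℂ),
    IsHolHom T B B' ψ ∧ IsHolHom T B' B χ ∧ ∀ u, ψ u * χ u = 1 ∧ χ u * ψ u = 1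

/-- `B` is simple: its only holomorphic endomorphisms are the scalars. -/
def IsSimple (T : Matrix (Fin n) (Fin n) ℂ) (B : TorusBundle n) : Prop :=
  ∀ ψ, IsHolHom T B B ψ → ∃ c : ℂ, ∀ u, ψ u = c • (1 : Matrix (Fin B.rank) (Fin B.rank) ℂ)

theorem isHolHom_one (T : Matrix (Fin n) (Fin n) ℂ) (B : TorusBundle n) :
    IsHolHom T B B (fun _ => 1) where
  smooth a b := contDiff_const
  equivariant k u := by simp
  dbar_closed u v w _ := by
    ext a b
    simp [covDeriv]

theorem IsHolHom.comp {T : Matrix (Fin n) (Fin n) ℂ} {B B' B'' : TorusBundle n}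
    {ψ : Cover n → Matrix (Fin B'.rank) (Fin B.rank) ℂ}
    {χ : Cover n → Matrix (Fin B''.rank) (Fin B'.rank) ℂ}
    (hχ : IsHolHom T B' B'' χ) (hψ : IsHolHom T B B' ψ) :
    IsHolHom T B B'' (fun u => χ u * ψ u) where
  smooth a b := by
    simp only [Matrix.mul_apply]
    exact ContDiff.sum fun i _ => (hχ.smooth a i).mul (hψ.smooth i b)
  equivariant k u := by
    rw [Matrix.mul_assoc, hψ.equivariant, ← Matrix.mul_assoc, hχ.equivariant, Matrix.mul_assoc]
  dbar_closed u v w h := by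
    have key : ∀ x, covDeriv B B'' (fun u => χ u * ψ u) u x
        = covDeriv B' B'' χ u x * ψ u + χ u * covDeriv B B' ψ u x := by
      intro x
      ext a b
      have hd : fderiv ℝ (fun y => (χ y * ψ y) a b) u x
          = ∑ i, (χ u a i * fderiv ℝ (fun y => ψ y i b) u x
            + fderiv ℝ (fun y => χ y a i) u x * ψ u i b) := by
        have h1 : ∀ i, DifferentiableAt ℝ (fun y => χ y a i) u := fun i =>
          (hχ.smooth a i).differentiable (by simp) u
        have h2 : ∀ i, DifferentiableAt ℝ (fun y => ψ y i b) u := fun i =>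
          (hψ.smooth i b).differentiable (by simp) u
        have h3 := HasFDerivAt.fun_sum (u := Finset.univ)
          (fun i _ => (h1 i).hasFDerivAt.mul (h2 i).hasFDerivAt)
        have h4 : HasFDerivAt (fun y => (χ y * ψ y) a b) _ u := h3
        rw [h4.fderiv, _root_.sum_apply]
        refine Finset.sum_congr rfl fun i _ => ?_
        simp [mul_comm]
      simp only [covDeriv, Matrix.of_apply, Matrix.add_apply, hd]
      simp only [Matrix.mul_apply, Matrix.of_apply, Finset.mul_sum, ← Finset.sum_add_distrib]
      refine Finset.sum_congr rfl fun i _ => ?_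
      ring
    have e1 := hχ.dbar_closed u v w h
    have e2 := hψ.dbar_closed u v w h
    rw [key, key]
    calc _ = (covDeriv B' B'' χ u v + Complex.I • covDeriv B' B'' χ u w) * ψ u
          + χ u * (covDeriv B B' ψ u v + Complex.I • covDeriv B B' ψ u w) := by
            simp only [Matrix.add_mul, Matrix.mul_add, Matrix.smul_mul, Matrix.mul_smul, smul_add]
            abel
      _ = 0 := by rw [e1, e2]; simp

theorem isomorphic_equivalence (T : Matrix (Fin n) (Fin n) ℂ) :
    Equivalence (Isomorphic T) where
  refl B := ⟨_, _, isHolHom_one T B, isHolHom_one T B, fun _ => by simp⟩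
  symm := fun ⟨ψ, χ, h1, h2, h3⟩ => ⟨χ, ψ, h2, h1, fun u => (h3 u).symm⟩
  trans := fun ⟨ψ, χ, h1, h2, h3⟩ ⟨ψ', χ', h1', h2', h3'⟩ =>
    ⟨_, _, h1'.comp h1, h2.comp h2', fun u => by
      constructor
      · rw [Matrix.mul_assoc, ← Matrix.mul_assoc (ψ u), (h3 u).1, Matrix.one_mul, (h3' u).1]
      · rw [Matrix.mul_assoc, ← Matrix.mul_assoc (χ' u), (h3' u).2, Matrix.one_mul, (h3 u).2]⟩

end TorusBundle

/-! ### The biholomorphic map `φ` -/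

/-- The matrix `T' = (-T + δ)⁻¹`. -/
def Tprime {n : ℕ} (T : Matrix (Fin n) (Fin n) ℂ) (δ : Matrix (Fin n) (Fin n) ℤ) :
    Matrix (Fin n) (Fin n) ℂ :=
  (-T + toC δ)⁻¹

/-- The lift to the universal covers of the biholomorphic map
`φ : ℂⁿ/2π(ℤⁿ ⊕ Tℤⁿ) → ℂⁿ/2π(ℤⁿ ⊕ T'ℤⁿ)`, in real coordinates:
`(x, y) ↦ (X, Y) = (-y, x + δ y)`; see `zcoord_phi` for the complex coordinates. -/
def phi {n : ℕ} (δ : Matrix (Fin n) (Fin n) ℤ) : Cover n →ₗ[ℝ] Cover n :=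
  LinearMap.prod (-LinearMap.snd ℝ _ _)
    (LinearMap.fst ℝ _ _ + (toR δ).mulVecLin ∘ₗ LinearMap.snd ℝ _ _)

/-- The map of deck transformations induced by `φ`. -/
def phiDeck {n : ℕ} (δ : Matrix (Fin n) (Fin n) ℤ) : Deck n →+ Deck n :=
  AddMonoidHom.prod (-AddMonoidHom.snd _ _)
    (AddMonoidHom.fst _ _ + δ.mulVecLin.toAddMonoidHom.comp (AddMonoidHom.snd _ _))

theorem phi_apply {n : ℕ} (δ : Matrix (Fin n) (Fin n) ℤ) (u : Cover n) :
    phi δ u = (-u.2, u.1 + toR δ *ᵥ u.2) := rfl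

theorem phiDeck_apply {n : ℕ} (δ : Matrix (Fin n) (Fin n) ℤ) (k : Deck n) :
    phiDeck δ k = (-k.2, k.1 + δ *ᵥ k.2) := rfl

theorem phi_period {n : ℕ} (δ : Matrix (Fin n) (Fin n) ℤ) (k : Deck n) :
    phi δ (period k) = period (phiDeck δ k) := by
  rw [phi_apply, phiDeck_apply]
  refine Prod.ext ?_ ?_
  · ext i; simp [period]
  · ext i
    simp only [period, Matrix.mulVec, dotProduct, Pi.add_apply, Matrix.map_apply, Int.cast_add,
      Int.cast_sum, Int.cast_mul, mul_add, Finset.mul_sum]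
    congr 1
    exact Finset.sum_congr rfl fun j _ => by ring

/-- In complex coordinates `φ (z) = (-T + δ)⁻¹ z`. -/
theorem zcoord_phi {n : ℕ} (T : Matrix (Fin n) (Fin n) ℂ) (δ : Matrix (Fin n) (Fin n) ℤ)
    (h : (-T + toC δ).det ≠ 0) (u : Cover n) :
    zcoord (Tprime T δ) (phi δ u) = (-T + toC δ)⁻¹ *ᵥ zcoord T u := by
  have hu : IsUnit (-T + toC δ).det := isUnit_iff_ne_zero.2 h
  set M := -T + toC δ with hM
  have hT : T = toC δ - M := by rw [hM]; abel
  set y : Fin n → ℂ := fun i => (u.2 i : ℂ) with hy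
  have e1 : (fun i => ((phi δ u).1 i : ℂ)) = -y := by ext i; simp [phi_apply, hy]
  have e2 : (fun i => ((phi δ u).2 i : ℂ)) = (fun i => (u.1 i : ℂ)) + toC δ *ᵥ y := by
    ext i; simp [phi_apply, hy, Matrix.mulVec, dotProduct]
  have e3 : -y = M⁻¹ *ᵥ (-(M *ᵥ y)) := by
    rw [Matrix.mulVec_neg, Matrix.mulVec_mulVec, Matrix.nonsing_inv_mul _ hu, Matrix.one_mulVec]
  unfold zcoord Tprime
  rw [← hM, e1, e2, e3, ← Matrix.mulVec_add, hT]
  congr 1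
  rw [Matrix.sub_mulVec]
  abel

/-- The pullback `φ^*B` of a bundle with connection along `φ`. -/
def TorusBundle.pullback {n : ℕ} (δ : Matrix (Fin n) (Fin n) ℤ) (B : TorusBundle n) :
    TorusBundle n where
  rank := B.rank
  mult k u := B.mult (phiDeck δ k) (phi δ u)
  form u := B.form (phi δ u) ∘ₗ phi δ
  mult_zero u := by rw [map_zero, B.mult_zero]
  mult_add k l u := by rw [map_add, B.mult_add, map_add, phi_period]
  mult_smooth k a b :=
    (B.mult_smooth (phiDeck δ k) a b).comp (LinearMap.toContinuousLinearMap (phi δ)).contDiff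
  form_smooth v :=
    (B.form_smooth (phi δ v)).comp (LinearMap.toContinuousLinearMap (phi δ)).contDiff
  compat k u v a b := by
    have hf : HasFDerivAt (fun x => B.mult (phiDeck δ k) (phi δ x) a b)
        ((fderiv ℝ (fun x => B.mult (phiDeck δ k) x a b) (phi δ u)).comp
          (LinearMap.toContinuousLinearMap (phi δ))) u := by
      have h1 := ((B.mult_smooth (phiDeck δ k) a b).differentiable (by simp) (phi δ u)).hasFDerivAt
      exact h1.comp u (LinearMap.toContinuousLinearMap (phi δ)).hasFDerivAt
    rw [hf.fderiv]
    have := B.compat (phiDeck δ k) (phi δ u) (phi δ v) a b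
    rw [← phi_period, ← map_add] at this
    exact this

/-! ### The bundles `E_(r,A,μ,𝒰)` -/

/-- `k = r'`, the natural number attached to `(r, A)` by elementary divisors: if `P A Q` is diagonal
with entries `d₁ ∣ d₂ ∣ ⋯` (so the zeros come last), `P, Q ∈ GL(n, ℤ)`, and `rᵢ' = r / gcd(r, dᵢ)`
is the denominator of `dᵢ / r` in lowest terms, then `r' = ∏ rᵢ'` (zero entries contribute `1`). -/
def IsRankOf {n : ℕ} (r : ℕ) (A : Matrix (Fin n) (Fin n) ℤ) (k : ℕ) : Prop :=
  ∃ (P Q : GL (Fin n) ℤ) (d : Fin n → ℕ),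
    (P : Matrix (Fin n) (Fin n) ℤ) * A * (Q : Matrix (Fin n) (Fin n) ℤ)
      = Matrix.diagonal (fun i => (d i : ℤ)) ∧
    (∀ i j, i ≤ j → d i ∣ d j) ∧ k = ∏ i, r / Nat.gcd r (d i)

/-- A triple `(r, A, 𝒰)`: a positive integer `r`, an integer matrix `A = (a_kj)`, the rank `r'`
attached to `(r, A)`, and unitary matrices `V_j, U_k ∈ U(r')` satisfying the cocycle condition,
where `ζ = exp(2π𝐢/r)`. -/
structure TransData (n : ℕ) where
  /-- `r` -/
  r : ℕ
  r_pos : 0 < r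
  /-- `A` -/
  A : Matrix (Fin n) (Fin n) ℤ
  /-- `r'` -/
  rk : ℕ
  rk_spec : IsRankOf r A rk
  /-- the matrices `V_j` -/
  V : Fin n → Matrix.unitaryGroup (Fin rk) ℂ
  /-- the matrices `U_k` -/
  U : Fin n → Matrix.unitaryGroup (Fin rk) ℂ
  comm_V : ∀ j k, V j * V k = V k * V j
  comm_U : ∀ j k, U j * U k = U k * U j
  comm_UV : ∀ j k, Complex.exp (2 * π * Complex.I / r) ^ (-(A k j))
      • ((U k : Matrix (Fin rk) (Fin rk) ℂ) * (V j : Matrix (Fin rk) (Fin rk) ℂ))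
    = (V j : Matrix (Fin rk) (Fin rk) ℂ) * (U k : Matrix (Fin rk) (Fin rk) ℂ)

/-- The ordered product `W₁ ^ m₁ ⋯ Wₙ ^ mₙ`. -/
def zpowProd {G : Type*} [Group G] {n : ℕ} (W : Fin n → G) (m : Fin n → ℤ) : G :=
  (List.ofFn fun j => W j ^ m j).prod

theorem zpowProd_succ {G : Type*} [Group G] {n : ℕ} (W : Fin (n + 1) → G) (m : Fin (n + 1) → ℤ) :
    zpowProd W m = W 0 ^ m 0 * zpowProd (fun j => W j.succ) (fun j => m j.succ) := by
  simp [zpowProd, List.ofFn_succ]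

theorem zpowProd_zero {G : Type*} [Group G] {n : ℕ} (W : Fin n → G) : zpowProd W 0 = 1 := by
  induction n with
  | zero => simp [zpowProd]
  | succ n ih =>
    rw [zpowProd_succ]
    have : (fun j : Fin n => (0 : Fin (n + 1) → ℤ) j.succ) = 0 := rfl
    rw [this, ih]; simp

theorem zpowProd_single {G : Type*} [Group G] {n : ℕ} (W : Fin n → G) (j : Fin n) :
    zpowProd W (Pi.single j 1) = W j := by
  induction n with
  | zero => exact j.elim0
  | succ n ih =>
    rw [zpowProd_succ]
    refine Fin.cases ?_ (fun i => ?_) j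
    · have : (fun i : Fin n => (Pi.single (0 : Fin (n + 1)) (1 : ℤ) : Fin (n + 1) → ℤ) i.succ)
          = 0 := by ext i; simp
      rw [this, zpowProd_zero]; simp
    · have : (fun l : Fin n => (Pi.single i.succ (1 : ℤ) : Fin (n + 1) → ℤ) l.succ)
          = Pi.single i 1 := by ext l; simp [Pi.single_apply]
      rw [this, ih]; simp

theorem commute_zpowProd {G : Type*} [Group G] {n : ℕ} (g : G) (W : Fin n → G) (m : Fin n → ℤ)
    (h : ∀ j, Commute g (W j)) : Commute g (zpowProd W m) := by
  induction n with
  | zero => simp [zpowProd]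
  | succ n ih =>
    rw [zpowProd_succ]
    exact ((h 0).zpow_right _).mul_right (ih _ _ fun j => h j.succ)

theorem zpowProd_add {G : Type*} [Group G] {n : ℕ} (W : Fin n → G) (m m' : Fin n → ℤ)
    (h : ∀ i j, Commute (W i) (W j)) : zpowProd W (m + m') = zpowProd W m * zpowProd W m' := by
  induction n with
  | zero => simp [zpowProd]
  | succ n ih =>
    rw [zpowProd_succ, zpowProd_succ W m, zpowProd_succ W m']
    have e : (fun j : Fin n => (m + m') j.succ)
        = (fun j : Fin n => m j.succ) + fun j : Fin n => m' j.succ := rfl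
    rw [e, ih _ _ _ fun i j => h i.succ j.succ, Pi.add_apply, _root_.zpow_add]
    have hc : Commute (W 0 ^ m' 0) (zpowProd (fun j => W j.succ) fun j => m j.succ) :=
      commute_zpowProd _ _ _ fun j => (h 0 j.succ).zpow_left _
    simp only [mul_assoc]
    rw [← mul_assoc (W 0 ^ m' 0), hc.eq, mul_assoc]

/-- The scalar unitary matrix `exp(𝐢 t)`. -/
def phase (k : ℕ) (t : ℝ) : Matrix.unitaryGroup (Fin k) ℂ :=
  ⟨Complex.exp (t * Complex.I) • (1 : Matrix (Fin k) (Fin k) ℂ), by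
    rw [Matrix.mem_unitaryGroup_iff]
    rw [star_smul, star_one, smul_mul_smul_comm, one_mul]
    have : Complex.exp (t * Complex.I) * star (Complex.exp (t * Complex.I)) = 1 := by
      rw [Complex.star_def, ← Complex.exp_conj, ← Complex.exp_add]
      simp
    rw [this, one_smul]⟩

theorem phase_add (k : ℕ) (s t : ℝ) : phase k (s + t) = phase k s * phase k t := by
  apply Subtype.ext
  change Complex.exp (((s + t : ℝ) : ℂ) * Complex.I) • (1 : Matrix (Fin k) (Fin k) ℂ)
    = (Complex.exp (s * Complex.I) • 1) * (Complex.exp (t * Complex.I) • 1)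
  rw [smul_mul_smul_comm, one_mul, ← Complex.exp_add]
  push_cast
  rw [add_mul]

theorem phase_comm (k : ℕ) (t : ℝ) (g : Matrix.unitaryGroup (Fin k) ℂ) :
    phase k t * g = g * phase k t := by
  apply Subtype.ext
  simp [phase]

/-- `g h = exp(𝐢 t) h g`. -/
def Twist {k : ℕ} (t : ℝ) (g h : Matrix.unitaryGroup (Fin k) ℂ) : Prop :=
  g * h = phase k t * (h * g)

theorem phase_zero (k : ℕ) : phase k 0 = 1 := by
  apply Subtype.ext
  simp [phase]

theorem Twist.mul_right {k : ℕ} {s t : ℝ} {g h h' : Matrix.unitaryGroup (Fin k) ℂ}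
    (a : Twist s g h) (b : Twist t g h') : Twist (s + t) g (h * h') := by
  unfold Twist at *
  rw [← mul_assoc, a, phase_add, mul_assoc, mul_assoc, b, ← mul_assoc h, ← phase_comm]
  simp only [mul_assoc]

theorem Twist.swap {k : ℕ} {t : ℝ} {g h : Matrix.unitaryGroup (Fin k) ℂ} (a : Twist t g h) :
    Twist (-t) h g := by
  unfold Twist at *
  rw [a, ← mul_assoc, ← phase_add]
  simp [phase_zero]

theorem Twist.one_right {k : ℕ} (g : Matrix.unitaryGroup (Fin k) ℂ) : Twist 0 g 1 := by
  simp [Twist, phase_zero]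

theorem Twist.inv_right {k : ℕ} {t : ℝ} {g h : Matrix.unitaryGroup (Fin k) ℂ} (a : Twist t g h) :
    Twist (-t) g h⁻¹ := by
  have b := a.swap
  unfold Twist at *
  have : h⁻¹ * (h * g) * h⁻¹ = h⁻¹ * (phase k (-t) * (g * h)) * h⁻¹ := by rw [b]
  rw [← mul_assoc h⁻¹ (phase k (-t)), ← phase_comm] at this
  simpa [mul_assoc] using this

theorem Twist.zpow_right {k : ℕ} {t : ℝ} {g h : Matrix.unitaryGroup (Fin k) ℂ} (a : Twist t g h)
    (m : ℤ) : Twist (m * t) g (h ^ m) := by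
  have hn : ∀ m : ℕ, Twist (m * t) g (h ^ m) := by
    intro m
    induction m with
    | zero => simpa using Twist.one_right g
    | succ m ih => rw [pow_succ]; have := ih.mul_right a; convert this using 1; push_cast; ring
  cases m with
  | ofNat m => simpa using hn m
  | negSucc m =>
    rw [zpow_negSucc]; have := (hn (m + 1)).inv_right; convert this using 1; push_cast; ring

theorem Twist.zpowProd_right {k n : ℕ} (t : Fin n → ℝ) (g : Matrix.unitaryGroup (Fin k) ℂ)
    (W : Fin n → Matrix.unitaryGroup (Fin k) ℂ) (h : ∀ j, Twist (t j) g (W j)) (m : Fin n → ℤ) :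
    Twist (∑ j, m j * t j) g (zpowProd W m) := by
  induction n with
  | zero => simpa [zpowProd] using Twist.one_right g
  | succ n ih =>
    rw [zpowProd_succ, Fin.sum_univ_succ]
    exact ((h 0).zpow_right _).mul_right (ih _ _ (fun j => h j.succ) _)

namespace TransData

variable {n : ℕ}

theorem twist_UV (D : TransData n) (k j : Fin n) :
    Twist (2 * π * D.A k j / D.r) (D.U k) (D.V j) := by
  have h := D.comm_UV j k
  apply Subtype.ext
  set z := Complex.exp (2 * π * Complex.I / D.r) with hz
  have hz0 : z ≠ 0 := Complex.exp_ne_zero _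
  have e : Complex.exp ((2 * π * D.A k j / D.r : ℝ) * Complex.I) = z ^ (D.A k j) := by
    rw [hz, ← Complex.exp_int_mul]; congr 1; push_cast; ring
  change (D.U k : Matrix (Fin D.rk) (Fin D.rk) ℂ) * (D.V j : Matrix (Fin D.rk) (Fin D.rk) ℂ)
    = (Complex.exp ((2 * π * D.A k j / D.r : ℝ) * Complex.I) • (1 : Matrix _ _ ℂ)) *
      ((D.V j : Matrix (Fin D.rk) (Fin D.rk) ℂ) * (D.U k : Matrix (Fin D.rk) (Fin D.rk) ℂ))
  rw [e, ← h, Matrix.smul_mul, Matrix.one_mul, smul_smul, ← zpow_add₀ hz0]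
  simp

theorem twist_prod (D : TransData n) (l m : Fin n → ℤ) :
    Twist (2 * π / D.r * ((D.A *ᵥ m) ⬝ᵥ l : ℤ)) (zpowProd D.U l) (zpowProd D.V m) := by
  have h1 : ∀ k, Twist (-∑ j, m j * (2 * π * D.A k j / D.r)) (zpowProd D.V m) (D.U k) := fun k =>
    (Twist.zpowProd_right _ _ _ (fun j => D.twist_UV k j) m).swap
  have h2 := (Twist.zpowProd_right _ _ _ h1 l).swap
  convert h2 using 1
  simp only [Matrix.mulVec, dotProduct, Int.cast_sum, Int.cast_mul, Finset.mul_sum,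
    mul_neg, Finset.sum_neg_distrib, neg_neg, Finset.sum_mul]
  exact Finset.sum_congr rfl fun k _ => Finset.sum_congr rfl fun j _ => by ring

/-- The exponent `(1/r) (A m)ᵗ (Y + 2πl)`. -/
def expo (D : TransData n) (k : Deck n) (u : Cover n) : ℝ :=
  (1 / (D.r : ℝ)) * ((toR D.A *ᵥ fun i => (k.1 i : ℝ)) ⬝ᵥ (u.2 + (period k).2))

theorem expo_fderiv (D : TransData n) (k : Deck n) (u : Cover n) :
    HasFDerivAt (D.expo k)
      (LinearMap.toContinuousLinearMap ((1 / (D.r : ℝ)) •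
        (dotProductBilin ℝ ℝ (toR D.A *ᵥ fun i => (k.1 i : ℝ)) ∘ₗ LinearMap.snd ℝ _ _))) u := by
  have h : D.expo k = fun u => LinearMap.toContinuousLinearMap ((1 / (D.r : ℝ)) •
        (dotProductBilin ℝ ℝ (toR D.A *ᵥ fun i => (k.1 i : ℝ)) ∘ₗ LinearMap.snd ℝ _ _)) u
        + D.expo k 0 := by
    ext u
    simp [expo, dotProduct_add, mul_add]
  rw [h]
  exact (ContinuousLinearMap.hasFDerivAt _).add_const _

theorem expo_smooth (D : TransData n) (k : Deck n) : ContDiff ℝ ∞ (D.expo k) := by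
  unfold expo dotProduct
  fun_prop

/-- The unitary matrix `V₁^m₁ ⋯ Vₙ^mₙ U₁^l₁ ⋯ Uₙ^lₙ`. -/
def word (D : TransData n) (k : Deck n) : Matrix (Fin D.rk) (Fin D.rk) ℂ :=
  (zpowProd D.V k.1 * zpowProd D.U k.2 : Matrix.unitaryGroup (Fin D.rk) ℂ)

/-- The transition function of `E_(r,A,μ,𝒰)` along `2πk`, `k = (m, l)`:
`exp((𝐢/r) (A m)ᵗ (Y + 2πl)) V₁^m₁ ⋯ Vₙ^mₙ U₁^l₁ ⋯ Uₙ^lₙ`. See `trans_X`, `trans_Y` for the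
generators. -/
def trans (D : TransData n) (k : Deck n) (u : Cover n) : Matrix (Fin D.rk) (Fin D.rk) ℂ :=
  Complex.exp (Complex.I * D.expo k u) • D.word k

/-- The complex vector bundle `E_(r,A,μ,𝒰)` with the connection
`∇ = d - (𝐢/2π) ((1/r) Xᵗ Aᵗ + (1/r) μᵗ) dY · I_{r'}` on the torus with coordinates `(X, Y)`. -/
def bundle (D : TransData n) (μ : Fin n → ℂ) : TorusBundle n where
  rank := D.rk
  mult := D.trans
  form u :=
    { toFun := fun v => -(Complex.I / (2 * π)) * ∑ i,
        ((1 / (D.r : ℂ)) * (((toR D.A *ᵥ u.1) i : ℝ) : ℂ) + (1 / (D.r : ℂ)) * μ i) * (v.2 i : ℂ)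
      map_add' := fun v w => by
        simp only [Prod.snd_add, Pi.add_apply, Complex.ofReal_add, mul_add, Finset.sum_add_distrib]
      map_smul' := fun c v => by
        simp only [Prod.smul_snd, Pi.smul_apply, smul_eq_mul, Complex.ofReal_mul,
          Finset.mul_sum, RingHom.id_apply, Complex.real_smul]
        exact Finset.sum_congr rfl fun i _ => by ring }
  mult_zero u := by
    have : D.expo 0 u = 0 := by
      have h0 : (fun i : Fin n => (((0 : Deck n).1 i : ℤ) : ℝ)) = 0 := by ext; simp
      unfold expo
      rw [h0]; simp
    unfold trans word
    rw [this, Prod.fst_zero, Prod.snd_zero, zpowProd_zero, zpowProd_zero]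
    simp
  mult_add k l u := by
    have hV := zpowProd_add D.V k.1 l.1 D.comm_V
    have hU := zpowProd_add D.U k.2 l.2 D.comm_U
    have hT := congrArg Subtype.val (D.twist_prod k.2 l.1)
    simp only [Submonoid.coe_mul, phase] at hT
    unfold trans word
    rw [Prod.fst_add, Prod.snd_add, hV, hU]
    simp only [Submonoid.coe_mul]
    rw [smul_mul_smul_comm, ← Complex.exp_add]
    have hexp : (D.expo (k + l) u : ℝ) = D.expo k (u + period l) + D.expo l u
        + 2 * π / D.r * ((D.A *ᵥ l.1) ⬝ᵥ k.2 : ℤ) := by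
      have e1 : (fun i => (((k + l).1 i : ℤ) : ℝ))
          = (fun i => (k.1 i : ℝ)) + fun i => (l.1 i : ℝ) := by ext; simp
      have e2 : (period (k + l)).2 = (period k).2 + (period l).2 := by
        ext; simp [period, mul_add]
      have e3 : (((D.A *ᵥ l.1) ⬝ᵥ k.2 : ℤ) : ℝ) * (2 * π)
          = (toR D.A *ᵥ fun i => (l.1 i : ℝ)) ⬝ᵥ (period k).2 := by
        simp only [Matrix.mulVec, dotProduct, period, Int.cast_sum, Int.cast_mul, Finset.sum_mul,
          Matrix.map_apply]
        exact Finset.sum_congr rfl fun i _ => Finset.sum_congr rfl fun j _ => by ring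
      simp only [expo, e1, e2, Matrix.mulVec_add, add_dotProduct, dotProduct_add, Prod.snd_add]
      have : 2 * π / D.r * (((D.A *ᵥ l.1) ⬝ᵥ k.2 : ℤ) : ℝ)
          = 1 / (D.r : ℝ) * ((toR D.A *ᵥ fun i => (l.1 i : ℝ)) ⬝ᵥ (period k).2) := by
        rw [← e3]; ring
      rw [this]; ring
    rw [hexp]
    set a : Matrix (Fin D.rk) (Fin D.rk) ℂ := (zpowProd D.V k.1).1
    set b : Matrix (Fin D.rk) (Fin D.rk) ℂ := (zpowProd D.U k.2).1
    set c : Matrix (Fin D.rk) (Fin D.rk) ℂ := (zpowProd D.V l.1).1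
    set d : Matrix (Fin D.rk) (Fin D.rk) ℂ := (zpowProd D.U l.2).1
    have e4 : a * b * (c * d) = a * (b * c) * d := by simp only [Matrix.mul_assoc]
    rw [e4, hT]
    simp only [Matrix.smul_mul, Matrix.mul_smul, Matrix.one_mul, smul_smul, ← Complex.exp_add,
      Matrix.mul_assoc]
    congr 2
    push_cast
    ring
  mult_smooth k a b := by
    unfold trans
    simp only [Matrix.smul_apply, smul_eq_mul]
    refine ContDiff.mul (ContDiff.cexp (contDiff_const.mul ?_)) contDiff_const
    exact Complex.ofRealCLM.contDiff.comp (D.expo_smooth k)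
  form_smooth v := by
    refine contDiff_const.mul (ContDiff.sum fun i _ => ?_)
    refine ContDiff.mul (ContDiff.add (contDiff_const.mul ?_) contDiff_const) contDiff_const
    refine Complex.ofRealCLM.contDiff.comp ?_
    exact (contDiff_apply ℝ ℝ i).comp (((toR D.A).mulVecLin.toContinuousLinearMap.contDiff).comp
      contDiff_fst)
  compat k u v a b := by
    have h1 := ((Complex.ofRealCLM.hasFDerivAt).comp u (D.expo_fderiv k u)).const_mul Complex.I
    have h2 := (h1.cexp.mul_const
      (D.word k a b))
    have h3 : (fun x => D.trans k x a b) = fun x =>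
        Complex.exp (Complex.I * (Complex.ofRealCLM ∘ D.expo k) x) * D.word k a b := by
      ext x; simp [trans, Matrix.smul_apply]
    rw [h3, h2.fderiv]
    have hpi : (π : ℂ) ≠ 0 := by exact_mod_cast Real.pi_ne_zero
    have hdiff : ∀ (_ : Fin n → ℝ), (toR D.A *ᵥ (u + period k).1) =
        toR D.A *ᵥ u.1 + (2 * π) • (toR D.A *ᵥ fun i => (k.1 i : ℝ)) := by
      intro _
      rw [Prod.fst_add, Matrix.mulVec_add, ← Matrix.mulVec_smul]
      rfl
    simp only [LinearMap.coe_mk, AddHom.coe_mk, hdiff u.1, ← mul_sub, ← Finset.sum_sub_distrib]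
    have hs : ∀ i, ((1 / (D.r : ℂ)) * (((toR D.A *ᵥ u.1 +
        (2 * π) • (toR D.A *ᵥ fun i => (k.1 i : ℝ))) i : ℝ) : ℂ) + (1 / (D.r : ℂ)) * μ i)
          * (v.2 i : ℂ) - ((1 / (D.r : ℂ)) * (((toR D.A *ᵥ u.1) i : ℝ) : ℂ)
          + (1 / (D.r : ℂ)) * μ i) * (v.2 i : ℂ)
        = 2 * π * (1 / (D.r : ℂ) * ((((toR D.A *ᵥ fun i => (k.1 i : ℝ)) i * v.2 i : ℝ)) : ℂ)) := by
      intro i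
      simp only [Pi.add_apply, Pi.smul_apply, smul_eq_mul, Complex.ofReal_add, Complex.ofReal_mul,
        Complex.ofReal_ofNat]
      ring
    rw [Finset.sum_congr rfl fun i _ => hs i, ← Finset.mul_sum, ← Finset.mul_sum,
      ← Complex.ofReal_sum]
    have h4 : D.trans k u a b = Complex.exp (Complex.I * D.expo k u) * D.word k a b := rfl
    rw [h4]
    simp [dotProduct]
    field_simp
    ring

/-- Transition function in the direction `X_j ↦ X_j + 2π`: it is `exp((𝐢/r) a_j Y) V_j`, with `a_j`
the `j`-th column of `A`. -/
theorem trans_X (D : TransData n) (j : Fin n) (u : Cover n) :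
    D.trans (Pi.single j 1, 0) u
      = Complex.exp (Complex.I / D.r * ∑ i, (D.A i j : ℂ) * (u.2 i : ℂ)) •
        (D.V j : Matrix (Fin D.rk) (Fin D.rk) ℂ) := by
  have h : (fun i => ((Pi.single j 1 : Fin n → ℤ) i : ℝ)) = Pi.single j 1 := by
    ext i; by_cases hij : i = j
    · subst hij; simp
    · simp [hij]
  have h2 : (period ((Pi.single j 1, 0) : Deck n)).2 = 0 := by ext; simp [period]
  unfold trans word expo
  rw [zpowProd_single, zpowProd_zero, mul_one, h2, h, Matrix.mulVec_single_one]
  congr 2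
  simp only [dotProduct, Matrix.col_apply, Matrix.map_apply, add_zero]
  push_cast
  ring

/-- Transition function in the direction `Y_k ↦ Y_k + 2π`: it is `U_k`. -/
theorem trans_Y (D : TransData n) (k : Fin n) (u : Cover n) :
    D.trans (0, Pi.single k 1) u = (D.U k : Matrix (Fin D.rk) (Fin D.rk) ℂ) := by
  have h : (fun i : Fin n => ((0 : Fin n → ℤ) i : ℝ)) = 0 := by ext; simp
  unfold trans word expo
  rw [zpowProd_single, zpowProd_zero, one_mul, h]
  simp

end TransData

/-- An object of the DG-category `𝒟𝒢^φ` of the complex torus `ℂⁿ / 2π(ℤⁿ ⊕ Tℤⁿ)`: data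
`(r, A, 𝒰)` and `μ = p + T'ᵗ q` such that the bundle `φ^*E_(r,A,μ,𝒰)` is holomorphic and simple. -/
structure DGObj {n : ℕ} (T : Matrix (Fin n) (Fin n) ℂ) (δ : Matrix (Fin n) (Fin n) ℤ) where
  /-- `(r, A, 𝒰)` -/
  data : TransData n
  /-- the real part `p` of `μ` -/
  p : Fin n → ℝ
  /-- the component `q` of `μ` along `T'ᵗ` -/
  q : Fin n → ℝ
  hol : TorusBundle.IsHolomorphic T ((data.bundle ((fun i => (p i : ℂ))
    + (Tprime T δ)ᵀ *ᵥ fun i => (q i : ℂ))).pullback δ)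
  simple : TorusBundle.IsSimple T ((data.bundle ((fun i => (p i : ℂ))
    + (Tprime T δ)ᵀ *ᵥ fun i => (q i : ℂ))).pullback δ)

namespace DGObj

variable {n : ℕ} {T : Matrix (Fin n) (Fin n) ℂ} {δ : Matrix (Fin n) (Fin n) ℤ}

/-- `μ = p + T'ᵗ q` -/
def mu (E : DGObj T δ) : Fin n → ℂ :=
  (fun i => (E.p i : ℂ)) + (Tprime T δ)ᵀ *ᵥ fun i => (E.q i : ℂ)

/-- The bundle `φ^*E_(r,A,μ,𝒰)` with its connection. -/
def bundle (E : DGObj T δ) : TorusBundle n := (E.data.bundle E.mu).pullback δ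

/-- Isomorphism of objects of `𝒟𝒢^φ`. -/
instance isoSetoid (T : Matrix (Fin n) (Fin n) ℂ) (δ : Matrix (Fin n) (Fin n) ℤ) :
    Setoid (DGObj T δ) where
  r E E' := TorusBundle.Isomorphic T E.bundle E'.bundle
  iseqv := (TorusBundle.isomorphic_equivalence T).comap bundle

end DGObj

/-! ### Affine objects of the Fukaya category of the mirror torus -/

/-- Data `(r, A, p, q)` of an affine submanifold and a flat line bundle along it. -/
structure AffData (n : ℕ) where
  /-- `r` -/
  r : ℕ
  r_pos : 0 < r
  /-- `A` -/
  A : Matrix (Fin n) (Fin n) ℤ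
  /-- `p` -/
  p : Fin n → ℝ
  /-- `q` -/
  q : Fin n → ℝ

/-- The value on two tangent vectors of the constant two-form `dxᵗ W dy`. -/
def twoForm {n : ℕ} (W : Matrix (Fin n) (Fin n) ℝ) (v w : Cover n) : ℝ :=
  v.1 ⬝ᵥ (W *ᵥ w.2) - w.1 ⬝ᵥ (W *ᵥ v.2)

namespace AffData

variable {n : ℕ}

/-- The parametrization `y ↦ (-(1/r) A y + (1/r) p, y)` of the affine submanifold. -/
def param (a : AffData n) (y : Fin n → ℝ) : Cover n :=
  (-(1 / (a.r : ℝ)) • (toR a.A *ᵥ y) + (1 / (a.r : ℝ)) • a.p, y)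

/-- The same parametrization as a map to the torus. It is a covering of its image `L̃_(r,A,p)`. -/
def point (a : AffData n) (y : Fin n → ℝ) : Torus n :=
  (fun i => (((a.param y).1 i : ℝ) : AddCircle (2 * π)),
    fun i => (((a.param y).2 i : ℝ) : AddCircle (2 * π)))

/-- The `n`-dimensional submanifold `L̃_(r,A,p) = {(x, y) | x = -(1/r) A y + (1/r) p}` of the
torus. -/
def L (a : AffData n) : Set (Torus n) := Set.range a.point

/-- The tangent vector of `L̃_(r,A,p)` at `point y` corresponding to the vector `v` of parameters. -/
def tangent (a : AffData n) (y v : Fin n → ℝ) : Cover n := fderiv ℝ a.param y v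

/-- The connection one-form `(𝐢/2π)(1/r) qᵗ dy` of the connection `d + (𝐢/2π)(1/r) qᵗ dy` on the
trivial line bundle `ℒ̃_(r,A,p,q)` on `L̃_(r,A,p)`, evaluated on a tangent vector `v`. -/
def connForm (a : AffData n) (v : Cover n) : ℂ :=
  Complex.I / (2 * π) * (1 / (a.r : ℂ)) * ((a.q ⬝ᵥ v.2 : ℝ) : ℂ)

/-- The curvature form of that connection, in the coordinates of the parametrization. -/
def curvature (a : AffData n) (y v w : Fin n → ℝ) : ℂ :=
  fderiv ℝ (fun x => a.connForm (a.tangent x w)) y v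
    - fderiv ℝ (fun x => a.connForm (a.tangent x v)) y w

/-- `(L̃_(r,A,p), ℒ̃_(r,A,p,q))` is an object of the Fukaya category of the torus with the
complexified symplectic form `dxᵗ τ dy`, i.e. with symplectic form `ω = dxᵗ (Im τ) dy` and B-field
`B = dxᵗ (Re τ) dy`: the `n`-dimensional submanifold is Lagrangian, and the curvature of the line
bundle is the restriction of `2π𝐢 B`. -/
structure IsFukObj (τ : Matrix (Fin n) (Fin n) ℂ) (a : AffData n) : Prop where
  lagrangian : ∀ y v w, twoForm (τ.map Complex.im) (a.tangent y v) (a.tangent y w) = 0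
  curv : ∀ y v w, a.curvature y v w
    = 2 * π * Complex.I * (twoForm (τ.map Complex.re) (a.tangent y v) (a.tangent y w) : ℝ)

/-- Isomorphism of the affine objects: the submanifolds are equal, and the line bundles with
connection on them are isomorphic, i.e. there is a smooth nowhere vanishing function `f` on the
submanifold with `∇' (f s) = f ∇ s` for all sections `s`. -/
def Isomorphic (a b : AffData n) : Prop :=
  a.L = b.L ∧ ∃ f : Torus n → ℂ, ContDiff ℝ ∞ (fun y => f (a.point y)) ∧
    (∀ y, f (a.point y) ≠ 0) ∧
    ∀ y v, fderiv ℝ (fun x => f (a.point x)) y v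
      + (b.connForm (a.tangent y v) - a.connForm (a.tangent y v)) * f (a.point y) = 0

theorem tangent_eq (a : AffData n) (y v : Fin n → ℝ) :
    a.tangent y v = (-(1 / (a.r : ℝ)) • (toR a.A *ᵥ v), v) := by
  set ℓ : (Fin n → ℝ) →ₗ[ℝ] Cover n :=
    LinearMap.prod (-(1 / (a.r : ℝ)) • (toR a.A).mulVecLin) LinearMap.id with hl
  have h : a.param = fun y => LinearMap.toContinuousLinearMap ℓ y
      + ((1 / (a.r : ℝ)) • a.p, (0 : Fin n → ℝ)) := by
    funext y
    refine Prod.ext ?_ ?_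
    · simp [param, hl]
    · simp [param, hl]
  have h2 : HasFDerivAt a.param (LinearMap.toContinuousLinearMap ℓ) y := by
    rw [h]; exact (ContinuousLinearMap.hasFDerivAt _).add_const _
  unfold tangent
  rw [h2.fderiv]
  simp [hl]

theorem coe_eq_coe {s t : ℝ} (h : (s : AddCircle (2 * π)) = t) : ∃ k : ℤ, t = s + k * (2 * π) := by
  obtain ⟨k, hk⟩ := AddSubgroup.mem_zmultiples_iff.1 (QuotientAddGroup.eq.1 h)
  refine ⟨k, ?_⟩
  rw [zsmul_eq_mul] at hk
  rw [hk]; ring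

theorem coe_add_period (s : ℝ) (k : ℤ) :
    ((s + k * (2 * π) : ℝ) : AddCircle (2 * π)) = s := by
  rw [AddCircle.coe_add]
  have : ((k * (2 * π) : ℝ) : AddCircle (2 * π)) = 0 := by
    rw [← zsmul_eq_mul, AddCircle.coe_zsmul, AddCircle.coe_period, smul_zero]
  rw [this, add_zero]

theorem slope_eq_of_L_eq {a b : AffData n} (h : a.L = b.L) (y : Fin n → ℝ) :
    (1 / (b.r : ℝ)) • (toR b.A *ᵥ y) = (1 / (a.r : ℝ)) • (toR a.A *ᵥ y) := by
  funext i
  by_contra hne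
  set x : ℝ := ((1 / (a.r : ℝ)) • (toR a.A *ᵥ y)) i - ((1 / (b.r : ℝ)) • (toR b.A *ᵥ y)) i with hx
  have hx0 : x ≠ 0 := fun h0 => hne (sub_eq_zero.1 (hx ▸ h0)).symm
  let S : (Fin n → ℤ) × ℤ → ℝ := fun m =>
    ((1 / (a.r : ℝ)) • a.p) i - ((1 / (b.r : ℝ)) • b.p) i
      - ((1 / (a.r : ℝ)) • (toR a.A *ᵥ fun j => (m.1 j : ℝ) * (2 * π))) i + m.2 * (2 * π)
  have key : ∀ t : ℝ, ∃ m, S m = t * x := by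
    intro t
    have hm : b.point (t • y) ∈ a.L := h ▸ Set.mem_range_self _
    obtain ⟨z, hz⟩ := hm
    have h2 : ∀ j, ∃ k : ℤ, z j = (t • y) j + k * (2 * π) := fun j =>
      coe_eq_coe (congrFun (congrArg Prod.snd hz) j).symm
    choose m hm using h2
    obtain ⟨k, hk⟩ := coe_eq_coe (congrFun (congrArg Prod.fst hz) i)
    have hz' : z = t • y + fun j => (m j : ℝ) * (2 * π) := funext hm
    refine ⟨(m, k), ?_⟩
    simp only [param, hz', Matrix.mulVec_add, Matrix.mulVec_smul, Pi.add_apply, Pi.smul_apply,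
      smul_eq_mul] at hk
    simp only [S, hx, Pi.smul_apply, smul_eq_mul]
    linarith
  have hc : (Set.range S).Countable := Set.countable_range S
  have huniv : (Set.univ : Set ℝ) ⊆ (fun s => s / x) '' Set.range S := by
    intro t _
    obtain ⟨m, hm⟩ := key t
    exact ⟨_, ⟨m, rfl⟩, by simp only [hm]; field_simp⟩
  exact Set.not_countable_univ ((hc.image _).mono huniv)

theorem exists_shift {a b : AffData n} (h : a.L = b.L) :
    ∃ c : Fin n → ℝ, ∀ y, b.point y = a.point (y + c) := by
  have h0 : b.point 0 ∈ a.L := h ▸ Set.mem_range_self _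
  obtain ⟨c, hc⟩ := h0
  refine ⟨c, fun y => ?_⟩
  have hs := slope_eq_of_L_eq h y
  refine Prod.ext ?_ ?_
  · funext i
    have h1 := congrFun (congrArg Prod.fst hc) i
    have e1 : (a.param (y + c)).1 i
        = -((1 / (a.r : ℝ)) • (toR a.A *ᵥ y)) i + (a.param c).1 i := by
      simp [param, Matrix.mulVec_add]; ring
    have e2 : (b.param y).1 i
        = -((1 / (b.r : ℝ)) • (toR b.A *ᵥ y)) i + (b.param 0).1 i := by
      simp [param]
    change (((b.param y).1 i : ℝ) : AddCircle (2 * π))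
      = (((a.param (y + c)).1 i : ℝ) : AddCircle (2 * π))
    rw [e1, e2, hs, AddCircle.coe_add, AddCircle.coe_add]
    exact congrArg _ h1.symm
  · funext i
    have h1 := congrFun (congrArg Prod.snd hc) i
    change ((y i : ℝ) : AddCircle (2 * π)) = ((y i + c i : ℝ) : AddCircle (2 * π))
    have h2 : ((c i : ℝ) : AddCircle (2 * π)) = ((0 : ℝ) : AddCircle (2 * π)) := h1
    rw [AddCircle.coe_add, h2]
    simp

/-- The conditions on `f` in `Isomorphic` do not depend on the parametrization. -/
theorem transfer {a b : AffData n} (h : a.L = b.L) (f : Torus n → ℂ) (κ : Cover n → ℂ)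
    (hκ : ∀ y v, κ (b.tangent y v) = κ (a.tangent y v))
    (hf : ContDiff ℝ ∞ (fun y => f (a.point y)) ∧ (∀ y, f (a.point y) ≠ 0) ∧
      ∀ y v, fderiv ℝ (fun x => f (a.point x)) y v + κ (a.tangent y v) * f (a.point y) = 0) :
    ContDiff ℝ ∞ (fun y => f (b.point y)) ∧ (∀ y, f (b.point y) ≠ 0) ∧
      ∀ y v, fderiv ℝ (fun x => f (b.point x)) y v + κ (b.tangent y v) * f (b.point y) = 0 := by
  obtain ⟨c, hc⟩ := exists_shift h
  obtain ⟨h1, h2, h3⟩ := hf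
  refine ⟨?_, fun y => hc y ▸ h2 _, fun y v => ?_⟩
  · simp only [hc]
    exact h1.comp (contDiff_id.add contDiff_const)
  · have h4 := h3 (y + c) v
    have e : fderiv ℝ (fun x => f (b.point x)) y
        = fderiv ℝ (fun x => f (a.point x)) (y + c) := by
      simp only [hc]
      exact fderiv_comp_add_right (f := fun x => f (a.point x)) c
    rw [e, hκ, hc]
    rw [tangent_eq] at h4 ⊢
    exact h4

theorem connForm_tangent (a b d : AffData n) (y v : Fin n → ℝ) :
    d.connForm (b.tangent y v) = d.connForm (a.tangent y v) := by
  simp [connForm, tangent_eq]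

theorem isomorphic_equivalence : Equivalence (Isomorphic (n := n)) where
  refl a := ⟨rfl, fun _ => 1, contDiff_const, fun _ => one_ne_zero, fun y v => by simp⟩
  symm := by
    rintro a b ⟨hL, f, hf⟩
    obtain ⟨h1, h2, h3⟩ := transfer hL f (fun w => b.connForm w - a.connForm w)
      (fun y v => by simp only [connForm_tangent a b]) hf
    refine ⟨hL.symm, fun x => (f x)⁻¹, h1.inv h2, fun y => inv_ne_zero (h2 y), fun y v => ?_⟩
    have hd := (h1.differentiable (by simp) y).hasFDerivAt
    have h4 := h3 y v
    have hne := h2 y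
    have e : HasFDerivAt (fun x => (f (b.point x))⁻¹) _ y :=
      (hasFDerivAt_inv' hne).comp y hd
    rw [e.fderiv]
    simp
    field_simp
    linear_combination -h4
  trans := by
    rintro a b c ⟨hL, f, hf⟩ ⟨hL', g, hg⟩
    obtain ⟨h1, h2, h3⟩ := hf
    obtain ⟨h1', h2', h3'⟩ := transfer hL.symm g (fun w => c.connForm w - b.connForm w)
      (fun y v => by simp only [connForm_tangent b a]) hg
    refine ⟨hL.trans hL', fun x => f x * g x, h1.mul h1', fun y => mul_ne_zero (h2 y) (h2' y),
      fun y v => ?_⟩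
    have hd := (h1.differentiable (by simp) y).hasFDerivAt
    have hd' := (h1'.differentiable (by simp) y).hasFDerivAt
    have h5 := h3 y v
    have h6 := h3' y v
    have e : HasFDerivAt (fun x => f (a.point x) * g (a.point x)) _ y := hd.mul hd'
    rw [e.fderiv]
    simp
    linear_combination g (a.point y) * h5 + f (a.point y) * h6

end AffData

/-- An object of `Fuk_aff` of the torus with complexified symplectic form `dxᵗ τ dy`. -/
structure FukObj {n : ℕ} (τ : Matrix (Fin n) (Fin n) ℂ) where
  /-- `(r, A, p, q)` -/
  data : AffData n
  isFukObj : data.IsFukObj τ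

/-- Isomorphism of objects of `Fuk_aff`. -/
instance FukObj.isoSetoid {n : ℕ} (τ : Matrix (Fin n) (Fin n) ℂ) : Setoid (FukObj τ) where
  r a b := AffData.Isomorphic a.data b.data
  iseqv := AffData.isomorphic_equivalence.comap FukObj.data

/-! ### The mirror map -/

/-- A choice of real numbers `ξ_j`, `θ_k` with `exp(𝐢 ξ_j) = det V_j`, `exp(𝐢 θ_k) = det U_k` for all
`(r, A, 𝒰)`. -/
structure Angles (n : ℕ) where
  /-- `ξ` -/
  ξ : TransData n → Fin n → ℝ
  /-- `θ` -/
  θ : TransData n → Fin n → ℝ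
  exp_ξ : ∀ D j, Complex.exp (Complex.I * ξ D j)
    = (D.V j : Matrix (Fin D.rk) (Fin D.rk) ℂ).det
  exp_θ : ∀ D k, Complex.exp (Complex.I * θ D k)
    = (D.U k : Matrix (Fin D.rk) (Fin D.rk) ℂ).det

/-- Determinants fix `ξ` and `θ` only modulo `2π`, and `2π`-shifts change the affine submanifold in
general. The choice is consistent if, for any two triples `(r, A, 𝒰)` and `(s, B, 𝒱)` of the same
slope `A / r = B / s`, the matrices of `𝒱` are obtained from those of `𝒰` by a change of frame `g`
and multiplication by the `r'`-th roots `exp(𝐢 (ξ_j(𝒱) - ξ_j(𝒰)) / r')` and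
`exp(𝐢 (θ_k(𝒱) - θ_k(𝒰)) / r')` of the quotients of determinants. -/
def Angles.IsConsistent {n : ℕ} (a : Angles n) : Prop :=
  ∀ D D' : TransData n, (D.r : ℤ) • D'.A = (D'.r : ℤ) • D.A →
    ∃ (g : Matrix (Fin D'.rk) (Fin D.rk) ℂ) (g' : Matrix (Fin D.rk) (Fin D'.rk) ℂ),
      g * g' = 1 ∧ g' * g = 1 ∧
      (∀ j, (D'.V j : Matrix (Fin D'.rk) (Fin D'.rk) ℂ)
        = Complex.exp (Complex.I * ((a.ξ D' j - a.ξ D j) / D.rk : ℝ)) •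
          (g * (D.V j : Matrix (Fin D.rk) (Fin D.rk) ℂ) * g')) ∧
      (∀ k, (D'.U k : Matrix (Fin D'.rk) (Fin D'.rk) ℂ)
        = Complex.exp (Complex.I * ((a.θ D' k - a.θ D k) / D.rk : ℝ)) •
          (g * (D.U k : Matrix (Fin D.rk) (Fin D.rk) ℂ) * g'))

/-- The data `(r, A, p(θ), q(ξ))` attached to `φ^*E_(r,A,μ,𝒰)`, `μ = p + T'ᵗ q`, where
`p(θ) = p - (r/r') θ` and `q(ξ) = q + (r/r') ξ`. -/
def mirrorData {n : ℕ} {T : Matrix (Fin n) (Fin n) ℂ} {δ : Matrix (Fin n) (Fin n) ℤ}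
    (a : Angles n) (E : DGObj T δ) : AffData n where
  r := E.data.r
  r_pos := E.data.r_pos
  A := E.data.A
  p := E.p - ((E.data.r : ℝ) / (E.data.rk : ℝ)) • a.θ E.data
  q := E.q + ((E.data.r : ℝ) / (E.data.rk : ℝ)) • a.ξ E.data

end TorusMirror

end

open TorusMirror

noncomputable section

namespace TorusMirror

/-! ### Smith normal form of integer matrices -/

/-! The two categories have the same classification, in terms of the slope `A / r` and two lattice
classes.

Which data occur. The curvature of the pulled back bundle only involves `A / r`, and its
`(0,2)`-part vanishes exactly when `Aᵗ (T - δ)` is symmetric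
(`TransData.isHolomorphic_pullback_iff`). The connection on the affine side is flat, so both the
symplectic form and the B-field must restrict to zero; these are the imaginary and real parts of the
same symmetry (`AffData.isFukObj_iff`). Hence the mirror map lands in the Fukaya side whatever the
angles are.

Isomorphism of bundles. An isomorphism has a nowhere vanishing determinant, and comparing its
winding along the periods shows that the slope is an invariant (`sameSlope_of_isomorphic`). For a
fixed slope, the matrices of `𝒰` form an irreducible projective representation of `ℤ²ⁿ` with
prescribed commutators: `r'` is the order of the image of `A` modulo `r` (`IsRankOf.eq_card`), so
`r'²` of the words in the `V_j`, `U_k` are orthogonal for the trace form and they span all matrices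
(`span_word`). Schur's lemma follows, and two triples of the same slope differ by a frame `g` and
phases (`SameSlope.exists_frame`). Pairing a holomorphic map with a word gives a scalar function
which, after division by the exponential of an imaginary linear form, is holomorphic with
multipliers of modulus one, hence constant by Liouville (`SameSlope.trace_section`). So bundles are
isomorphic if and only if two characters of the deck group agree up to the commutator character of
some word (`SameSlope.isomorphic_iff`). Evaluated on generators, this says that the differences of
`p / r` and `q / r`, corrected by the phases of the frame, lie in `2π((1/r) A ℤⁿ + ℤⁿ)` and
`2π((1/r) Aᵗ ℤⁿ + ℤⁿ)` (`exists_word_iff`). The same estimate shows that every such bundle is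
simple.

Isomorphism of affine objects. Equal submanifolds have equal slope and positions differing by the
first lattice (`L_eq_iff`). The line bundles agree if and only if the difference of connections has
trivial holonomy on the loops `m` with `A m ∈ r ℤⁿ`, and the dual lattice computation
`mem_dual_lattice` turns this into membership in the second lattice (`lineBundle_iso_iff`).

Comparison. Consistency of the angles says that the phases of the frame are the differences of `ξ`
and `θ` divided by `r'`, so `p(θ)` and `q(ξ)` absorb the correction and the two criteria coincide
(`isomorphic_mirrorData_iff`). Consistent angles come from one reference triple per slope.
Surjectivity needs a triple for every `(r, A)`, supplied by clock and shift matrices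
(`exists_transData`). -/

/-- Equality of integer matrices up to unimodular row and column operations. -/
def UnimodEquiv {n : ℕ} (A B : Matrix (Fin n) (Fin n) ℤ) : Prop :=
  ∃ P Q : GL (Fin n) ℤ,
    (P : Matrix (Fin n) (Fin n) ℤ) * A * (Q : Matrix (Fin n) (Fin n) ℤ) = B

theorem UnimodEquiv.refl {n : ℕ} (A : Matrix (Fin n) (Fin n) ℤ) : UnimodEquiv A A :=
  ⟨1, 1, by simp⟩

theorem UnimodEquiv.trans {n : ℕ} {A B C : Matrix (Fin n) (Fin n) ℤ} (h : UnimodEquiv A B)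
    (h' : UnimodEquiv B C) : UnimodEquiv A C := by
  obtain ⟨P, Q, rfl⟩ := h
  obtain ⟨P', Q', rfl⟩ := h'
  exact ⟨P' * P, Q * Q', by simp [Matrix.mul_assoc]⟩

theorem UnimodEquiv.transpose {n : ℕ} {A B : Matrix (Fin n) (Fin n) ℤ} (h : UnimodEquiv A B) :
    UnimodEquiv Aᵀ Bᵀ := by
  obtain ⟨P, Q, rfl⟩ := h
  let t : GL (Fin n) ℤ → GL (Fin n) ℤ := fun P =>
    ⟨(P : Matrix (Fin n) (Fin n) ℤ)ᵀ, ((P⁻¹ : GL (Fin n) ℤ) : Matrix (Fin n) (Fin n) ℤ)ᵀ,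
      by rw [← Matrix.transpose_mul, Units.inv_mul, Matrix.transpose_one],
      by rw [← Matrix.transpose_mul, Units.mul_inv, Matrix.transpose_one]⟩
  exact ⟨t Q, t P, by simp [t, Matrix.transpose_mul, Matrix.mul_assoc]⟩

/-- Since `c k = 0`, the rank one matrix `c eₖᵗ` has square zero, so `1 + c eₖᵗ` has the integral
inverse `1 - c eₖᵗ`. -/
theorem unimodEquiv_row_op {n : ℕ} (A : Matrix (Fin n) (Fin n) ℤ) (k : Fin n) (c : Fin n → ℤ)
    (hc : c k = 0) : UnimodEquiv A (A + Matrix.of fun i j => c i * A k j) := by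
  have h0 : Matrix.vecMulVec c (Pi.single k 1) * Matrix.vecMulVec c (Pi.single k 1) = 0 := by
    ext i j
    simp [Matrix.mul_apply, Matrix.vecMulVec_apply, Pi.single_apply, hc]
  refine ⟨⟨1 + Matrix.vecMulVec c (Pi.single k 1), 1 - Matrix.vecMulVec c (Pi.single k 1),
    ?_, ?_⟩, 1, ?_⟩
  · rw [Matrix.add_mul, Matrix.mul_sub, Matrix.mul_sub, h0]; simp
  · rw [Matrix.sub_mul, Matrix.mul_add, Matrix.mul_add, h0]; simp
  · change (1 + Matrix.vecMulVec c (Pi.single k 1)) * A * 1 = _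
    rw [Matrix.mul_one, Matrix.add_mul, Matrix.one_mul]
    ext i j
    simp [Matrix.mul_apply, Matrix.vecMulVec_apply, Pi.single_apply]

theorem unimodEquiv_col_op {n : ℕ} (A : Matrix (Fin n) (Fin n) ℤ) (k : Fin n) (c : Fin n → ℤ)
    (hc : c k = 0) : UnimodEquiv A (A + Matrix.of fun i j => A i k * c j) := by
  have h := (unimodEquiv_row_op Aᵀ k c hc).transpose
  rw [Matrix.transpose_transpose] at h
  convert h using 1
  ext i j
  simp only [Matrix.add_apply, Matrix.of_apply, Matrix.transpose_apply, mul_comm]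

theorem unimodEquiv_submatrix {n : ℕ} (A : Matrix (Fin n) (Fin n) ℤ) (σ τ : Equiv.Perm (Fin n)) :
    UnimodEquiv A (A.submatrix σ τ) := by
  have hu : ∀ ρ : Equiv.Perm (Fin n), ρ.toPEquiv.toMatrix * ρ.symm.toPEquiv.toMatrix
      = (1 : Matrix (Fin n) (Fin n) ℤ) := fun ρ => by
    rw [← PEquiv.toMatrix_trans, ← Equiv.toPEquiv_trans]
    simp
  refine ⟨⟨σ.toPEquiv.toMatrix, σ.symm.toPEquiv.toMatrix, hu σ, hu σ.symm⟩,
    ⟨τ.symm.toPEquiv.toMatrix, τ.toPEquiv.toMatrix, hu τ.symm, hu τ⟩, ?_⟩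
  change σ.toPEquiv.toMatrix * A * τ.symm.toPEquiv.toMatrix = _
  rw [PEquiv.toMatrix_toPEquiv_mul, PEquiv.mul_toMatrix_toPEquiv]
  rfl

/-- A nonzero integer matrix is equivalent to one whose corner entry is nonzero, divides all
entries, and is the only nonzero entry of its row and column. -/
theorem exists_unimodEquiv_corner {n : ℕ} {A : Matrix (Fin (n + 1)) (Fin (n + 1)) ℤ} (hA : A ≠ 0) :
    ∃ B, UnimodEquiv A B ∧ (∀ j, j ≠ 0 → B 0 j = 0) ∧ (∀ i, i ≠ 0 → B i 0 = 0) ∧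
      ∀ i j, B 0 0 ∣ B i j := by
  classical
  -- The corner will be a nonzero entry of least absolute value among all entries of all equivalent
  -- matrices. Any remainder of a division by it is smaller, hence zero.
  have hex : ∃ k : ℕ, 0 < k ∧ ∃ B, UnimodEquiv A B ∧ ∃ i j, (B i j).natAbs = k := by
    by_contra hcon
    push Not at hcon
    refine hA (Matrix.ext fun i j => ?_)
    by_contra hij
    exact hcon _ (Int.natAbs_pos.2 hij) A (UnimodEquiv.refl A) i j rfl
  obtain ⟨hpos, B, hB, i₀, j₀, hk⟩ := Nat.find_spec hex
  set k := Nat.find hex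
  have hmin : ∀ C, UnimodEquiv A C → ∀ i j, (C i j).natAbs < k → C i j = 0 := by
    intro C hC i j hlt
    by_contra hne
    exact Nat.find_min hex hlt ⟨Int.natAbs_pos.2 hne, C, hC, i, j, rfl⟩
  have hrow : ∀ C, UnimodEquiv A C → (C 0 0).natAbs = k → ∀ j, C 0 0 ∣ C 0 j := by
    intro C hC hCk j
    by_cases hj : j = 0
    · rw [hj]
    have h1 := hmin _ (hC.trans (unimodEquiv_col_op C 0 (Pi.single j (-(C 0 j / C 0 0)))
      (by simp [Ne.symm hj]))) 0 j
    have e : C 0 j + C 0 0 * -(C 0 j / C 0 0) = C 0 j % C 0 0 := by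
      rw [Int.emod_def]; ring
    simp only [Matrix.add_apply, Matrix.of_apply, Pi.single_eq_same, e] at h1
    have hne : C 0 0 ≠ 0 := fun h0 => by rw [h0] at hCk; simp at hCk; omega
    refine Int.dvd_of_emod_eq_zero (h1 ?_)
    have h2 := Int.emod_lt_abs (C 0 j) hne
    have h3 := Int.emod_nonneg (C 0 j) hne
    rw [← hCk]
    zify
    rwa [abs_of_nonneg h3]
  have hcol : ∀ C, UnimodEquiv A C → (C 0 0).natAbs = k → ∀ i, C 0 0 ∣ C i 0 := by
    intro C hC hCk i
    by_cases hi : i = 0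
    · rw [hi]
    have h1 := hmin _ (hC.trans (unimodEquiv_row_op C 0 (Pi.single i (-(C i 0 / C 0 0)))
      (by simp [Ne.symm hi]))) i 0
    have e : C i 0 + -(C i 0 / C 0 0) * C 0 0 = C i 0 % C 0 0 := by
      rw [Int.emod_def]; ring
    simp only [Matrix.add_apply, Matrix.of_apply, Pi.single_eq_same, e] at h1
    have hne : C 0 0 ≠ 0 := fun h0 => by rw [h0] at hCk; simp at hCk; omega
    refine Int.dvd_of_emod_eq_zero (h1 ?_)
    have h2 := Int.emod_lt_abs (C i 0) hne
    have h3 := Int.emod_nonneg (C i 0) hne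
    rw [← hCk]
    zify
    rwa [abs_of_nonneg h3]
  set C := B.submatrix (Equiv.swap 0 i₀) (Equiv.swap 0 j₀) with hCdef
  have hC : UnimodEquiv A C := hB.trans (unimodEquiv_submatrix B _ _)
  have hCk : (C 0 0).natAbs = k := by simp [hCdef, hk]
  set E := C + Matrix.of fun i j => (if i = 0 then 0 else -(C i 0 / C 0 0)) * C 0 j with hEdef
  have hE : UnimodEquiv A E :=
    hC.trans (unimodEquiv_row_op C 0 (fun i => if i = 0 then 0 else -(C i 0 / C 0 0)) (by simp))
  have hE0 : ∀ j, E 0 j = C 0 j := fun j => by simp [hEdef]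
  have hEk : (E 0 0).natAbs = k := by rw [hE0, hCk]
  have hEcol : ∀ i, i ≠ 0 → E i 0 = 0 := by
    intro i hi
    have := Int.ediv_mul_cancel (hcol C hC hCk i)
    simp only [hEdef, Matrix.add_apply, Matrix.of_apply, if_neg hi]
    linarith
  set F := E + Matrix.of fun i j => E i 0 * (if j = 0 then 0 else -(E 0 j / E 0 0)) with hFdef
  have hF : UnimodEquiv A F :=
    hE.trans (unimodEquiv_col_op E 0 (fun j => if j = 0 then 0 else -(E 0 j / E 0 0)) (by simp))
  have hF0 : ∀ i, F i 0 = E i 0 := fun i => by simp [hFdef]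
  have hFk : (F 0 0).natAbs = k := by rw [hF0, hEk]
  have hFrow : ∀ j, j ≠ 0 → F 0 j = 0 := by
    intro j hj
    have := Int.mul_ediv_cancel' (hrow E hE hEk j)
    simp only [hFdef, Matrix.add_apply, Matrix.of_apply, if_neg hj]
    linarith
  refine ⟨F, hF, hFrow, fun i hi => by rw [hF0, hEcol i hi], fun i j => ?_⟩
  by_cases hi : i = 0
  · rw [hi]; exact hrow F hF hFk j
  -- Adding row `i` to row `0` keeps the corner, because `F i 0 = 0`, and puts `F i j` into the
  -- first row, where divisibility is already known.
  have hG := hF.trans (unimodEquiv_row_op F i (Pi.single 0 1) (by simp [hi]))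
  have h2 := hrow _ hG (by simp [hF0, hEcol i hi, hEk]) j
  simp only [Matrix.add_apply, Matrix.of_apply, Pi.single_eq_same, one_mul, hF0, hEcol i hi,
    add_zero] at h2
  by_cases hj : j = 0
  · rw [hj, hF0, hF0, hEcol i hi]; exact dvd_zero _
  · rw [hFrow j hj, zero_add] at h2
    rwa [hF0]

/-- The block matrix with blocks `a` and `M`. -/
def cornerBlock {n : ℕ} (a : ℤ) (M : Matrix (Fin n) (Fin n) ℤ) :
    Matrix (Fin (n + 1)) (Fin (n + 1)) ℤ :=
  Matrix.of (Fin.cons (Fin.cons a 0) fun i => Fin.cons 0 (M i))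

theorem cornerBlock_mul {n : ℕ} (a b : ℤ) (M N : Matrix (Fin n) (Fin n) ℤ) :
    cornerBlock a M * cornerBlock b N = cornerBlock (a * b) (M * N) := by
  ext i j
  refine Fin.cases ?_ (fun i => ?_) i <;> refine Fin.cases ?_ (fun j => ?_) j <;>
    simp [cornerBlock, Matrix.mul_apply, Fin.sum_univ_succ]

theorem cornerBlock_diagonal {n : ℕ} (a : ℤ) (d : Fin n → ℤ) :
    cornerBlock a (Matrix.diagonal d) = Matrix.diagonal (Fin.cons a d : Fin (n + 1) → ℤ) := by
  ext i j
  refine Fin.cases ?_ (fun i => ?_) i <;> refine Fin.cases ?_ (fun j => ?_) j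
  · simp [cornerBlock]
  · simp [cornerBlock, (Fin.succ_ne_zero j).symm]
  · simp [cornerBlock]
  · simp [cornerBlock, Matrix.diagonal_apply]

theorem cornerBlock_one {n : ℕ} :
    cornerBlock 1 (1 : Matrix (Fin n) (Fin n) ℤ) = 1 := by
  rw [← Matrix.diagonal_one, cornerBlock_diagonal, ← Matrix.diagonal_one]
  congr 1
  ext i
  refine Fin.cases ?_ (fun i => ?_) i <;> simp

/-- Smith normal form. -/
theorem exists_smith {n : ℕ} (A : Matrix (Fin n) (Fin n) ℤ) :
    ∃ d : Fin n → ℕ, UnimodEquiv A (Matrix.diagonal fun i => (d i : ℤ)) ∧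
      ∀ i j, i ≤ j → d i ∣ d j := by
  induction n with
  | zero => exact ⟨0, ⟨1, 1, by ext i; exact i.elim0⟩, fun i => i.elim0⟩
  | succ n ih =>
    by_cases hA : A = 0
    · exact ⟨0, ⟨1, 1, by simp [hA]⟩, fun i j _ => by simp⟩
    obtain ⟨B, hB, hrow, hcol, hdvd⟩ := exists_unimodEquiv_corner hA
    obtain ⟨d, ⟨P, Q, hPQ⟩, hd⟩ := ih (B.submatrix Fin.succ Fin.succ)
    have hBb : B = cornerBlock (B 0 0) (B.submatrix Fin.succ Fin.succ) := by
      ext i j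
      refine Fin.cases ?_ (fun i => ?_) i <;> refine Fin.cases ?_ (fun j => ?_) j <;>
        simp [cornerBlock, hrow, hcol]
    have hdiv : ∀ i, (B 0 0).natAbs ∣ d i := by
      intro i
      have h1 : ((d i : ℕ) : ℤ) = ∑ x, (∑ y, (P : Matrix (Fin n) (Fin n) ℤ) i y
          * B y.succ x.succ) * (Q : Matrix (Fin n) (Fin n) ℤ) x i := by
        have := congrFun (congrFun hPQ i) i
        simpa [Matrix.mul_apply] using this.symm
      have h2 : B 0 0 ∣ ((d i : ℕ) : ℤ) := by
        rw [h1]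
        exact Finset.dvd_sum fun x _ => Dvd.dvd.mul_right
          (Finset.dvd_sum fun y _ => Dvd.dvd.mul_left (hdvd _ _) _) _
      simpa using Int.natAbs_dvd_natAbs.2 h2
    -- The sign `s` makes the corner nonnegative, since elementary divisors are natural numbers.
    obtain ⟨s, hs, hsb⟩ : ∃ s : ℤ, s * s = 1 ∧ s * B 0 0 = (B 0 0).natAbs := by
      rcases le_total 0 (B 0 0) with h | h
      · exact ⟨1, by norm_num, by omega⟩
      · exact ⟨-1, by norm_num, by omega⟩
    refine ⟨Fin.cons (B 0 0).natAbs d, hB.trans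
      ⟨⟨cornerBlock s P, cornerBlock s (P⁻¹ : GL (Fin n) ℤ), ?_, ?_⟩,
        ⟨cornerBlock 1 Q, cornerBlock 1 (Q⁻¹ : GL (Fin n) ℤ), ?_, ?_⟩, ?_⟩, ?_⟩
    · rw [cornerBlock_mul, hs, Units.mul_inv, cornerBlock_one]
    · rw [cornerBlock_mul, hs, Units.inv_mul, cornerBlock_one]
    · rw [cornerBlock_mul, Units.mul_inv, one_mul, cornerBlock_one]
    · rw [cornerBlock_mul, Units.inv_mul, one_mul, cornerBlock_one]
    · change cornerBlock s P * B * cornerBlock 1 Q = _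
      rw [hBb, cornerBlock_mul, cornerBlock_mul, mul_one, ← hBb, hsb, hPQ, cornerBlock_diagonal]
      congr 1
      ext i
      refine Fin.cases ?_ (fun i => ?_) i <;> simp
    · intro i j
      refine Fin.cases ?_ (fun i => ?_) i <;> refine Fin.cases ?_ (fun j => ?_) j
      · simp
      · simpa using hdiv j
      · simp
      · simpa using hd i j

theorem exists_isRankOf {n : ℕ} (r : ℕ) (A : Matrix (Fin n) (Fin n) ℤ) : ∃ k, IsRankOf r A k := by
  obtain ⟨d, ⟨P, Q, h⟩, hd⟩ := exists_smith A
  exact ⟨_, P, Q, d, h, hd, rfl⟩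

theorem IsRankOf.transpose {n : ℕ} {r k : ℕ} {A : Matrix (Fin n) (Fin n) ℤ} (h : IsRankOf r A k) :
    IsRankOf r Aᵀ k := by
  obtain ⟨P, Q, d, h, hd, hk⟩ := h
  obtain ⟨P', Q', h'⟩ := UnimodEquiv.transpose ⟨P, Q, h⟩
  exact ⟨P', Q', d, by rw [h', Matrix.diagonal_transpose], hd, hk⟩

theorem IsRankOf.pos {n : ℕ} {r k : ℕ} {A : Matrix (Fin n) (Fin n) ℤ} (hr : 0 < r)
    (h : IsRankOf r A k) : 0 < k := by
  obtain ⟨P, Q, d, -, -, rfl⟩ := h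
  exact Finset.prod_pos fun i _ =>
    Nat.div_pos (Nat.le_of_dvd hr (Nat.gcd_dvd_left _ _)) (Nat.gcd_pos_of_pos_left _ hr)

/-! ### The image of an integer matrix modulo `r` -/

/-- Reduction of an integer matrix modulo `r`. -/
abbrev modMat {n : ℕ} (r : ℕ) (A : Matrix (Fin n) (Fin n) ℤ) :
    Matrix (Fin n) (Fin n) (ZMod r) :=
  A.map (Int.castRingHom (ZMod r))

/-- The image of `A` in `(ℤ / r)ⁿ`. -/
abbrev imageMod {n : ℕ} (r : ℕ) (A : Matrix (Fin n) (Fin n) ℤ) :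
    Submodule (ZMod r) (Fin n → ZMod r) :=
  LinearMap.range (modMat r A).mulVecLin

/-- The multiples of `d` form the cyclic subgroup generated by `d`, whose order is `r / gcd(r, d)`.
-/
theorem card_range_mulLeft_zmod (r d : ℕ) (hr : 0 < r) :
    Nat.card (Set.range fun x : ZMod r => (d : ZMod r) * x) = r / Nat.gcd r d := by
  have : NeZero r := ⟨hr.ne'⟩
  have h : Set.range (fun x : ZMod r => (d : ZMod r) * x)
      = (AddSubgroup.zmultiples (d : ZMod r) : Set (ZMod r)) := by
    ext y
    constructor
    · rintro ⟨x, rfl⟩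
      refine AddSubgroup.mem_zmultiples_iff.2 ⟨x.val, ?_⟩
      simp [mul_comm]
    · intro hy
      obtain ⟨k, hk⟩ := AddSubgroup.mem_zmultiples_iff.1 hy
      exact ⟨k, by rw [← hk]; simp [mul_comm]⟩
  rw [h]
  change Nat.card (AddSubgroup.zmultiples (d : ZMod r)) = _
  rw [Nat.card_zmultiples, ZMod.addOrderOf_coe _ hr.ne']

/-- Unimodular matrices stay invertible modulo `r`, so `P` carries the image of `A` onto the product
of the subgroups `dᵢ (ℤ/r)`. This frees `r'` from the choice of a normal form and makes it usable
for counting words and for indexing a basis. -/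
theorem IsRankOf.eq_card {n : ℕ} {r k : ℕ} {A : Matrix (Fin n) (Fin n) ℤ} (hr : 0 < r)
    (h : IsRankOf r A k) : k = Nat.card (imageMod r A) := by
  obtain ⟨P, Q, d, hPQ, -, rfl⟩ := h
  set f := (Int.castRingHom (ZMod r)).mapMatrix (m := Fin n) with hf
  have hunit : ∀ P : GL (Fin n) ℤ, f P * f (P⁻¹ : GL (Fin n) ℤ) = 1 := fun P => by
    rw [← map_mul, Units.mul_inv, map_one]
  have hunit' : ∀ P : GL (Fin n) ℤ, f (P⁻¹ : GL (Fin n) ℤ) * f P = 1 := fun P => by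
    rw [← map_mul, Units.inv_mul, map_one]
  have hD : f P * f A * f Q = Matrix.diagonal fun i => ((d i : ℕ) : ZMod r) := by
    rw [← map_mul, ← map_mul, hPQ]
    ext i j
    by_cases hij : i = j
    · subst hij; simp [hf]
    · simp [hf, hij]
  have e1 : (imageMod r A : Set (Fin n → ZMod r)) ≃
      {v : Fin n → ZMod r | ∀ i, v i ∈ Set.range fun x : ZMod r => (d i : ZMod r) * x} :=
    { toFun := fun v => ⟨f P *ᵥ v.1, by
        obtain ⟨w, hw⟩ := v.2
        intro i
        refine ⟨(f (Q⁻¹ : GL (Fin n) ℤ) *ᵥ w) i, ?_⟩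
        have : f P *ᵥ v.1 = (Matrix.diagonal fun i => ((d i : ℕ) : ZMod r)) *ᵥ
            (f (Q⁻¹ : GL (Fin n) ℤ) *ᵥ w) := by
          rw [← hD, ← hw, Matrix.mulVec_mulVec, Matrix.mul_assoc, hunit, Matrix.mul_one,
            ← Matrix.mulVec_mulVec]
          rfl
        rw [this, Matrix.mulVec_diagonal]⟩
      invFun := fun v => ⟨f (P⁻¹ : GL (Fin n) ℤ) *ᵥ v.1, by
        choose w hw using v.2
        refine ⟨f Q *ᵥ w, ?_⟩
        have : v.1 = f P *ᵥ (f A *ᵥ (f Q *ᵥ w)) := by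
          rw [Matrix.mulVec_mulVec, Matrix.mulVec_mulVec, hD]
          ext i
          rw [Matrix.mulVec_diagonal, ← hw i]
        rw [this, Matrix.mulVec_mulVec _ (f (P⁻¹ : GL (Fin n) ℤ)), hunit', Matrix.one_mulVec]
        rfl⟩
      left_inv := fun v => Subtype.ext (by
        change f (P⁻¹ : GL (Fin n) ℤ) *ᵥ (f P *ᵥ v.1) = v.1
        rw [Matrix.mulVec_mulVec, hunit', Matrix.one_mulVec])
      right_inv := fun v => Subtype.ext (by
        change f P *ᵥ (f (P⁻¹ : GL (Fin n) ℤ) *ᵥ v.1) = v.1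
        rw [Matrix.mulVec_mulVec, hunit, Matrix.one_mulVec]) }
  have e2 : {v : Fin n → ZMod r | ∀ i, v i ∈ Set.range fun x : ZMod r => (d i : ZMod r) * x} ≃
      ∀ i, Set.range fun x : ZMod r => (d i : ZMod r) * x :=
    Equiv.subtypePiEquivPi
  have h3 := Nat.card_congr (e1.trans e2)
  rw [Nat.card_pi] at h3
  simp only [card_range_mulLeft_zmod _ _ hr] at h3
  exact h3.symm

/-! ### Duality of lattices -/

/-- The lattice dual to `{m ∈ ℤⁿ | A m ∈ r ℤⁿ}` is `ℤⁿ + (1/r) Aᵗ ℤⁿ`. -/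
theorem mem_dual_lattice {n : ℕ} {r : ℕ} (hr : 0 < r) (A : Matrix (Fin n) (Fin n) ℤ)
    (b : Fin n → ℝ)
    (hb : ∀ m : Fin n → ℤ, (∀ i, (r : ℤ) ∣ (A *ᵥ m) i) → ∃ z : ℤ, ∑ i, b i * (m i : ℝ) = z) :
    ∃ l₀ l₁ : Fin n → ℤ, ∀ i, b i = (((Aᵀ *ᵥ l₀) i : ℤ) : ℝ) / r + (l₁ i : ℝ) := by
  obtain ⟨d, ⟨P, Q, hPQ⟩, -⟩ := exists_smith A
  have hr' : (r : ℝ) ≠ 0 := by exact_mod_cast hr.ne'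
  have hAQ : A * (Q : Matrix (Fin n) (Fin n) ℤ) = ((P⁻¹ : GL (Fin n) ℤ) : Matrix (Fin n) (Fin n) ℤ)
      * Matrix.diagonal fun i => (d i : ℤ) := by
    rw [← hPQ, Matrix.mul_assoc, ← Matrix.mul_assoc, Units.inv_mul, Matrix.one_mul]
  set g : Fin n → ℕ := fun i => Nat.gcd r (d i) with hg
  have hgr : ∀ i, ((r / g i : ℕ) : ℤ) * g i = r := fun i => by
    exact_mod_cast Nat.div_mul_cancel (Nat.gcd_dvd_left r (d i))
  have key : ∀ i, ∃ z : ℤ, (∑ j, b j * ((Q : Matrix (Fin n) (Fin n) ℤ) j i : ℝ))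
      * (r / g i : ℕ) = z := by
    intro i
    -- The test vector is `r / gcd(r, dᵢ)` times the `i`-th column of `Q`: since `A Q = P⁻¹ D`, its
    -- image under `A` is `dᵢ r / gcd(r, dᵢ)` times a column of `P⁻¹`, which is divisible by `r`.
    obtain ⟨z, hz⟩ := hb ((Q : Matrix (Fin n) (Fin n) ℤ) *ᵥ Pi.single i ((r / g i : ℕ) : ℤ)) (by
      intro k
      rw [Matrix.mulVec_mulVec, hAQ, ← Matrix.mulVec_mulVec]
      change (r : ℤ) ∣ ∑ j, ((P⁻¹ : GL (Fin n) ℤ) : Matrix (Fin n) (Fin n) ℤ) k j * _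
      refine Finset.dvd_sum fun j _ => Dvd.dvd.mul_left ?_ _
      rw [Matrix.mulVec_diagonal]
      by_cases hj : j = i
      · subst hj
        rw [Pi.single_eq_same]
        obtain ⟨e, he⟩ := Nat.gcd_dvd_right r (d j)
        refine ⟨e, ?_⟩
        rw [← hgr j]
        have : (d j : ℤ) = g j * e := by exact_mod_cast he
        rw [this]; ring
      · simp [hj])
    refine ⟨z, ?_⟩
    rw [← hz, Finset.sum_mul]
    refine Finset.sum_congr rfl fun j _ => ?_
    have h8 : ((Q : Matrix (Fin n) (Fin n) ℤ) *ᵥ Pi.single i ((r / g i : ℕ) : ℤ)) j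
        = (Q : Matrix (Fin n) (Fin n) ℤ) j i * ((r / g i : ℕ) : ℤ) := by
      rw [Matrix.mulVec_single]
      rfl
    rw [h8, Int.cast_mul, Int.cast_natCast]
    ring
  choose z hz using key
  -- The `i`-th coordinate of `b Q` is an integer times `gcd(r, dᵢ) / r`; Bézout writes the gcd as a
  -- combination of `r` and `dᵢ`.
  have hbez : ∀ i, ∃ x y : ℤ, (∑ j, b j * ((Q : Matrix (Fin n) (Fin n) ℤ) j i : ℝ))
      = (d i : ℝ) / r * x + y := by
    intro i
    have h1 := Nat.gcd_eq_gcd_ab r (d i)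
    refine ⟨z i * Nat.gcdB r (d i), z i * Nat.gcdA r (d i), ?_⟩
    have h2 := hz i
    have h3 : ((r / g i : ℕ) : ℝ) * g i = r := by exact_mod_cast hgr i
    have h4 : (g i : ℝ) = r * (Nat.gcdA r (d i) : ℝ) + d i * (Nat.gcdB r (d i) : ℝ) := by
      exact_mod_cast h1
    set X := ∑ j, b j * ((Q : Matrix (Fin n) (Fin n) ℤ) j i : ℝ)
    have h5 : X * r = z i * g i := by rw [← h2, ← h3]; ring
    have h6 : X = z i * g i / r := by rw [← h5]; field_simp
    rw [h6, h4]
    push_cast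
    field_simp
    ring
  choose x y hxy using hbez
  have hb2 : ∀ j, b j = ∑ i, ((d i : ℝ) / r * x i + y i)
      * (((Q⁻¹ : GL (Fin n) ℤ) : Matrix (Fin n) (Fin n) ℤ) i j : ℝ) := by
    intro j
    simp only [← hxy, Finset.sum_mul]
    rw [Finset.sum_comm]
    have h7 : ∀ k, ∑ i, ((Q : Matrix (Fin n) (Fin n) ℤ) k i : ℝ)
        * (((Q⁻¹ : GL (Fin n) ℤ) : Matrix (Fin n) (Fin n) ℤ) i j : ℝ) = if k = j then 1 else 0 := by
      intro k
      have := congrFun (congrFun (Units.mul_inv Q) k) j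
      rw [Matrix.mul_apply, Matrix.one_apply] at this
      exact_mod_cast congrArg (Int.cast : ℤ → ℝ) this
    simp only [mul_assoc, ← Finset.mul_sum, h7]
    simp
  have hA2 : A = ((P⁻¹ : GL (Fin n) ℤ) : Matrix (Fin n) (Fin n) ℤ)
      * (Matrix.diagonal fun i => (d i : ℤ)) * ((Q⁻¹ : GL (Fin n) ℤ) : Matrix (Fin n) (Fin n) ℤ) := by
    rw [← hAQ, Matrix.mul_assoc, Units.mul_inv, Matrix.mul_one]
  refine ⟨(P : Matrix (Fin n) (Fin n) ℤ)ᵀ *ᵥ x,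
    ((Q⁻¹ : GL (Fin n) ℤ) : Matrix (Fin n) (Fin n) ℤ)ᵀ *ᵥ y, fun j => ?_⟩
  have hAP : Aᵀ *ᵥ ((P : Matrix (Fin n) (Fin n) ℤ)ᵀ *ᵥ x)
      = ((Q⁻¹ : GL (Fin n) ℤ) : Matrix (Fin n) (Fin n) ℤ)ᵀ *ᵥ (fun i => (d i : ℤ) * x i) := by
    have : (P : Matrix (Fin n) (Fin n) ℤ) * A = (Matrix.diagonal fun i => (d i : ℤ))
        * ((Q⁻¹ : GL (Fin n) ℤ) : Matrix (Fin n) (Fin n) ℤ) := by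
      rw [← hPQ, Matrix.mul_assoc _ _ ((Q⁻¹ : GL (Fin n) ℤ) : Matrix (Fin n) (Fin n) ℤ),
        Units.mul_inv, Matrix.mul_one]
    rw [Matrix.mulVec_mulVec, ← Matrix.transpose_mul, this, Matrix.transpose_mul,
      ← Matrix.mulVec_mulVec, Matrix.diagonal_transpose]
    congr 1
    ext i
    rw [Matrix.mulVec_diagonal]
  rw [hAP, hb2 j]
  simp only [Matrix.mulVec, dotProduct, Matrix.transpose_apply]
  push_cast
  rw [Finset.sum_div, ← Finset.sum_add_distrib]
  exact Finset.sum_congr rfl fun i _ => by ring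

/-! ### Families of unitary matrices commuting up to scalars -/

theorem Twist.mul_left {k : ℕ} {s t : ℝ} {g g' h : Matrix.unitaryGroup (Fin k) ℂ}
    (a : Twist s g h) (b : Twist t g' h) : Twist (s + t) (g * g') h := by
  have := (a.swap.mul_right b.swap).swap
  rwa [neg_add_rev, neg_neg, neg_neg, add_comm] at this

theorem Twist.of_commute {k : ℕ} {g h : Matrix.unitaryGroup (Fin k) ℂ} (a : Commute g h) :
    Twist 0 g h := by
  rw [Twist, phase_zero, one_mul, a.eq]

theorem Twist.coe {k : ℕ} {t : ℝ} {g h : Matrix.unitaryGroup (Fin k) ℂ} (a : Twist t g h) :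
    (g : Matrix (Fin k) (Fin k) ℂ) * (h : Matrix (Fin k) (Fin k) ℂ)
      = Complex.exp (t * Complex.I) •
        ((h : Matrix (Fin k) (Fin k) ℂ) * (g : Matrix (Fin k) (Fin k) ℂ)) := by
  have := congrArg Subtype.val a
  simpa [phase] using this

theorem unitary_mul_star {k : ℕ} (g : Matrix.unitaryGroup (Fin k) ℂ) :
    (g : Matrix (Fin k) (Fin k) ℂ) * (g : Matrix (Fin k) (Fin k) ℂ)ᴴ = 1 :=
  Matrix.mem_unitaryGroup_iff.1 g.2

theorem unitary_star_mul {k : ℕ} (g : Matrix.unitaryGroup (Fin k) ℂ) :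
    (g : Matrix (Fin k) (Fin k) ℂ)ᴴ * (g : Matrix (Fin k) (Fin k) ℂ) = 1 :=
  Matrix.mem_unitaryGroup_iff'.1 g.2

open scoped ComplexOrder in
theorem trace_conjTranspose_mul_self_ne_zero {m n : Type*} [Fintype m] [Fintype n]
    {X : Matrix m n ℂ} (hX : X ≠ 0) : (Xᴴ * X).trace ≠ 0 :=
  fun h => hX (Matrix.trace_conjTranspose_mul_self_eq_zero_iff.1 h)

theorem norm_eq_one_of_mul_star {c : ℂ} (h : c * star c = 1) : ‖c‖ = 1 := by
  rw [Complex.star_def, Complex.mul_conj, Complex.normSq_eq_norm_sq] at h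
  have h4 : ‖c‖ ^ 2 = 1 := by exact_mod_cast h
  exact (pow_eq_one_iff_of_nonneg (norm_nonneg c) two_ne_zero).1 h4

/-- Commuting endomorphisms of a finite dimensional complex vector space have a common
eigenvector. -/
theorem exists_common_eigenvector {ι E : Type*} [Finite ι] [AddCommGroup E] [Module ℂ E]
    [FiniteDimensional ℂ E] [Nontrivial E] (f : ι → Module.End ℂ E)
    (hf : ∀ i j, Commute (f i) (f j)) : ∃ v : E, v ≠ 0 ∧ ∀ i, ∃ c : ℂ, f i v = c • v := by
  classical
  have := Fintype.ofFinite ι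
  -- Invariance under all `f j`, not only those in `s`, is what lets the next eigenspace be taken
  -- inside `S`.
  have key : ∀ s : Finset ι, ∃ S : Submodule ℂ E, S ≠ ⊥ ∧ (∀ j, ∀ v ∈ S, f j v ∈ S) ∧
      ∀ i ∈ s, ∃ c : ℂ, ∀ v ∈ S, f i v = c • v := by
    intro s
    induction s using Finset.induction_on with
    | empty => exact ⟨⊤, top_ne_bot, by simp, by simp⟩
    | insert a s _ ih =>
      obtain ⟨S, hS, hinv, hs⟩ := ih
      have : Nontrivial S := Submodule.nontrivial_iff_ne_bot.2 hS
      obtain ⟨c, hc⟩ := Module.End.exists_eigenvalue ((f a).restrict (hinv a))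
      obtain ⟨v, hv⟩ := hc.exists_hasEigenvector
      refine ⟨S ⊓ LinearMap.ker (f a - c • LinearMap.id), ?_, ?_, ?_⟩
      · rw [Submodule.ne_bot_iff]
        refine ⟨v, ⟨v.2, ?_⟩, fun h => hv.2 (Subtype.ext h)⟩
        have := congrArg Subtype.val hv.apply_eq_smul
        simpa [sub_eq_zero] using this
      · rintro j v ⟨hv1, hv2⟩
        refine ⟨hinv j v hv1, ?_⟩
        have h1 : f a v = c • v := by simpa [sub_eq_zero] using hv2
        have h2 : f a (f j v) = f j (f a v) := LinearMap.congr_fun (hf a j).eq v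
        simp [h2, h1]
      · intro i hi
        rcases Finset.mem_insert.1 hi with rfl | hi
        · exact ⟨c, fun v hv => by simpa [sub_eq_zero] using hv.2⟩
        · obtain ⟨c', hc'⟩ := hs i hi
          exact ⟨c', fun v hv => hc' v hv.1⟩
  obtain ⟨S, hS, -, h⟩ := key Finset.univ
  obtain ⟨v, hv, hv0⟩ := (Submodule.ne_bot_iff _).1 hS
  refine ⟨v, hv0, fun i => ?_⟩
  obtain ⟨c, hc⟩ := h i (Finset.mem_univ i)
  exact ⟨c, hc v hv⟩

/-- Two families of unitary matrices with the same commutation relations are intertwined, up to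
scalars of modulus one, by a nonzero matrix. -/
theorem exists_intertwiner {ι : Type*} [Finite ι] {k k' : ℕ} (hk : 0 < k) (hk' : 0 < k')
    (W : ι → Matrix.unitaryGroup (Fin k) ℂ) (W' : ι → Matrix.unitaryGroup (Fin k') ℂ)
    (t : ι → ι → ℝ) (h : ∀ i j, Twist (t i j) (W i) (W j))
    (h' : ∀ i j, Twist (t i j) (W' i) (W' j)) :
    ∃ (X : Matrix (Fin k') (Fin k) ℂ) (τ : ι → ℝ), X ≠ 0 ∧
      ∀ i, (W' i : Matrix (Fin k') (Fin k') ℂ) * X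
        = Complex.exp (Complex.I * τ i) • (X * (W i : Matrix (Fin k) (Fin k) ℂ)) := by
  have : Nonempty (Fin k) := ⟨⟨0, hk⟩⟩
  have : Nonempty (Fin k') := ⟨⟨0, hk'⟩⟩
  -- The operators `X ↦ W'ᵢ X Wᵢ*` commute: the phase from exchanging the `W'` is cancelled by the
  -- conjugate phase from exchanging the `W*`. A common eigenvector is the intertwiner.
  let f : ι → Module.End ℂ (Matrix (Fin k') (Fin k) ℂ) := fun i =>
    { toFun := fun X => (W' i : Matrix (Fin k') (Fin k') ℂ) * X * (W i : Matrix (Fin k) (Fin k) ℂ)ᴴ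
      map_add' := fun X Y => by rw [Matrix.mul_add, Matrix.add_mul]
      map_smul' := fun c X => by simp }
  have hf : ∀ i j, Commute (f i) (f j) := by
    intro i j
    refine LinearMap.ext fun X => ?_
    change (W' i : Matrix (Fin k') (Fin k') ℂ) * ((W' j : Matrix (Fin k') (Fin k') ℂ) * X
        * (W j : Matrix (Fin k) (Fin k) ℂ)ᴴ) * (W i : Matrix (Fin k) (Fin k) ℂ)ᴴ
      = (W' j : Matrix (Fin k') (Fin k') ℂ) * ((W' i : Matrix (Fin k') (Fin k') ℂ) * X
        * (W i : Matrix (Fin k) (Fin k) ℂ)ᴴ) * (W j : Matrix (Fin k) (Fin k) ℂ)ᴴ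
    have e1 := (h' i j).coe
    have e2 := congrArg Matrix.conjTranspose (h i j).coe
    rw [Matrix.conjTranspose_smul, Matrix.conjTranspose_mul, Matrix.conjTranspose_mul] at e2
    have e3 : ∀ (a b : Matrix (Fin k') (Fin k') ℂ) (c d : Matrix (Fin k) (Fin k) ℂ),
        a * (b * X * c) * d = a * b * (X * (c * d)) := fun a b c d => by
      simp only [Matrix.mul_assoc]
    have hunit : Complex.exp (t i j * Complex.I) * star (Complex.exp (t i j * Complex.I)) = 1 := by
      rw [Complex.star_def, ← Complex.exp_conj, ← Complex.exp_add]
      simp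
    rw [e3, e3, e1, e2]
    simp only [Matrix.smul_mul, Matrix.mul_smul, smul_smul]
    rw [mul_comm, hunit, one_smul]
  obtain ⟨X, hX, hc⟩ := exists_common_eigenvector f hf
  have hc' : ∀ i, ∃ τ : ℝ, (W' i : Matrix (Fin k') (Fin k') ℂ) * X
        = Complex.exp (Complex.I * τ) • (X * (W i : Matrix (Fin k) (Fin k) ℂ)) := by
    intro i
    obtain ⟨c, hc⟩ := hc i
    have h1 : (W' i : Matrix (Fin k') (Fin k') ℂ) * X
        = c • (X * (W i : Matrix (Fin k) (Fin k) ℂ)) := by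
      have h2 : (W' i : Matrix (Fin k') (Fin k') ℂ) * X * (W i : Matrix (Fin k) (Fin k) ℂ)ᴴ
        = c • X := hc
      have h3 := congrArg (· * (W i : Matrix (Fin k) (Fin k) ℂ)) h2
      simpa [Matrix.mul_assoc, unitary_star_mul] using h3
    -- Multiplication by unitary matrices on either side preserves `tr (X* X)`, so the eigenvalue
    -- has modulus one.
    have h2 : ‖c‖ = 1 := by
      have e1 : ((W' i : Matrix (Fin k') (Fin k') ℂ) * X)ᴴ
          * ((W' i : Matrix (Fin k') (Fin k') ℂ) * X) = Xᴴ * X := by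
        rw [Matrix.conjTranspose_mul, Matrix.mul_assoc, ← Matrix.mul_assoc _ _ X,
          unitary_star_mul, Matrix.one_mul]
      have e2 := congrArg Matrix.trace e1
      rw [h1, Matrix.conjTranspose_smul, Matrix.smul_mul, Matrix.mul_smul, smul_smul,
        Matrix.conjTranspose_mul, Matrix.trace_smul, Matrix.mul_assoc, Matrix.trace_mul_comm,
        Matrix.mul_assoc, Matrix.mul_assoc, unitary_mul_star, Matrix.mul_one, smul_eq_mul] at e2
      refine norm_eq_one_of_mul_star ?_
      rw [mul_comm]
      exact mul_right_cancel₀ (trace_conjTranspose_mul_self_ne_zero hX) (by rw [e2, one_mul])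
    obtain ⟨τ, hτ⟩ := (Complex.norm_eq_one_iff c).1 h2
    exact ⟨τ, by rw [h1, ← hτ, mul_comm]⟩
  choose τ hτ using hc'
  exact ⟨X, τ, hX, hτ⟩

/-! ### Words in the `V_j` and `U_k`: orthogonality, spanning and Schur's lemma -/

namespace TransData

variable {n : ℕ}

theorem rk_pos (D : TransData n) : 0 < D.rk := D.rk_spec.pos D.r_pos

theorem r_ne (D : TransData n) : (D.r : ℝ) ≠ 0 := by exact_mod_cast D.r_pos.ne'

/-- The unitary matrix `V₁^m₁ ⋯ Vₙ^mₙ U₁^l₁ ⋯ Uₙ^lₙ` as an element of the unitary group. -/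
def unitaryWord (D : TransData n) (k : Deck n) : Matrix.unitaryGroup (Fin D.rk) ℂ :=
  zpowProd D.V k.1 * zpowProd D.U k.2

/-- The phase of the commutator of two words. -/
def pairing (D : TransData n) (k w : Deck n) : ℝ :=
  2 * π / D.r * (((D.A *ᵥ w.1) ⬝ᵥ k.2 : ℤ) - ((D.A *ᵥ k.1) ⬝ᵥ w.2 : ℤ))

theorem zpowProd_commute {G : Type*} [Group G] (W : Fin n → G)
    (h : ∀ i j, W i * W j = W j * W i) (m l : Fin n → ℤ) :
    Commute (zpowProd W m) (zpowProd W l) :=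
  commute_zpowProd _ _ _ fun j => (commute_zpowProd _ _ _ fun i => h j i).symm

theorem twist_unitaryWord (D : TransData n) (k w : Deck n) :
    Twist (D.pairing k w) (D.unitaryWord k) (D.unitaryWord w) := by
  have h1 : Twist 0 (zpowProd D.V k.1) (zpowProd D.V w.1) :=
    .of_commute (zpowProd_commute _ D.comm_V _ _)
  have h2 := (D.twist_prod w.2 k.1).swap
  have h3 := D.twist_prod k.2 w.1
  have h4 : Twist 0 (zpowProd D.U k.2) (zpowProd D.U w.2) :=
    .of_commute (zpowProd_commute _ D.comm_U _ _)
  have h := (h1.mul_right h2).mul_left (h3.mul_right h4)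
  have e : D.pairing k w = 0 + -(2 * π / D.r * ((D.A *ᵥ k.1) ⬝ᵥ w.2 : ℤ))
      + (2 * π / D.r * ((D.A *ᵥ w.1) ⬝ᵥ k.2 : ℤ) + 0) := by
    rw [pairing]
    ring
  rw [e]
  exact h

theorem word_mul_word (D : TransData n) (k w : Deck n) :
    D.word k * D.word w = Complex.exp (D.pairing k w * Complex.I) • (D.word w * D.word k) :=
  (D.twist_unitaryWord k w).coe

theorem word_mul_star (D : TransData n) (k : Deck n) : D.word k * (D.word k)ᴴ = 1 :=
  unitary_mul_star _

theorem star_mul_word (D : TransData n) (k : Deck n) : (D.word k)ᴴ * D.word k = 1 :=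
  unitary_star_mul _

/-- Words with different commutators are orthogonal. -/
theorem trace_star_word_mul_word (D : TransData n) (k w w' : Deck n)
    (h : Complex.exp (D.pairing k w * Complex.I) ≠ Complex.exp (D.pairing k w' * Complex.I)) :
    ((D.word w)ᴴ * D.word w').trace = 0 := by
  -- Left multiplication by the word `k` preserves the trace pairing. Moving it to the right
  -- multiplies the pairing by the quotient of the two commutator phases, so the pairing vanishes
  -- when they differ.
  have e1 : (D.word k * D.word w)ᴴ * (D.word k * D.word w') = (D.word w)ᴴ * D.word w' := by
    rw [Matrix.conjTranspose_mul, Matrix.mul_assoc, ← Matrix.mul_assoc _ _ (D.word w'),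
      star_mul_word, Matrix.one_mul]
  rw [D.word_mul_word k w, D.word_mul_word k w', Matrix.conjTranspose_smul, Matrix.conjTranspose_mul] at e1
  have e2 := congrArg Matrix.trace e1
  rw [Matrix.smul_mul, Matrix.mul_smul, smul_smul, Matrix.trace_smul, Matrix.mul_assoc,
    Matrix.trace_mul_comm, Matrix.mul_assoc, Matrix.mul_assoc, word_mul_star, Matrix.mul_one,
    smul_eq_mul] at e2
  by_contra h0
  have e3 := mul_right_cancel₀ h0 (e2.trans (one_mul _).symm)
  have hunit : Complex.exp (D.pairing k w * Complex.I)
      * star (Complex.exp (D.pairing k w * Complex.I)) = 1 := by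
    rw [Complex.star_def, ← Complex.exp_conj, ← Complex.exp_add]
    simp
  refine h ?_
  calc _ = Complex.exp (D.pairing k w * Complex.I)
        * (star (Complex.exp (D.pairing k w * Complex.I))
        * Complex.exp (D.pairing k w' * Complex.I)) := by rw [e3, mul_one]
    _ = _ := by rw [← mul_assoc, hunit, one_mul]

theorem exp_int_div_ne {r : ℕ} (hr : 0 < r) (a b : ℤ) (h : (a : ZMod r) ≠ b) :
    Complex.exp ((2 * π / r * a : ℝ) * Complex.I) ≠ Complex.exp ((2 * π / r * b : ℝ) * Complex.I) := by
  intro he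
  have hr' : (r : ℂ) ≠ 0 := by exact_mod_cast hr.ne'
  have hpi : (π : ℂ) ≠ 0 := by exact_mod_cast Real.pi_ne_zero
  obtain ⟨m, hm⟩ := Complex.exp_eq_exp_iff_exists_int.1 he
  have h1 : (a : ℂ) = b + m * r := by
    push_cast at hm
    field_simp at hm
    have := Complex.I_ne_zero
    linear_combination hm
  have h2 : a = b + m * r := by exact_mod_cast h1
  exact h (by rw [h2]; simp)

theorem intCast_mulVec (r : ℕ) (A : Matrix (Fin n) (Fin n) ℤ) (m : Fin n → ℤ) (i : Fin n) :
    (((A *ᵥ m) i : ℤ) : ZMod r) = (modMat r A *ᵥ fun j => (m j : ZMod r)) i := by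
  simp [Matrix.mulVec, dotProduct]

theorem exists_lift_imageMod {r : ℕ} (A : Matrix (Fin n) (Fin n) ℤ) (x : imageMod r A) :
    ∃ m : Fin n → ℤ, ∀ i, (((A *ᵥ m) i : ℤ) : ZMod r) = x.1 i := by
  obtain ⟨y, hy⟩ := x.2
  choose m hm using fun i => ZMod.intCast_surjective (y i)
  refine ⟨m, fun i => ?_⟩
  rw [intCast_mulVec, funext hm, ← hy]
  rfl

/-- The words span the matrix algebra. -/
theorem span_word (D : TransData n) : Submodule.span ℂ (Set.range D.word) = ⊤ := by
  have : NeZero D.r := ⟨D.r_pos.ne'⟩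
  have hcard := D.rk_spec.eq_card D.r_pos
  have hcard' := D.rk_spec.transpose.eq_card D.r_pos
  choose m hm using exists_lift_imageMod (r := D.r) D.A
  choose l hl using exists_lift_imageMod (r := D.r) D.Aᵀ
  -- Commutators with generators see `m` only through `A m` modulo `r` and `l` only through `Aᵗ l`
  -- modulo `r`. One word is taken for each pair of such values; there are `r'²` pairs, because `A`
  -- and `Aᵗ` have the same elementary divisors.
  let I := imageMod D.r D.A × imageMod D.r D.Aᵀ
  have : Fintype I := Fintype.ofFinite I
  let b : I → Matrix (Fin D.rk) (Fin D.rk) ℂ := fun x => D.word (m x.1, l x.2)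
  have horth : ∀ x y : I, x ≠ y → ((b x)ᴴ * b y).trace = 0 := by
    intro x y hxy
    by_cases h1 : x.1 = y.1
    · have h2 : x.2 ≠ y.2 := fun h2 => hxy (Prod.ext h1 h2)
      obtain ⟨i, hi⟩ := Function.ne_iff.1 (fun h => h2 (Subtype.ext h))
      -- The commutator with `V_i` detects the `i`-th coordinate of `Aᵗ l`.
      refine D.trace_star_word_mul_word (Pi.single i 1, 0) _ _ ?_
      rw [← hl, ← hl] at hi
      have e : ∀ z : I, D.pairing (Pi.single i 1, 0) (m z.1, l z.2)
          = 2 * π / D.r * ((-((D.Aᵀ *ᵥ l z.2) i) : ℤ) : ℝ) := by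
        intro z
        have : (D.A *ᵥ Pi.single i 1) ⬝ᵥ l z.2 = (D.Aᵀ *ᵥ l z.2) i := by
          rw [Matrix.mulVec_single_one]; rfl
        simp only [pairing, dotProduct_zero, this]
        push_cast
        ring
      rw [e, e]
      refine exp_int_div_ne D.r_pos _ _ fun h => hi ?_
      push_cast at h
      exact neg_injective h
    · obtain ⟨i, hi⟩ := Function.ne_iff.1 (fun h => h1 (Subtype.ext h))
      -- The commutator with `U_i` detects the `i`-th coordinate of `A m`.
      refine D.trace_star_word_mul_word (0, Pi.single i 1) _ _ ?_
      rw [← hm, ← hm] at hi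
      have e : ∀ z : I, D.pairing (0, Pi.single i 1) (m z.1, l z.2)
          = 2 * π / D.r * (((D.A *ᵥ m z.1) i : ℤ) : ℝ) := by
        intro z
        simp [pairing]
      rw [e, e]
      exact exp_int_div_ne D.r_pos _ _ hi
  have hli : LinearIndependent ℂ b := by
    rw [Fintype.linearIndependent_iff]
    intro c hc x
    have h1 := congrArg (fun M => ((b x)ᴴ * M).trace) hc
    simp only [Matrix.mul_sum, Matrix.mul_smul, Matrix.trace_sum, Matrix.trace_smul,
      Matrix.mul_zero, Matrix.trace_zero] at h1
    rw [Finset.sum_eq_single x (fun y _ hy => by rw [horth x y hy.symm, smul_zero]) (by simp)] at h1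
    have h2 : (b x)ᴴ * b x = 1 := D.star_mul_word _
    rw [h2, Matrix.trace_one, Fintype.card_fin, smul_eq_mul] at h1
    exact (mul_eq_zero.1 h1).resolve_right (by exact_mod_cast D.rk_pos.ne')
  have hfin : Fintype.card I = Module.finrank ℂ (Matrix (Fin D.rk) (Fin D.rk) ℂ) := by
    rw [← Nat.card_eq_fintype_card, Nat.card_prod, ← hcard, ← hcard', Module.finrank_matrix]
    simp
  rw [eq_top_iff, ← hli.span_eq_top_of_card_eq_finrank' hfin]
  refine Submodule.span_mono ?_
  rintro _ ⟨x, rfl⟩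
  exact ⟨_, rfl⟩

/-- A matrix orthogonal to all words is orthogonal to their span, hence to itself, and the trace
form is definite. -/
theorem exists_trace_word_ne_zero (D : TransData n) {M : Matrix (Fin D.rk) (Fin D.rk) ℂ}
    (hM : M ≠ 0) : ∃ w, ((D.word w)ᴴ * M).trace ≠ 0 := by
  by_contra! h
  let f : Matrix (Fin D.rk) (Fin D.rk) ℂ →ₗ[ℂ] ℂ :=
    Matrix.traceLinearMap (Fin D.rk) ℂ ℂ ∘ₗ LinearMap.mulLeft ℂ Mᴴ
  have hf : f = 0 := by
    refine LinearMap.ext_on D.span_word ?_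
    rintro _ ⟨w, rfl⟩
    have h1 := congrArg star (h w)
    rw [← Matrix.trace_conjTranspose, Matrix.conjTranspose_mul, Matrix.conjTranspose_conjTranspose,
      star_zero] at h1
    exact h1
  exact trace_conjTranspose_mul_self_ne_zero hM (LinearMap.congr_fun hf M)

/-- Schur's lemma. -/
theorem eq_smul_one_of_commute_word (D : TransData n) {M : Matrix (Fin D.rk) (Fin D.rk) ℂ}
    (hM : ∀ k, Commute M (D.word k)) : ∃ c : ℂ, M = c • 1 := by
  have h : ∀ X : Matrix (Fin D.rk) (Fin D.rk) ℂ, Commute X M := by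
    intro X
    have hX : X ∈ Submodule.span ℂ (Set.range D.word) := by rw [D.span_word]; trivial
    induction hX using Submodule.span_induction with
    | mem x hx => obtain ⟨k, rfl⟩ := hx; exact (hM k).symm
    | zero => exact Commute.zero_left _
    | add x y _ _ hx hy => exact hx.add_left hy
    | smul c x _ hx => exact hx.smul_left c
  obtain ⟨c, hc⟩ := Matrix.mem_range_scalar_iff_commute_single'.2 fun i j => h (Matrix.single i j 1)
  exact ⟨c, by rw [← hc]; ext i j; simp [Matrix.scalar_apply, Matrix.diagonal_apply,
    Matrix.one_apply]⟩

/-- The generators `V_j` and `U_k` as one family. -/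
def gen (D : TransData n) : Fin n ⊕ Fin n → Matrix.unitaryGroup (Fin D.rk) ℂ := Sum.elim D.V D.U

/-- The unitary matrices commuting with `M` form a subgroup; `M` itself need not be unitary or
invertible. -/
theorem commute_word_of_gen (D : TransData n) {M : Matrix (Fin D.rk) (Fin D.rk) ℂ}
    (hM : ∀ i, Commute M (D.gen i : Matrix (Fin D.rk) (Fin D.rk) ℂ)) (k : Deck n) :
    Commute M (D.word k) := by
  let H : Subgroup (Matrix.unitaryGroup (Fin D.rk) ℂ) :=
    { carrier := {g | Commute M (g : Matrix (Fin D.rk) (Fin D.rk) ℂ)}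
      mul_mem' := fun {a b} ha hb => by
        change Commute M ((a : Matrix (Fin D.rk) (Fin D.rk) ℂ) * (b : Matrix _ _ ℂ))
        exact Commute.mul_right ha hb
      one_mem' := Commute.one_right M
      inv_mem' := fun {a} ha => by
        have ha' : M * (a : Matrix (Fin D.rk) (Fin D.rk) ℂ) = (a : Matrix _ _ ℂ) * M := ha
        change M * (a : Matrix (Fin D.rk) (Fin D.rk) ℂ)ᴴ = (a : Matrix (Fin D.rk) (Fin D.rk) ℂ)ᴴ * M
        calc _ = (a : Matrix (Fin D.rk) (Fin D.rk) ℂ)ᴴ * ((a : Matrix (Fin D.rk) (Fin D.rk) ℂ) * M)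
              * (a : Matrix (Fin D.rk) (Fin D.rk) ℂ)ᴴ := by
              rw [← Matrix.mul_assoc, unitary_star_mul, Matrix.one_mul]
          _ = _ := by
              rw [← ha', Matrix.mul_assoc, Matrix.mul_assoc, unitary_mul_star, Matrix.mul_one] }
  have hz : ∀ (W : Fin n → Matrix.unitaryGroup (Fin D.rk) ℂ) (m : Fin n → ℤ),
      (∀ j, W j ∈ H) → zpowProd W m ∈ H := by
    intro W m hW
    refine H.list_prod_mem fun x hx => ?_
    obtain ⟨j, rfl⟩ := (List.mem_ofFn' _ _).1 hx
    exact H.zpow_mem (hW j) _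
  exact H.mul_mem (hz D.V k.1 fun j => hM (Sum.inl j)) (hz D.U k.2 fun j => hM (Sum.inr j))

/-! ### Triples of equal slope and existence of triples -/

/-- Triples of the same slope `A / r`. -/
def SameSlope (D D' : TransData n) : Prop := (D.r : ℤ) • D'.A = (D'.r : ℤ) • D.A

theorem SameSlope.div_eq {D D' : TransData n} (h : SameSlope D D') (i j : Fin n) :
    (D'.A i j : ℝ) / D'.r = (D.A i j : ℝ) / D.r := by
  have h1 := congrFun (congrFun h i) j
  simp only [Matrix.smul_apply, smul_eq_mul] at h1
  have h2 : (D.r : ℝ) * D'.A i j = D'.r * D.A i j := by exact_mod_cast h1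
  rw [div_eq_div_iff D'.r_ne D.r_ne]
  linarith

theorem sameSlope_of_div_eq {D D' : TransData n}
    (h : ∀ i j, (D'.A i j : ℝ) / D'.r = (D.A i j : ℝ) / D.r) : SameSlope D D' := by
  ext i j
  have h1 := h i j
  rw [div_eq_div_iff D'.r_ne D.r_ne] at h1
  simp only [Matrix.smul_apply, smul_eq_mul]
  have h2 : (D.r : ℝ) * D'.A i j = D'.r * D.A i j := by linarith
  exact_mod_cast h2

/-- The commutation phases of the generators. -/
def genPhase (D : TransData n) : Fin n ⊕ Fin n → Fin n ⊕ Fin n → ℝ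
  | .inl _, .inl _ => 0
  | .inr _, .inr _ => 0
  | .inr k, .inl j => 2 * π * (D.A k j / D.r)
  | .inl j, .inr k => -(2 * π * (D.A k j / D.r))

theorem twist_gen (D : TransData n) (i j : Fin n ⊕ Fin n) :
    Twist (D.genPhase i j) (D.gen i) (D.gen j) := by
  rcases i with i | i <;> rcases j with j | j
  · exact .of_commute (D.comm_V i j)
  · have := (D.twist_UV j i).swap
    rwa [mul_div_assoc] at this
  · have := D.twist_UV i j
    rwa [mul_div_assoc] at this
  · exact .of_commute (D.comm_U i j)

/-- The generators of triples of the same slope agree up to a change of frame and scalars of modulus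
one: irreducible representations of finite Heisenberg groups are determined by their central
characters. -/
theorem SameSlope.exists_frame {D D' : TransData n} (h : SameSlope D D') :
    ∃ (g : Matrix (Fin D'.rk) (Fin D.rk) ℂ) (g' : Matrix (Fin D.rk) (Fin D'.rk) ℂ)
      (τ : Fin n ⊕ Fin n → ℝ), g * g' = 1 ∧ g' * g = 1 ∧
      ∀ i, (D'.gen i : Matrix (Fin D'.rk) (Fin D'.rk) ℂ)
        = Complex.exp (Complex.I * τ i) • (g * (D.gen i : Matrix (Fin D.rk) (Fin D.rk) ℂ) * g') := by
  have hph : D'.genPhase = D.genPhase := by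
    funext i j
    rcases i with i | i <;> rcases j with j | j <;> simp [genPhase, h.div_eq]
  obtain ⟨X, τ, hX, hτ⟩ := exists_intertwiner D.rk_pos D'.rk_pos D.gen D'.gen D.genPhase
    D.twist_gen (hph ▸ D'.twist_gen)
  have hunit : ∀ i, star (Complex.exp (Complex.I * τ i)) * Complex.exp (Complex.I * τ i) = 1 := by
    intro i
    rw [Complex.star_def, ← Complex.exp_conj, ← Complex.exp_add]
    simp
  have hunit' : ∀ i, Complex.exp (Complex.I * τ i) * star (Complex.exp (Complex.I * τ i)) = 1 :=
    fun i => by rw [mul_comm, hunit]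
  -- The phases of the intertwining relation cancel in `X* X` and in `X X*`, so by Schur's lemma
  -- both are scalar. The two scalars agree and are nonzero, which makes `X` invertible with inverse
  -- a multiple of `X*`; in particular the ranks agree.
  obtain ⟨c, hc⟩ := D.eq_smul_one_of_commute_word (M := Xᴴ * X) (D.commute_word_of_gen fun i => by
    have e1 : ((D'.gen i : Matrix (Fin D'.rk) (Fin D'.rk) ℂ) * X)ᴴ
          * ((D'.gen i : Matrix (Fin D'.rk) (Fin D'.rk) ℂ) * X) = Xᴴ * X := by
      rw [Matrix.conjTranspose_mul, Matrix.mul_assoc, ← Matrix.mul_assoc _ _ X,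
        unitary_star_mul, Matrix.one_mul]
    rw [hτ, Matrix.conjTranspose_smul, Matrix.smul_mul, Matrix.mul_smul, smul_smul, hunit,
      one_smul, Matrix.conjTranspose_mul] at e1
    change Xᴴ * X * _ = _ * (Xᴴ * X)
    nth_rw 2 [← e1]
    simp only [← Matrix.mul_assoc, unitary_mul_star, Matrix.one_mul])
  obtain ⟨c', hc'⟩ := D'.eq_smul_one_of_commute_word (M := X * Xᴴ)
    (D'.commute_word_of_gen fun i => by
    have e2 := congrArg Matrix.conjTranspose (hτ i)
    rw [Matrix.conjTranspose_smul, Matrix.conjTranspose_mul, Matrix.conjTranspose_mul] at e2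
    have e1 : ((D'.gen i : Matrix (Fin D'.rk) (Fin D'.rk) ℂ) * X)
          * (Xᴴ * (D'.gen i : Matrix (Fin D'.rk) (Fin D'.rk) ℂ)ᴴ) = X * Xᴴ := by
      rw [hτ, e2, Matrix.smul_mul, Matrix.mul_smul, smul_smul, hunit', one_smul, Matrix.mul_assoc,
        ← Matrix.mul_assoc _ _ Xᴴ, unitary_mul_star, Matrix.one_mul]
    change X * Xᴴ * _ = _ * (X * Xᴴ)
    nth_rw 1 [← e1]
    simp only [Matrix.mul_assoc, unitary_star_mul, Matrix.mul_one])
  have hc0 : c ≠ 0 := by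
    rintro rfl
    rw [zero_smul] at hc
    exact trace_conjTranspose_mul_self_ne_zero hX (by rw [hc, Matrix.trace_zero])
  have hcc : c' = c := by
    have h1 : X * (Xᴴ * X) = X * Xᴴ * X := (Matrix.mul_assoc _ _ _).symm
    rw [hc, hc', Matrix.mul_smul, Matrix.mul_one, Matrix.smul_mul, Matrix.one_mul] at h1
    have h2 : (c' - c) • X = 0 := by rw [sub_smul, h1, sub_self]
    exact sub_eq_zero.1 ((smul_eq_zero.1 h2).resolve_right hX)
  have hXX : X * (c⁻¹ • Xᴴ) = 1 := by
    rw [Matrix.mul_smul, hc', hcc, smul_smul, inv_mul_cancel₀ hc0, one_smul]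
  refine ⟨X, c⁻¹ • Xᴴ, τ, hXX, ?_, fun i => ?_⟩
  · rw [Matrix.smul_mul, hc, smul_smul, inv_mul_cancel₀ hc0, one_smul]
  · rw [← Matrix.smul_mul, ← hτ, Matrix.mul_assoc, hXX, Matrix.mul_one]

theorem rk_eq_of_inverse {k k' : ℕ} {g : Matrix (Fin k') (Fin k) ℂ} {g' : Matrix (Fin k) (Fin k') ℂ}
    (h : g * g' = 1) (h' : g' * g = 1) : k = k' := by
  simpa using (Fintype.card_congr (Matrix.indexEquivOfInv h h')).symm

/-- Triples `(r, A, 𝒰)` exist for all `(r, A)`. -/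
theorem exists_transData (r : ℕ) (hr : 0 < r) (A : Matrix (Fin n) (Fin n) ℤ) :
    ∃ D : TransData n, D.r = r ∧ D.A = A := by
  have : NeZero r := ⟨hr.ne'⟩
  obtain ⟨k, hk⟩ := exists_isRankOf r A
  -- Clock and shift matrices on functions on the image of `A` modulo `r`: `V_j` permutes the points
  -- by translation along the `j`-th column of `A`, and `U_l` multiplies by a character of the
  -- `l`-th coordinate.
  let e : Fin k ≃ imageMod r A := (Finite.equivFinOfCardEq (hk.eq_card hr).symm).symm
  -- The sign is forced by the relation: row `a` of the permutation matrix has its entry in column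
  -- `σ j a`, so `V_j U_l` carries the character at the translated point, and this has to be
  -- `ζ^(-a_lj)` times its value at `a`.
  let s : Fin n → imageMod r A := fun j => -⟨modMat r A *ᵥ Pi.single j 1, ⟨_, rfl⟩⟩
  let σ : Fin n → Equiv.Perm (Fin k) := fun j => (e.trans (Equiv.addRight (s j))).trans e.symm
  have hσ : ∀ j a, e (σ j a) = e a + s j := fun j a => by simp [σ]
  have hσc : ∀ i j a, σ i (σ j a) = σ j (σ i a) := fun i j a => by
    apply e.injective
    rw [hσ, hσ, hσ, hσ, add_right_comm]
  let χ := ZMod.stdAddChar (N := r)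
  have hχ : ∀ x : ZMod r, χ x * star (χ x) = 1 := fun x => by
    change ZMod.stdAddChar x * star (ZMod.stdAddChar x) = 1
    rw [ZMod.stdAddChar_apply, Complex.star_def, Complex.mul_conj, Circle.normSq_coe,
      Complex.ofReal_one]
  let V : Fin n → Matrix.unitaryGroup (Fin k) ℂ := fun j => ⟨(σ j).toPEquiv.toMatrix, by
    rw [Matrix.mem_unitaryGroup_iff]
    ext a b
    rw [PEquiv.toMatrix_toPEquiv_mul]
    rw [Matrix.submatrix_apply, Matrix.star_apply, PEquiv.toMatrix_apply, Matrix.one_apply]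
    simp only [Equiv.toPEquiv_apply, Option.mem_def, Option.some.injEq, id_eq,
      (σ j).injective.eq_iff]
    by_cases hab : a = b
    · subst hab; simp
    · rw [if_neg (Ne.symm hab), if_neg hab, star_zero]⟩
  let U : Fin n → Matrix.unitaryGroup (Fin k) ℂ := fun l =>
    ⟨Matrix.diagonal fun a => χ ((e a).1 l), by
      rw [Matrix.mem_unitaryGroup_iff, Matrix.star_eq_conjTranspose, Matrix.diagonal_conjTranspose,
        Matrix.diagonal_mul_diagonal, ← Matrix.diagonal_one]
      congr 1
      funext a
      exact hχ _⟩
  refine ⟨⟨r, hr, A, k, hk, V, U, fun i j => ?_, fun i j => ?_, fun j l => ?_⟩, rfl, rfl⟩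
  · apply Subtype.ext
    change (σ i).toPEquiv.toMatrix * (σ j).toPEquiv.toMatrix
      = (σ j).toPEquiv.toMatrix * (σ i).toPEquiv.toMatrix
    rw [← PEquiv.toMatrix_trans, ← PEquiv.toMatrix_trans, ← Equiv.toPEquiv_trans,
      ← Equiv.toPEquiv_trans]
    congr 2
    ext a
    simp [hσc i j a]
  · apply Subtype.ext
    change Matrix.diagonal _ * Matrix.diagonal _ = Matrix.diagonal _ * Matrix.diagonal _
    rw [Matrix.diagonal_mul_diagonal, Matrix.diagonal_mul_diagonal]
    simp only [mul_comm]
  · change _ • (Matrix.diagonal (fun a => χ ((e a).1 l)) * (σ j).toPEquiv.toMatrix)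
      = (σ j).toPEquiv.toMatrix * Matrix.diagonal (fun a => χ ((e a).1 l))
    ext a b
    rw [Matrix.smul_apply, Matrix.diagonal_mul, Matrix.mul_diagonal, smul_eq_mul]
    simp only [PEquiv.toMatrix_apply, Equiv.toPEquiv_apply, Option.mem_def, Option.some.injEq]
    by_cases hab : σ j a = b
    · subst hab
      have h1 : (e (σ j a)).1 l = (e a).1 l + ((-(A l j) : ℤ) : ZMod r) := by
        rw [hσ]
        simp [s]
      have h2 : χ ((-(A l j) : ℤ) : ZMod r)
          = Complex.exp (2 * π * Complex.I / r) ^ (-(A l j)) := by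
        change ZMod.stdAddChar _ = _
        rw [ZMod.stdAddChar_coe, ← Complex.exp_int_mul]
        congr 1
        ring
      rw [h1, AddChar.map_add_eq_mul, h2]
      simp
      ring
    · simp [hab]

end TransData

/-! ### Existence of consistent angles -/

theorem exists_real_angle {k : ℕ} (g : Matrix.unitaryGroup (Fin k) ℂ) :
    ∃ t : ℝ, Complex.exp (Complex.I * t) = (g : Matrix (Fin k) (Fin k) ℂ).det := by
  have h1 : (g : Matrix (Fin k) (Fin k) ℂ).det * star (g : Matrix (Fin k) (Fin k) ℂ).det = 1 := by
    rw [← Matrix.det_conjTranspose, ← Matrix.det_mul, unitary_mul_star, Matrix.det_one]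
  obtain ⟨t, ht⟩ := (Complex.norm_eq_one_iff _).1 (norm_eq_one_of_mul_star h1)
  exact ⟨t, by rw [← ht, mul_comm]⟩

/-- In each slope class one reference triple is fixed, with arbitrary angles `t`. If a triple arises
from it by a frame and phases `τ`, its angles are defined as `t + r' τ`; they are valid because
scaling by `exp(𝐢 τ)` multiplies the determinant by `exp(𝐢 r' τ)`. For two triples of the class `t`
cancels, and the difference divided by `r'` is the phase of the composite change of frame. -/
theorem exists_isConsistent (n : ℕ) : ∃ a : Angles n, a.IsConsistent := by
  let S : Setoid (TransData n) :=
    { r := TransData.SameSlope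
      iseqv :=
        { refl := fun D => rfl
          symm := fun h => TransData.sameSlope_of_div_eq fun i j => (h.div_eq i j).symm
          trans := fun h h' => TransData.sameSlope_of_div_eq fun i j =>
            (h'.div_eq i j).trans (h.div_eq i j) } }
  let rep : TransData n → TransData n := fun D => (Quotient.mk S D).out
  have hrep : ∀ D, TransData.SameSlope (rep D) D := fun D => Quotient.mk_out (s := S) D
  choose g g' τ hg hg' hτ using fun D => (hrep D).exists_frame
  choose t ht using fun (D : TransData n) (i : Fin n ⊕ Fin n) => exists_real_angle (D.gen i)
  have hrk : ∀ D, (rep D).rk = D.rk := fun D => TransData.rk_eq_of_inverse (hg D) (hg' D)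
  have hexp : ∀ D i, Complex.exp (Complex.I * ((t (rep D) i + D.rk * τ D i : ℝ) : ℂ))
      = (D.gen i : Matrix (Fin D.rk) (Fin D.rk) ℂ).det := by
    intro D i
    rw [hτ, Matrix.det_smul, Matrix.det_conj_of_mul_eq_one (hg D) (hg' D), ← ht,
      Fintype.card_fin, ← Complex.exp_nat_mul, ← Complex.exp_add]
    congr 1
    push_cast
    ring
  refine ⟨⟨fun D j => t (rep D) (Sum.inl j) + D.rk * τ D (Sum.inl j),
    fun D j => t (rep D) (Sum.inr j) + D.rk * τ D (Sum.inr j),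
    fun D j => hexp D _, fun D j => hexp D _⟩, fun D D' h => ?_⟩
  have hq : rep D' = rep D := congrArg Quotient.out (Quotient.sound (s := S) h).symm
  have key : ∃ (h : Matrix (Fin D'.rk) (Fin D.rk) ℂ) (h' : Matrix (Fin D.rk) (Fin D'.rk) ℂ),
      h * h' = 1 ∧ h' * h = 1 ∧ ∀ i, (D'.gen i : Matrix (Fin D'.rk) (Fin D'.rk) ℂ)
        = Complex.exp (Complex.I * ((t (rep D') i + D'.rk * τ D' i
          - (t (rep D) i + D.rk * τ D i)) / D.rk : ℝ)) •
          (h * (D.gen i : Matrix (Fin D.rk) (Fin D.rk) ℂ) * h') := by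
    have hDD : D'.rk = D.rk := by rw [← hrk D', hq, hrk]
    have h1 := hg D'
    have h2 := hg' D'
    have h3 := hτ D'
    -- The frame of `D'` has a size depending on `rep D'`; abstracting it allows `rep D'` to be
    -- replaced by `rep D`, after which the two frames can be composed.
    generalize g D' = a at h1 h2 h3
    generalize g' D' = a' at h1 h2 h3
    generalize τ D' = τ' at h3 ⊢
    revert a a'
    rw [hq]
    intro a a' h1 h2 h3
    refine ⟨a * g' D, g D * a', ?_, ?_, fun i => ?_⟩
    · rw [Matrix.mul_assoc, ← Matrix.mul_assoc _ _ a', hg', Matrix.one_mul, h1]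
    · rw [Matrix.mul_assoc, ← Matrix.mul_assoc a', h2, Matrix.one_mul, hg]
    · rw [h3, hτ D]
      have e : a * g' D * (g D * ((rep D).gen i : Matrix (Fin (rep D).rk) (Fin (rep D).rk) ℂ) * g' D) * (g D * a')
          = a * ((rep D).gen i : Matrix (Fin (rep D).rk) (Fin (rep D).rk) ℂ) * a' := by
        calc _ = a * (g' D * g D) * ((rep D).gen i : Matrix (Fin (rep D).rk) (Fin (rep D).rk) ℂ) * (g' D * g D) * a' := by
              simp only [Matrix.mul_assoc]
          _ = _ := by rw [hg', Matrix.mul_one, Matrix.mul_one]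
      rw [Matrix.mul_smul, Matrix.smul_mul, e, smul_smul, ← Complex.exp_add]
      congr 2
      have h0 : (D.rk : ℂ) ≠ 0 := by exact_mod_cast D.rk_pos.ne'
      have hDD' : (D'.rk : ℂ) = D.rk := by rw [hDD]
      push_cast
      rw [hDD']
      field_simp
      ring
  obtain ⟨h, h', h1, h2, h3⟩ := key
  exact ⟨h, h', h1, h2, fun j => h3 (Sum.inl j), fun j => h3 (Sum.inr j)⟩

/-! ### Complex coordinates -/

theorem map_re_mulVec {n : ℕ} (T : Matrix (Fin n) (Fin n) ℂ) (y : Fin n → ℝ) (i : Fin n) :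
    ((T *ᵥ fun j => (y j : ℂ)) i).re = (T.map Complex.re *ᵥ y) i := by
  simp [Matrix.mulVec, dotProduct]

theorem map_im_mulVec {n : ℕ} (T : Matrix (Fin n) (Fin n) ℂ) (y : Fin n → ℝ) (i : Fin n) :
    ((T *ᵥ fun j => (y j : ℂ)) i).im = (T.map Complex.im *ᵥ y) i := by
  simp [Matrix.mulVec, dotProduct]

/-- `z = x + T y` is onto if the imaginary part of `T` is positive definite. -/
theorem zcoord_surjective {n : ℕ} {T : Matrix (Fin n) (Fin n) ℂ}
    (hIm : ∀ x : Fin n → ℝ, x ≠ 0 → 0 < x ⬝ᵥ (T.map Complex.im *ᵥ x)) :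
    Function.Surjective (zcoord T) := by
  -- Positivity makes `Im T` injective, hence bijective: `y` is read off from the imaginary part of
  -- `z`, and then `x` from the real part.
  have hinj : Function.Injective (T.map Complex.im).mulVec := by
    intro x y hxy
    by_contra hne
    have h1 := hIm (x - y) (sub_ne_zero.2 hne)
    have h2 : T.map Complex.im *ᵥ x = T.map Complex.im *ᵥ y := hxy
    rw [Matrix.mulVec_sub, h2, sub_self, dotProduct_zero] at h1
    exact lt_irrefl _ h1
  have hsurj : Function.Surjective (T.map Complex.im).mulVec :=
    Matrix.mulVec_surjective_iff_isUnit.2 (Matrix.mulVec_injective_iff_isUnit.1 hinj)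
  intro z
  obtain ⟨y, hy⟩ := hsurj fun i => (z i).im
  refine ⟨(fun i => (z i).re - (T.map Complex.re *ᵥ y) i, y), ?_⟩
  funext i
  apply Complex.ext
  · simp [zcoord, map_re_mulVec]
  · simp [zcoord, map_im_mulVec, congrFun hy i]

/-- Every real tangent vector is the real part of a vector of type `(0,1)`. -/
def HasComplexStructure {n : ℕ} (T : Matrix (Fin n) (Fin n) ℂ) : Prop :=
  ∀ v, ∃ w, IsType01 T v w

theorem hasComplexStructure_of_surjective {n : ℕ} {T : Matrix (Fin n) (Fin n) ℂ}
    (h : Function.Surjective (zcoord T)) : HasComplexStructure T := by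
  intro v
  obtain ⟨w, hw⟩ := h (Complex.I • zcoord T v)
  refine ⟨w, ?_⟩
  rw [IsType01, hw, smul_smul, Complex.I_mul_I, neg_one_smul, add_neg_cancel]

/-! ### Liouville's theorem on complex tori -/

theorem exists_add_period {n : ℕ} (u : Cover n) :
    ∃ (k : Deck n), ∃ u' ∈ Set.Icc (0 : Cover n) (fun _ => 2 * π, fun _ => 2 * π),
      u = u' + period k := by
  have h2 : (0 : ℝ) < 2 * π := by positivity
  have hk : ∀ t : ℝ, 0 ≤ t - 2 * π * ⌊t / (2 * π)⌋ ∧ t - 2 * π * ⌊t / (2 * π)⌋ ≤ 2 * π := by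
    intro t
    have h3 := Int.floor_le (t / (2 * π))
    have h4 := (Int.lt_floor_add_one (t / (2 * π))).le
    rw [le_div_iff₀ h2] at h3
    rw [div_le_iff₀ h2] at h4
    constructor <;> linarith
  let k : Deck n := (fun i => ⌊u.1 i / (2 * π)⌋, fun i => ⌊u.2 i / (2 * π)⌋)
  refine ⟨k, u - period k, ⟨⟨fun i => (hk _).1, fun i => (hk _).1⟩,
    ⟨fun i => (hk _).2, fun i => (hk _).2⟩⟩, by simp⟩

/-- Up to periods every point lies in a compact fundamental cube, where `H` is bounded. -/
theorem isBounded_range_of_norm_periodic {n : ℕ} {H : Cover n → ℂ} (hH : Continuous H)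
    (hper : ∀ k u, ‖H (u + period k)‖ = ‖H u‖) : Bornology.IsBounded (Set.range H) := by
  obtain ⟨C, hC⟩ := isCompact_Icc.exists_bound_of_continuousOn
    (s := Set.Icc (0 : Cover n) (fun _ => 2 * π, fun _ => 2 * π)) hH.continuousOn
  refine isBounded_iff_forall_norm_le.2 ⟨C, ?_⟩
  rintro _ ⟨u, rfl⟩
  obtain ⟨k, u', hu', rfl⟩ := exists_add_period u
  rw [hper]
  exact hC u' hu'

/-- Holomorphic functions whose absolute value is periodic are constant. -/
theorem eq_of_holomorphic_of_norm_periodic {n : ℕ} {T : Matrix (Fin n) (Fin n) ℂ}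
    (hT : HasComplexStructure T) {H : Cover n → ℂ} (hH : Differentiable ℝ H)
    (hper : ∀ k u, ‖H (u + period k)‖ = ‖H u‖)
    (hd : ∀ u v w, IsType01 T v w → fderiv ℝ H u v + Complex.I * fderiv ℝ H u w = 0)
    (u u' : Cover n) : H u = H u' := by
  obtain ⟨w, hw⟩ := hT (u' - u)
  -- The real line through `u` and `u'` is completed to a complex line: `w` is the direction for
  -- which `(u' - u) + 𝐢 w` has type `(0,1)`, so the hypothesis on `H` becomes the Cauchy–Riemann
  -- equation of `F`. As `F` is entire and bounded, `F 0 = F 1`.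
  let ℓ : ℂ →L[ℝ] Cover n := Complex.reCLM.smulRight (u' - u) + Complex.imCLM.smulRight w
  let F : ℂ → ℂ := fun t => H (u + ℓ t)
  have hF : ∀ t, HasFDerivAt F ((fderiv ℝ H (u + ℓ t)).comp ℓ) t := fun t =>
    (hH (u + ℓ t)).hasFDerivAt.comp t (ℓ.hasFDerivAt.const_add u)
  have hdiff : Differentiable ℂ F := fun t => by
    refine differentiableAt_complex_iff_differentiableAt_real.2 ⟨(hF t).differentiableAt, ?_⟩
    rw [(hF t).fderiv]
    have h1 := hd (u + ℓ t) _ _ hw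
    simp only [ContinuousLinearMap.comp_apply, ℓ, _root_.add_apply,
      ContinuousLinearMap.smulRight_apply, Complex.reCLM_apply, Complex.imCLM_apply, Complex.I_re,
      Complex.I_im, Complex.one_re, Complex.one_im, zero_smul, one_smul, zero_add, add_zero,
      smul_eq_mul] at h1 ⊢
    linear_combination (-Complex.I) * h1 + fderiv ℝ H (u + (t.re • (u' - u) + t.im • w)) w
      * Complex.I_mul_I
  have hb : Bornology.IsBounded (Set.range F) :=
    (isBounded_range_of_norm_periodic hH.continuous hper).subset (by
      rintro _ ⟨t, rfl⟩
      exact ⟨_, rfl⟩)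
  have h := hdiff.apply_eq_apply_of_bounded hb 0 1
  simpa [F, ℓ] using h

/-! ### Winding numbers -/

/-- The exponential is a covering of the punctured plane and the universal cover `ℝ²ⁿ` is simply
connected. -/
theorem exists_continuous_log {n : ℕ} {f : Cover n → ℂ} (hf : Continuous f) (h0 : ∀ u, f u ≠ 0) :
    ∃ g : Cover n → ℂ, Continuous g ∧ ∀ u, Complex.exp (g u) = f u := by
  obtain ⟨F, ⟨-, hF⟩, -⟩ := Complex.isCoveringMapOn_exp.existsUnique_continuousMap_lifts
    (⟨f, hf⟩ : C(Cover n, ℂ)) (a₀ := 0) (e₀ := Complex.log (f 0)) (Complex.exp_log (h0 0))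
    (fun u => h0 u)
  exact ⟨F, F.continuous, fun u => congrFun hF u⟩

theorem eq_of_exp_eq {n : ℕ} {g : Cover n → ℂ} (hg : Continuous g)
    (h : ∀ u u', Complex.exp (g u) = Complex.exp (g u')) (u u' : Cover n) : g u = g u' :=
  Complex.isCoveringMap_exp.const_of_comp hg (fun a a' => Subtype.ext (h a a')) u u'

/-- A nonvanishing function with multipliers `c₁ exp(𝐢 λ)` along `a` and `c₂` along `b` exists only
if `λ` is invariant under `b`. -/
theorem multiplier_invariant {n : ℕ} {f : Cover n → ℂ} (hf : Continuous f) (h0 : ∀ u, f u ≠ 0)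
    {a b : Cover n} {c₁ c₂ : ℂ} {lam : Cover n → ℝ} (hl : Continuous lam)
    (ha : ∀ u, f (u + a) = c₁ * Complex.exp (Complex.I * lam u) * f u)
    (hb : ∀ u, f (u + b) = c₂ * f u) (u : Cover n) : lam (u + b) = lam u := by
  obtain ⟨g, hg, hgf⟩ := exists_continuous_log hf h0
  have h1 : ∀ u, Complex.exp (g (u + a) - g u - Complex.I * lam u) = c₁ := fun u => by
    rw [Complex.exp_sub, Complex.exp_sub, hgf, hgf, ha]
    have := h0 u
    have := Complex.exp_ne_zero (Complex.I * lam u)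
    field_simp
  have h2 : ∀ u, Complex.exp (g (u + b) - g u) = c₂ := fun u => by
    rw [Complex.exp_sub, hgf, hgf, hb]
    have := h0 u
    field_simp
  have k1 := eq_of_exp_eq (g := fun u => g (u + a) - g u - Complex.I * lam u) (by fun_prop)
    (fun u u' => by rw [h1, h1])
  have k2 := eq_of_exp_eq (g := fun u => g (u + b) - g u) (by fun_prop)
    (fun u u' => by rw [h2, h2])
  -- The increments of `g` along `a` (corrected by `𝐢 λ`) and along `b` are constant. Computing `g
  -- (u + a + b)` in both orders leaves only the change of `λ` along `b`.
  have e1 := k1 (u + b) u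
  have e2 := k2 (u + a) u
  rw [add_right_comm] at e2
  have e3 : Complex.I * ((lam (u + b) : ℂ) - lam u) = 0 := by linear_combination e2 - e1
  have e4 := (mul_eq_zero.1 e3).resolve_left Complex.I_ne_zero
  exact_mod_cast sub_eq_zero.1 e4

/-! ### Pullback along the biholomorphic map -/

theorem fderiv_comp_linear {n : ℕ} {f : Cover n → ℂ} (hf : ContDiff ℝ ∞ f)
    (ℓ : Cover n →ₗ[ℝ] Cover n) (u v : Cover n) :
    fderiv ℝ (fun x => f (ℓ x)) u v = fderiv ℝ f (ℓ u) (ℓ v) := by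
  have h1 : HasFDerivAt (fun x => f (ℓ x))
      ((fderiv ℝ f (ℓ u)).comp (LinearMap.toContinuousLinearMap ℓ)) u :=
    (hf.differentiable (by simp) (ℓ u)).hasFDerivAt.comp u
      (LinearMap.toContinuousLinearMap ℓ).hasFDerivAt
  rw [h1.fderiv]
  rfl

theorem contDiff_comp_linear {n : ℕ} {f : Cover n → ℂ} (hf : ContDiff ℝ ∞ f)
    (ℓ : Cover n →ₗ[ℝ] Cover n) : ContDiff ℝ ∞ fun x => f (ℓ x) :=
  hf.comp (LinearMap.toContinuousLinearMap ℓ).contDiff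

/-- The inverse of `phi`. -/
def phiInv {n : ℕ} (δ : Matrix (Fin n) (Fin n) ℤ) : Cover n →ₗ[ℝ] Cover n :=
  LinearMap.prod (LinearMap.snd ℝ _ _ + (toR δ).mulVecLin ∘ₗ LinearMap.fst ℝ _ _)
    (-LinearMap.fst ℝ _ _)

theorem phi_phiInv {n : ℕ} (δ : Matrix (Fin n) (Fin n) ℤ) (u : Cover n) : phi δ (phiInv δ u) = u := by
  rw [phi_apply]
  refine Prod.ext ?_ ?_
  · simp [phiInv]
  · simp [phiInv, Matrix.mulVec_neg]

theorem phiInv_phi {n : ℕ} (δ : Matrix (Fin n) (Fin n) ℤ) (u : Cover n) : phiInv δ (phi δ u) = u := by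
  rw [phi_apply]
  refine Prod.ext ?_ ?_
  · simp [phiInv, Matrix.mulVec_neg]
  · simp [phiInv]

theorem phiDeck_surjective {n : ℕ} (δ : Matrix (Fin n) (Fin n) ℤ) :
    Function.Surjective (phiDeck δ) := fun k =>
  ⟨(k.2 + δ *ᵥ k.1, -k.1), by simp [phiDeck_apply, Matrix.mulVec_neg]⟩

section Pullback

variable {n : ℕ} {T : Matrix (Fin n) (Fin n) ℂ} {δ : Matrix (Fin n) (Fin n) ℤ}

theorem isUnit_det_of_sub (hδ : (T - toC δ).det ≠ 0) : (-T + toC δ).det ≠ 0 := by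
  have : -T + toC δ = -(T - toC δ) := by abel
  rw [this, Matrix.det_neg]
  exact mul_ne_zero (pow_ne_zero _ (by norm_num)) hδ

theorem isType01_phi (hδ : (T - toC δ).det ≠ 0) (v w : Cover n) :
    IsType01 (Tprime T δ) (phi δ v) (phi δ w) ↔ IsType01 T v w := by
  have hd := isUnit_det_of_sub hδ
  have hu : IsUnit (-T + toC δ).det := isUnit_iff_ne_zero.2 hd
  rw [IsType01, IsType01, zcoord_phi T δ hd, zcoord_phi T δ hd, ← Matrix.mulVec_smul,
    ← Matrix.mulVec_add]
  constructor
  · intro h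
    have h1 := congrArg ((-T + toC δ) *ᵥ ·) h
    simpa [Matrix.mulVec_mulVec, Matrix.mul_nonsing_inv _ hu] using h1
  · intro h
    rw [h, Matrix.mulVec_zero]

theorem hasComplexStructure_Tprime (hδ : (T - toC δ).det ≠ 0) (hT : HasComplexStructure T) :
    HasComplexStructure (Tprime T δ) := by
  intro v
  obtain ⟨w, hw⟩ := hT (phiInv δ v)
  refine ⟨phi δ w, ?_⟩
  rw [← phi_phiInv δ v, isType01_phi hδ]
  exact hw

namespace TorusBundle

variable {B B' : TorusBundle n}

theorem covDeriv_pullback {ψ : Cover n → Matrix (Fin B'.rank) (Fin B.rank) ℂ}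
    (hψ : ∀ a b, ContDiff ℝ ∞ fun u => ψ u a b) (u v : Cover n) :
    covDeriv (B.pullback δ) (B'.pullback δ) (fun u => ψ (phi δ u)) u v
      = covDeriv B B' ψ (phi δ u) (phi δ v) := by
  ext a b
  have := fderiv_comp_linear (hψ a b) (phi δ) u v
  exact congrArg (· + (B'.form (phi δ u) (phi δ v) - B.form (phi δ u) (phi δ v))
    * ψ (phi δ u) a b) this

theorem IsHolHom.pullback (hδ : (T - toC δ).det ≠ 0)
    {ψ : Cover n → Matrix (Fin B'.rank) (Fin B.rank) ℂ} (h : IsHolHom (Tprime T δ) B B' ψ) :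
    IsHolHom T (B.pullback δ) (B'.pullback δ) fun u => ψ (phi δ u) where
  smooth a b := contDiff_comp_linear (h.smooth a b) (phi δ)
  equivariant k u := by
    rw [map_add, phi_period]
    exact h.equivariant _ _
  dbar_closed u v w hvw := by
    rw [covDeriv_pullback h.smooth, covDeriv_pullback h.smooth]
    exact h.dbar_closed _ _ _ ((isType01_phi hδ v w).2 hvw)

/-- Transport along `φ⁻¹`, which has an integral lift inducing a bijection of deck groups; hence
isomorphism and simplicity may be studied for `T'` before pulling back. -/
theorem IsHolHom.of_pullback (hδ : (T - toC δ).det ≠ 0)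
    {ψ : Cover n → Matrix (Fin B'.rank) (Fin B.rank) ℂ}
    (h : IsHolHom T (B.pullback δ) (B'.pullback δ) ψ) :
    IsHolHom (Tprime T δ) B B' fun u => ψ (phiInv δ u) where
  smooth a b := contDiff_comp_linear (h.smooth a b) (phiInv δ)
  equivariant k u := by
    obtain ⟨k, rfl⟩ := phiDeck_surjective δ k
    have h1 : ψ (phiInv δ u + period k) * B.mult (phiDeck δ k) (phi δ (phiInv δ u))
      = B'.mult (phiDeck δ k) (phi δ (phiInv δ u)) * ψ (phiInv δ u) := h.equivariant k (phiInv δ u)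
    have h2 : phiInv δ (u + period (phiDeck δ k)) = phiInv δ u + period k := by
      rw [map_add, ← phi_period, phiInv_phi]
    rw [h2]
    rwa [phi_phiInv] at h1
  dbar_closed u v w hvw := by
    have hs : ∀ a b, ContDiff ℝ ∞ fun x => ψ (phiInv δ x) a b := fun a b =>
      contDiff_comp_linear (h.smooth a b) (phiInv δ)
    have e : (fun x => ψ (phiInv δ (phi δ x))) = ψ := funext fun x => by rw [phiInv_phi]
    have h1 := h.dbar_closed (phiInv δ u) (phiInv δ v) (phiInv δ w)
      ((isType01_phi hδ _ _).1 (by rwa [phi_phiInv, phi_phiInv]))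
    have key := covDeriv_pullback (B := B) (B' := B') (δ := δ) hs
    simp only [phiInv_phi] at key
    have k1 := key (phiInv δ u) (phiInv δ v)
    have k2 := key (phiInv δ u) (phiInv δ w)
    rw [phi_phiInv, phi_phiInv] at k1 k2
    rw [← k1, ← k2]
    exact h1

theorem isomorphic_pullback_iff (hδ : (T - toC δ).det ≠ 0) :
    Isomorphic T (B.pullback δ) (B'.pullback δ) ↔ Isomorphic (Tprime T δ) B B' := by
  constructor
  · rintro ⟨ψ, χ, h1, h2, h3⟩
    exact ⟨_, _, h1.of_pullback hδ, h2.of_pullback hδ, fun u => h3 _⟩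
  · rintro ⟨ψ, χ, h1, h2, h3⟩
    exact ⟨_, _, h1.pullback hδ, h2.pullback hδ, fun u => h3 _⟩

theorem IsSimple.pullback (hδ : (T - toC δ).det ≠ 0) (h : IsSimple (Tprime T δ) B) :
    IsSimple T (B.pullback δ) := by
  intro ψ hψ
  obtain ⟨c, hc⟩ := h _ (hψ.of_pullback hδ)
  refine ⟨c, fun u => ?_⟩
  have := hc (phi δ u)
  rwa [phiInv_phi] at this

theorem curvature_pullback (B : TorusBundle n) (u v w : Cover n) :
    (B.pullback δ).curvature u v w = B.curvature (phi δ u) (phi δ v) (phi δ w) := by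
  rw [curvature, curvature, ← fderiv_comp_linear (B.form_smooth (phi δ w)) (phi δ),
    ← fderiv_comp_linear (B.form_smooth (phi δ v)) (phi δ)]
  rfl

end TorusBundle

end Pullback

/-! ### Change of frame for words -/

section Frame

variable {k k' : ℕ} (g : Matrix (Fin k') (Fin k) ℂ) (g' : Matrix (Fin k) (Fin k') ℂ)

/-- `W' = exp(𝐢 t) g W g'`. -/
def FrameRel (t : ℝ) (W : Matrix.unitaryGroup (Fin k) ℂ) (W' : Matrix.unitaryGroup (Fin k') ℂ) :
    Prop :=
  (W' : Matrix (Fin k') (Fin k') ℂ)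
    = Complex.exp (Complex.I * t) • (g * (W : Matrix (Fin k) (Fin k) ℂ) * g')

variable {g g'}

theorem FrameRel.mul (hg' : g' * g = 1) {s t : ℝ} {a b : Matrix.unitaryGroup (Fin k) ℂ}
    {a' b' : Matrix.unitaryGroup (Fin k') ℂ} (ha : FrameRel g g' s a a')
    (hb : FrameRel g g' t b b') : FrameRel g g' (s + t) (a * b) (a' * b') := by
  unfold FrameRel at *
  simp only [Submonoid.coe_mul]
  have e : g * (a : Matrix (Fin k) (Fin k) ℂ) * g' * (g * (b : Matrix (Fin k) (Fin k) ℂ) * g')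
      = g * ((a : Matrix (Fin k) (Fin k) ℂ) * (b : Matrix (Fin k) (Fin k) ℂ)) * g' := by
    calc _ = g * (a : Matrix (Fin k) (Fin k) ℂ) * (g' * g) * (b : Matrix (Fin k) (Fin k) ℂ) * g' := by
          simp only [Matrix.mul_assoc]
      _ = _ := by rw [hg', Matrix.mul_one]; simp only [Matrix.mul_assoc]
  rw [ha, hb, Matrix.smul_mul, Matrix.mul_smul, e, smul_smul, ← Complex.exp_add]
  push_cast
  rw [mul_add]

theorem FrameRel.one (hg : g * g' = 1) : FrameRel g g' 0 1 1 := by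
  simp [FrameRel, hg]

theorem FrameRel.inv (hg : g * g' = 1) (hg' : g' * g = 1) {t : ℝ}
    {a : Matrix.unitaryGroup (Fin k) ℂ} {a' : Matrix.unitaryGroup (Fin k') ℂ}
    (ha : FrameRel g g' t a a') : FrameRel g g' (-t) a⁻¹ a'⁻¹ := by
  unfold FrameRel at *
  change (a' : Matrix (Fin k') (Fin k') ℂ)ᴴ
    = Complex.exp (Complex.I * (-t : ℝ)) • (g * (a : Matrix (Fin k) (Fin k) ℂ)ᴴ * g')
  have e : g * (a : Matrix (Fin k) (Fin k) ℂ) * g' * (g * (a : Matrix (Fin k) (Fin k) ℂ)ᴴ * g')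
      = 1 := by
    calc _ = g * (a : Matrix (Fin k) (Fin k) ℂ) * (g' * g) * (a : Matrix (Fin k) (Fin k) ℂ)ᴴ * g' := by
          simp only [Matrix.mul_assoc]
      _ = _ := by rw [hg', Matrix.mul_one, Matrix.mul_assoc g, unitary_mul_star, Matrix.mul_one, hg]
  have h1 : (a' : Matrix (Fin k') (Fin k') ℂ) * (Complex.exp (Complex.I * (-t : ℝ)) •
      (g * (a : Matrix (Fin k) (Fin k) ℂ)ᴴ * g')) = 1 := by
    rw [ha, Matrix.smul_mul, Matrix.mul_smul, e, smul_smul, ← Complex.exp_add]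
    simp
  rw [← Matrix.mul_one (a' : Matrix (Fin k') (Fin k') ℂ)ᴴ, ← h1, ← Matrix.mul_assoc,
    unitary_star_mul, Matrix.one_mul]

theorem FrameRel.zpow (hg : g * g' = 1) (hg' : g' * g = 1) {t : ℝ}
    {a : Matrix.unitaryGroup (Fin k) ℂ} {a' : Matrix.unitaryGroup (Fin k') ℂ}
    (ha : FrameRel g g' t a a') (m : ℤ) : FrameRel g g' (t * m) (a ^ m) (a' ^ m) := by
  have hn : ∀ m : ℕ, FrameRel g g' (t * m) (a ^ m) (a' ^ m) := by
    intro m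
    induction m with
    | zero => simpa using FrameRel.one hg
    | succ m ih => rw [pow_succ, pow_succ]; have := ih.mul hg' ha; convert this using 1; push_cast; ring
  cases m with
  | ofNat m => simpa using hn m
  | negSucc m =>
    rw [zpow_negSucc, zpow_negSucc]
    have := (hn (m + 1)).inv hg hg'
    convert this using 1
    push_cast
    ring

theorem FrameRel.zpowProd (hg : g * g' = 1) (hg' : g' * g = 1) {n : ℕ} {t : Fin n → ℝ}
    {W : Fin n → Matrix.unitaryGroup (Fin k) ℂ} {W' : Fin n → Matrix.unitaryGroup (Fin k') ℂ}
    (h : ∀ j, FrameRel g g' (t j) (W j) (W' j)) (m : Fin n → ℤ) :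
    FrameRel g g' (∑ j, t j * m j) (zpowProd W m) (zpowProd W' m) := by
  induction n with
  | zero => simpa [TorusMirror.zpowProd] using FrameRel.one hg
  | succ n ih =>
    rw [zpowProd_succ, zpowProd_succ, Fin.sum_univ_succ]
    exact ((h 0).zpow hg hg' _).mul hg' (ih (fun j => h j.succ) _)

end Frame

namespace TransData

variable {n : ℕ}

/-- Phases add up along a word, so a frame relation on generators extends to all words with a phase
linear in the deck transformation. This linear phase is later compared with the multipliers of a
holomorphic map. -/
theorem word_eq_of_frame {D D' : TransData n} {g : Matrix (Fin D'.rk) (Fin D.rk) ℂ}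
    {g' : Matrix (Fin D.rk) (Fin D'.rk) ℂ} (hg : g * g' = 1) (hg' : g' * g = 1) {x y : Fin n → ℝ}
    (hV : ∀ j, FrameRel g g' (x j) (D.V j) (D'.V j))
    (hU : ∀ j, FrameRel g g' (y j) (D.U j) (D'.U j)) (k : Deck n) :
    D'.word k = Complex.exp (Complex.I * (∑ j, x j * k.1 j + ∑ j, y j * k.2 j : ℝ)) •
      (g * D.word k * g') :=
  (FrameRel.zpowProd hg hg' hV k.1).mul hg' (FrameRel.zpowProd hg hg' hU k.2)

theorem SameSlope.symm {D D' : TransData n} (h : SameSlope D D') : SameSlope D' D :=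
  Eq.symm h

theorem SameSlope.mulVec_div {D D' : TransData n} (h : SameSlope D D') (v : Fin n → ℝ) (i : Fin n) :
    (1 / (D'.r : ℝ)) * (toR D'.A *ᵥ v) i = (1 / (D.r : ℝ)) * (toR D.A *ᵥ v) i := by
  simp only [Matrix.mulVec, dotProduct, Finset.mul_sum, Matrix.map_apply]
  refine Finset.sum_congr rfl fun j _ => ?_
  linear_combination v j * h.div_eq i j

theorem SameSlope.expo_eq {D D' : TransData n} (h : SameSlope D D') (k : Deck n) (u : Cover n) :
    D'.expo k u = D.expo k u := by
  simp only [expo, dotProduct, Finset.mul_sum]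
  refine Finset.sum_congr rfl fun i _ => ?_
  linear_combination (u.2 + (period k).2) i * h.mulVec_div (fun i => (k.1 i : ℝ)) i

/-! ### Morphisms between bundles of the same slope -/

/-- The linear form `αᵗ dY - βᵗ dX`. -/
def _root_.TorusMirror.linForm (α β : Fin n → ℝ) : Cover n →ₗ[ℝ] ℝ :=
  dotProductBilin ℝ ℝ α ∘ₗ LinearMap.snd ℝ _ _ - dotProductBilin ℝ ℝ β ∘ₗ LinearMap.fst ℝ _ _

theorem _root_.TorusMirror.linForm_apply (α β : Fin n → ℝ) (u : Cover n) :
    linForm α β u = α ⬝ᵥ u.2 - β ⬝ᵥ u.1 := rfl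

/-- `μ = p + Tᵗ q` -/
def _root_.TorusMirror.muOf (T : Matrix (Fin n) (Fin n) ℂ) (p q : Fin n → ℝ) : Fin n → ℂ :=
  (fun i => (p i : ℂ)) + Tᵀ *ᵥ fun i => (q i : ℂ)

/-- The difference `p' / r' - p / r` of normalized parameters. -/
def diff (D D' : TransData n) (p p' : Fin n → ℝ) : Fin n → ℝ := fun i => p' i / D'.r - p i / D.r

theorem form_apply (D : TransData n) (μ : Fin n → ℂ) (u v : Cover n) :
    (D.bundle μ).form u v = -(Complex.I / (2 * π)) * ∑ i,
        ((1 / (D.r : ℂ)) * (((toR D.A *ᵥ u.1) i : ℝ) : ℂ) + (1 / (D.r : ℂ)) * μ i) * (v.2 i : ℂ) :=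
  rfl

/-- The terms with `A` cancel, leaving the constant form `(α + Tᵗ β)ᵗ dY` with `α`, `β` the
differences of `p / r` and `q / r`. Adding and subtracting `βᵗ dX` splits it into the real form `αᵗ
dY - βᵗ dX` and the `(1,0)`-form `βᵗ dz`. -/
theorem SameSlope.form_sub {D D' : TransData n} (h : SameSlope D D')
    (T : Matrix (Fin n) (Fin n) ℂ) (p q p' q' : Fin n → ℝ) (u v : Cover n) :
    (D'.bundle (muOf T p' q')).form u v - (D.bundle (muOf T p q)).form u v
      = -(Complex.I / (2 * π)) * (linForm (diff D D' p p') (diff D D' q q') v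
        + (fun i => (diff D D' q q' i : ℂ)) ⬝ᵥ zcoord T v) := by
  rw [form_apply, form_apply, ← mul_sub, ← Finset.sum_sub_distrib]
  congr 1
  have h1 : ∀ i, (1 / (D'.r : ℂ)) * (((toR D'.A *ᵥ u.1) i : ℝ) : ℂ)
      = (1 / (D.r : ℂ)) * (((toR D.A *ᵥ u.1) i : ℝ) : ℂ) := fun i => by
    simpa only [Complex.ofReal_mul, Complex.ofReal_div, Complex.ofReal_one,
      Complex.ofReal_natCast] using congrArg Complex.ofReal (h.mulVec_div u.1 i)
  have h2 : ∀ i, (1 / (D'.r : ℂ)) * muOf T p' q' i - (1 / (D.r : ℂ)) * muOf T p q i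
      = (diff D D' p p' i : ℂ) + (Tᵀ *ᵥ fun i => (diff D D' q q' i : ℂ)) i := by
    intro i
    have e : (fun i => (diff D D' q q' i : ℂ)) = (1 / (D'.r : ℂ)) • (fun i => (q' i : ℂ))
        - (1 / (D.r : ℂ)) • (fun i => (q i : ℂ)) := by
      ext i
      simp [diff]
      ring
    rw [e, Matrix.mulVec_sub, Matrix.mulVec_smul, Matrix.mulVec_smul]
    simp [muOf, diff]
    ring
  have h3 : ∀ i, ((1 / (D'.r : ℂ)) * (((toR D'.A *ᵥ u.1) i : ℝ) : ℂ)
        + (1 / (D'.r : ℂ)) * muOf T p' q' i) * (v.2 i : ℂ)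
      - ((1 / (D.r : ℂ)) * (((toR D.A *ᵥ u.1) i : ℝ) : ℂ)
        + (1 / (D.r : ℂ)) * muOf T p q i) * (v.2 i : ℂ)
      = (diff D D' p p' i : ℂ) * (v.2 i : ℂ)
        + (Tᵀ *ᵥ fun i => (diff D D' q q' i : ℂ)) i * (v.2 i : ℂ) := fun i => by
    linear_combination (v.2 i : ℂ) * h1 i + (v.2 i : ℂ) * h2 i
  rw [Finset.sum_congr rfl fun i _ => h3 i, Finset.sum_add_distrib]
  have h4 : ∑ i, (Tᵀ *ᵥ fun i => (diff D D' q q' i : ℂ)) i * (v.2 i : ℂ)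
      = (fun i => (diff D D' q q' i : ℂ)) ⬝ᵥ (T *ᵥ fun i => (v.2 i : ℂ)) := by
    rw [Matrix.dotProduct_mulVec, Matrix.mulVec_transpose]
    rfl
  rw [h4, zcoord, dotProduct_add, linForm_apply]
  simp only [dotProduct, Complex.ofReal_sub, Complex.ofReal_sum, Complex.ofReal_mul]
  ring

/-- The part `βᵗ dz` vanishes on vectors of type `(0,1)`. Only a real form times `𝐢 / 2π` remains,
so the function integrating it has modulus one. -/
theorem SameSlope.form_sub_type01 {D D' : TransData n} (h : SameSlope D D')
    {T : Matrix (Fin n) (Fin n) ℂ} (p q p' q' : Fin n → ℝ) (u : Cover n) {v w : Cover n}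
    (hvw : IsType01 T v w) :
    ((D'.bundle (muOf T p' q')).form u v - (D.bundle (muOf T p q)).form u v)
      + Complex.I * ((D'.bundle (muOf T p' q')).form u w - (D.bundle (muOf T p q)).form u w)
      = -(Complex.I / (2 * π)) * (linForm (diff D D' p p') (diff D D' q q') v
        + Complex.I * linForm (diff D D' p p') (diff D D' q q') w) := by
  rw [h.form_sub, h.form_sub]
  have h1 := congrArg ((fun i => (diff D D' q q' i : ℂ)) ⬝ᵥ ·) hvw
  simp only [dotProduct_add, dotProduct_smul, dotProduct_zero, smul_eq_mul] at h1
  linear_combination (-(Complex.I / (2 * π))) * h1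

/-- Holomorphic maps between bundles of the same slope. -/
theorem SameSlope.isHolHom_iff {D D' : TransData n} (h : SameSlope D D')
    {T : Matrix (Fin n) (Fin n) ℂ} {p q p' q' : Fin n → ℝ}
    {ψ : Cover n → Matrix (Fin D'.rk) (Fin D.rk) ℂ} :
    TorusBundle.IsHolHom T (D.bundle (muOf T p q)) (D'.bundle (muOf T p' q')) ψ ↔
      (∀ a b, ContDiff ℝ ∞ fun u => ψ u a b) ∧
      (∀ k u, ψ (u + period k) * D.word k = D'.word k * ψ u) ∧
      ∀ u v w, IsType01 T v w → ∀ a b, fderiv ℝ (fun x => ψ x a b) u v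
        + Complex.I * fderiv ℝ (fun x => ψ x a b) u w
        = Complex.I / (2 * π) * (linForm (diff D D' p p') (diff D D' q q') v
          + Complex.I * linForm (diff D D' p p') (diff D D' q q') w) * ψ u a b := by
  -- Equal slopes give equal scalar exponentials in the transition functions, and these cancel: the
  -- equivariance only involves constant matrices.
  have h1 : ∀ k u, (ψ (u + period k) * D.trans k u = D'.trans k u * ψ u ↔
      ψ (u + period k) * D.word k = D'.word k * ψ u) := by
    intro k u
    rw [trans, trans, h.expo_eq, Matrix.mul_smul, Matrix.smul_mul]
    exact (smul_right_injective _ (Complex.exp_ne_zero _)).eq_iff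
  have h2 : ∀ u v w, IsType01 T v w →
      (TorusBundle.covDeriv (D.bundle (muOf T p q)) (D'.bundle (muOf T p' q')) ψ u v + Complex.I •
        TorusBundle.covDeriv (D.bundle (muOf T p q)) (D'.bundle (muOf T p' q')) ψ u w = 0 ↔
      ∀ a b, fderiv ℝ (fun x => ψ x a b) u v
        + Complex.I * fderiv ℝ (fun x => ψ x a b) u w
        = Complex.I / (2 * π) * (linForm (diff D D' p p') (diff D D' q q') v
          + Complex.I * linForm (diff D D' p p') (diff D D' q q') w) * ψ u a b) := by
    intro u v w hvw
    have h3 := h.form_sub_type01 p q p' q' u hvw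
    rw [← Matrix.ext_iff]
    refine forall_congr' fun a => forall_congr' fun b => ?_
    change fderiv ℝ (fun x => ψ x a b) u v
      + ((D'.bundle (muOf T p' q')).form u v - (D.bundle (muOf T p q)).form u v) * ψ u a b
      + Complex.I * (fderiv ℝ (fun x => ψ x a b) u w
      + ((D'.bundle (muOf T p' q')).form u w - (D.bundle (muOf T p q)).form u w) * ψ u a b) = 0 ↔ _
    constructor
    · intro h4
      linear_combination h4 - ψ u a b * h3
    · intro h4
      linear_combination h4 + ψ u a b * h3
  constructor
  · rintro ⟨a, b, c⟩
    exact ⟨a, fun k u => (h1 k u).1 (b k u), fun u v w hvw => (h2 u v w hvw).1 (c u v w hvw)⟩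
  · rintro ⟨a, b, c⟩
    exact ⟨a, fun k u => (h1 k u).2 (b k u), fun u v w hvw => (h2 u v w hvw).2 (c u v w hvw)⟩

theorem pairing_antisymm (D : TransData n) (k w : Deck n) : D.pairing w k = -D.pairing k w := by
  simp only [pairing]
  ring

theorem star_mul_star_mul_word (D : TransData n) (k w : Deck n) :
    (D.word k)ᴴ * ((D.word w)ᴴ * D.word k)
      = Complex.exp (D.pairing k w * Complex.I) • (D.word w)ᴴ := by
  have h1 : (D.word k)ᴴ * (D.word w * D.word k)
      = Complex.exp (D.pairing w k * Complex.I) • D.word w := by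
    rw [D.word_mul_word w k, Matrix.mul_smul, ← Matrix.mul_assoc, star_mul_word, Matrix.one_mul]
  have h2 := congrArg Matrix.conjTranspose h1
  rw [Matrix.conjTranspose_mul, Matrix.conjTranspose_mul, Matrix.conjTranspose_conjTranspose,
    Matrix.conjTranspose_smul, Matrix.mul_assoc] at h2
  rw [h2, Complex.star_def, ← Complex.exp_conj, pairing_antisymm]
  simp

theorem hasFDerivAt_exp_linForm (c : ℂ) (α β : Fin n → ℝ) (u : Cover n) :
    HasFDerivAt (fun u => Complex.exp (c * linForm α β u))
      (Complex.exp (c * linForm α β u) • (c • Complex.ofRealCLM.comp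
        (LinearMap.toContinuousLinearMap (linForm α β)))) u := by
  have h1 : HasFDerivAt (fun u => c * ((linForm α β u : ℝ) : ℂ)) (c • Complex.ofRealCLM.comp
        (LinearMap.toContinuousLinearMap (linForm α β))) u :=
    (Complex.ofRealCLM.comp (LinearMap.toContinuousLinearMap
      (linForm α β))).hasFDerivAt.const_mul c
  exact h1.cexp

theorem contDiff_exp_linForm (c : ℂ) (α β : Fin n → ℝ) :
    ContDiff ℝ ∞ (fun u => Complex.exp (c * linForm α β u)) :=
  (contDiff_const.mul (Complex.ofRealCLM.contDiff.comp
    (LinearMap.toContinuousLinearMap (linForm α β)).contDiff)).cexp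

theorem _root_.TorusMirror.norm_exp_real_mul_I (t : ℝ) : ‖Complex.exp (Complex.I * t)‖ = 1 := by
  rw [mul_comm, Complex.norm_exp_ofReal_mul_I]

/-- The component of a holomorphic map along a word is determined by its value at the origin, and
can be nonzero only if the multipliers agree. -/
theorem SameSlope.trace_section {D D' : TransData n} (h : SameSlope D D')
    {T : Matrix (Fin n) (Fin n) ℂ} (hT : HasComplexStructure T) {p q p' q' : Fin n → ℝ}
    {g : Matrix (Fin D'.rk) (Fin D.rk) ℂ} {g' : Matrix (Fin D.rk) (Fin D'.rk) ℂ}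
    (hg' : g' * g = 1) {t : Deck n → ℝ}
    (hw : ∀ k, D'.word k = Complex.exp (Complex.I * t k) • (g * D.word k * g'))
    {ψ : Cover n → Matrix (Fin D'.rk) (Fin D.rk) ℂ}
    (hψ : TorusBundle.IsHolHom T (D.bundle (muOf T p q)) (D'.bundle (muOf T p' q')) ψ)
    (w : Deck n) :
    (∀ u, ((D.word w)ᴴ * (g' * ψ u)).trace
      = Complex.exp (Complex.I / (2 * π) * linForm (diff D D' p p') (diff D D' q q') u)
        * ((D.word w)ᴴ * (g' * ψ 0)).trace) ∧
    (((D.word w)ᴴ * (g' * ψ 0)).trace ≠ 0 → ∀ k,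
      Complex.exp (Complex.I / (2 * π) * linForm (diff D D' p p') (diff D D' q q') (period k))
        = Complex.exp (Complex.I * (t k + D.pairing k w : ℝ))) := by
  obtain ⟨hsm, heq, hdb⟩ := h.isHolHom_iff.1 hψ
  set α := diff D D' p p'
  set β := diff D D' q q'
  set C := (D.word w)ᴴ * g' with hC
  set f : Cover n → ℂ := fun u => ((D.word w)ᴴ * (g' * ψ u)).trace with hf
  have hfs : f = fun u => ∑ b, ∑ a, C b a * ψ u a b := by
    funext u
    simp only [hf, ← Matrix.mul_assoc, Matrix.trace, Matrix.diag_apply]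
    exact Finset.sum_congr rfl fun b _ => Matrix.mul_apply
  have hfd : ∀ u, HasFDerivAt f (∑ b, ∑ a, C b a • fderiv ℝ (fun x => ψ x a b) u) u := by
    intro u
    rw [hfs]
    refine HasFDerivAt.fun_sum fun b _ => HasFDerivAt.fun_sum fun a _ => ?_
    exact ((hsm a b).differentiable (by simp) u).hasFDerivAt.const_mul _
  have hfdb : ∀ u v w, IsType01 T v w → fderiv ℝ f u v + Complex.I * fderiv ℝ f u w
      = Complex.I / (2 * π) * (linForm α β v + Complex.I * linForm α β w) * f u := by
    intro u v w hvw
    rw [(hfd u).fderiv, hfs]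
    simp only [_root_.sum_apply, _root_.smul_apply, smul_eq_mul, Finset.mul_sum,
      ← Finset.sum_add_distrib]
    refine Finset.sum_congr rfl fun b _ => Finset.sum_congr rfl fun a _ => ?_
    linear_combination C b a * hdb u v w hvw a b
  -- Equivariance conjugates `g' ψ` by the word `k`. Under the trace against the word `w` this
  -- conjugation becomes the commutator phase, so `f` has scalar multipliers.
  have hfeq : ∀ k u, f (u + period k) = Complex.exp (Complex.I * (t k + D.pairing k w : ℝ)) * f u := by
    intro k u
    have h1 : g' * ψ (u + period k) * D.word k
        = Complex.exp (Complex.I * t k) • (D.word k * (g' * ψ u)) := by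
      rw [Matrix.mul_assoc, heq, hw, Matrix.smul_mul, Matrix.mul_smul]
      congr 1
      rw [← Matrix.mul_assoc, ← Matrix.mul_assoc, ← Matrix.mul_assoc, hg', Matrix.one_mul,
        Matrix.mul_assoc]
    have h2 : g' * ψ (u + period k)
        = Complex.exp (Complex.I * t k) • (D.word k * (g' * ψ u) * (D.word k)ᴴ) := by
      rw [← Matrix.mul_one (g' * ψ (u + period k)), ← D.word_mul_star k, ← Matrix.mul_assoc, h1,
        Matrix.smul_mul]
    simp only [hf]
    rw [h2, Matrix.mul_smul, Matrix.trace_smul, ← Matrix.mul_assoc, Matrix.trace_mul_comm,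
      ← Matrix.mul_assoc, ← Matrix.mul_assoc, Matrix.mul_assoc _ _ (D.word k),
      star_mul_star_mul_word, Matrix.smul_mul, Matrix.trace_smul, smul_eq_mul, smul_eq_mul,
      ← mul_assoc, ← Complex.exp_add]
    congr 2
    push_cast
    ring
  -- Removing the exponential of the linear form makes `f` holomorphic, while the multipliers keep
  -- modulus one; Liouville's theorem applies.
  set H : Cover n → ℂ := fun u => Complex.exp (-(Complex.I / (2 * π)) * linForm α β u) * f u with hH
  have hHd : ∀ u, HasFDerivAt H _ u := fun u =>
    (hasFDerivAt_exp_linForm (-(Complex.I / (2 * π))) α β u).mul (hfd u).differentiableAt.hasFDerivAt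
  have hexp : ∀ s : ℝ, -(Complex.I / (2 * π)) * (s : ℂ) = Complex.I * ((-(s / (2 * π)) : ℝ) : ℂ) := by
    intro s
    push_cast
    ring
  have hper : ∀ k u, H (u + period k) = Complex.exp (-(Complex.I / (2 * π)) * linForm α β (period k))
      * Complex.exp (Complex.I * (t k + D.pairing k w : ℝ)) * H u := by
    intro k u
    simp only [hH]
    rw [hfeq, map_add, Complex.ofReal_add, mul_add, Complex.exp_add]
    ring
  have hconst : ∀ u u', H u = H u' := eq_of_holomorphic_of_norm_periodic hT
    (fun u => (hHd u).differentiableAt)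
    (fun k u => by
      rw [hper, norm_mul, norm_mul, hexp, norm_exp_real_mul_I, norm_exp_real_mul_I, one_mul, one_mul])
    (fun u v w hvw => by
      rw [(hHd u).fderiv]
      simp only [_root_.add_apply, _root_.smul_apply, smul_eq_mul,
        ContinuousLinearMap.comp_apply, Complex.ofRealCLM_apply, LinearMap.coe_toContinuousLinearMap']
      linear_combination Complex.exp (-(Complex.I / (2 * π)) * linForm α β u) * hfdb u v w hvw)
  refine ⟨fun u => ?_, fun h0 k => ?_⟩
  · have h1 := hconst u 0
    simp only [hH, map_zero, Complex.ofReal_zero, mul_zero, Complex.exp_zero, one_mul] at h1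
    change f u = _ * f 0
    rw [← h1, ← mul_assoc, ← Complex.exp_add]
    simp
  -- A nonzero constant can only have multiplier one.
  · have h1 := hper k 0
    rw [hconst _ 0] at h1
    have hH0 : H 0 ≠ 0 := mul_ne_zero (Complex.exp_ne_zero _) h0
    have h2 := mul_right_cancel₀ hH0 ((one_mul (H 0)).trans h1)
    rw [neg_mul, Complex.exp_neg] at h2
    exact (inv_mul_eq_one₀ (Complex.exp_ne_zero _)).1 h2.symm

/-- The bundles `E_(r,A,μ,𝒰)` are simple. -/
theorem isSimple_bundle (D : TransData n) {T : Matrix (Fin n) (Fin n) ℂ}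
    (hT : HasComplexStructure T) (p q : Fin n → ℝ) :
    TorusBundle.IsSimple T (D.bundle (muOf T p q)) := by
  have hs : SameSlope D D := rfl
  have hd : ∀ p, diff D D p p = 0 := fun p => by ext; simp [diff]
  have hL : ∀ u, linForm (0 : Fin n → ℝ) 0 u = 0 := fun u => by simp [linForm_apply]
  intro ψ hψ
  change Cover n → Matrix (Fin D.rk) (Fin D.rk) ℂ at ψ
  have hconst : ∀ u, ψ u = ψ 0 := by
    intro u
    by_contra hne
    obtain ⟨w, hw⟩ := D.exists_trace_word_ne_zero (sub_ne_zero.2 hne)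
    -- For endomorphisms the linear form is zero, so every component along a word is constant. As
    -- words detect nonzero matrices, `ψ` is constant, and equivariance puts it in the commutant of
    -- the words.
    have h1 := (hs.trace_section hT (g := 1) (g' := 1) (t := 0) (by simp) (by simp) hψ w).1 u
    rw [hd, hd, hL] at h1
    simp only [Complex.ofReal_zero, mul_zero, Complex.exp_zero, one_mul] at h1
    rw [Matrix.mul_sub, Matrix.trace_sub, h1, sub_self] at hw
    exact hw rfl
  obtain ⟨-, heq, -⟩ := hs.isHolHom_iff.1 hψ
  obtain ⟨c, hc⟩ := D.eq_smul_one_of_commute_word (M := ψ 0) fun k => by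
    have := heq k 0
    rwa [hconst] at this
  exact ⟨c, fun u => (hconst u).trans hc⟩

theorem diff_symm (D D' : TransData n) (p p' : Fin n → ℝ) : diff D' D p' p = -diff D D' p p' := by
  ext
  simp [diff]

theorem linForm_neg (α β : Fin n → ℝ) (u : Cover n) : linForm (-α) (-β) u = -linForm α β u := by
  simp [linForm_apply]
  ring

/-- The exponential solves the `(0,1)`-equation, so a constant matrix `M` with the right multipliers
gives a holomorphic map. -/
theorem SameSlope.isHolHom_exp {D D' : TransData n} (h : SameSlope D D')
    {T : Matrix (Fin n) (Fin n) ℂ} {p q p' q' : Fin n → ℝ} (M : Matrix (Fin D'.rk) (Fin D.rk) ℂ)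
    (hM : ∀ k, Complex.exp (Complex.I / (2 * π) *
      linForm (diff D D' p p') (diff D D' q q') (period k)) • (M * D.word k) = D'.word k * M) :
    TorusBundle.IsHolHom T (D.bundle (muOf T p q)) (D'.bundle (muOf T p' q')) (fun u =>
      Complex.exp (Complex.I / (2 * π) * linForm (diff D D' p p') (diff D D' q q') u) • M) := by
  refine h.isHolHom_iff.2 ⟨fun a b => ?_, fun k u => ?_, fun u v w hvw a b => ?_⟩
  · simp only [Matrix.smul_apply, smul_eq_mul]
    exact (contDiff_exp_linForm _ _ _).mul contDiff_const
  · rw [Matrix.mul_smul, ← hM, smul_smul, Matrix.smul_mul, ← Complex.exp_add, map_add,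
      Complex.ofReal_add, mul_add]
  · simp only [Matrix.smul_apply, smul_eq_mul]
    rw [((hasFDerivAt_exp_linForm (Complex.I / (2 * π)) (diff D D' p p') (diff D D' q q')
      u).mul_const (M a b)).fderiv]
    simp only [_root_.smul_apply, smul_eq_mul,
      ContinuousLinearMap.comp_apply, Complex.ofRealCLM_apply, LinearMap.coe_toContinuousLinearMap']
    ring

/-- Classification of the bundles of a given slope. -/
theorem SameSlope.isomorphic_iff {D D' : TransData n} (h : SameSlope D D')
    {T : Matrix (Fin n) (Fin n) ℂ} (hT : HasComplexStructure T) {p q p' q' : Fin n → ℝ}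
    {g : Matrix (Fin D'.rk) (Fin D.rk) ℂ} {g' : Matrix (Fin D.rk) (Fin D'.rk) ℂ}
    (hg : g * g' = 1) (hg' : g' * g = 1) {t : Deck n → ℝ}
    (hw : ∀ k, D'.word k = Complex.exp (Complex.I * t k) • (g * D.word k * g')) :
    TorusBundle.Isomorphic T (D.bundle (muOf T p q)) (D'.bundle (muOf T p' q')) ↔
      ∃ w, ∀ k,
        Complex.exp (Complex.I / (2 * π) * linForm (diff D D' p p') (diff D D' q q') (period k))
          = Complex.exp (Complex.I * (t k + D.pairing k w : ℝ)) := by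
  constructor
  · rintro ⟨ψ, χ, hψ, -, hinv⟩
    change Cover n → Matrix (Fin D'.rk) (Fin D.rk) ℂ at ψ
    change Cover n → Matrix (Fin D.rk) (Fin D'.rk) ℂ at χ
    have hinv' : χ 0 * ψ 0 = 1 := (hinv 0).2
    have hne : g' * ψ 0 ≠ 0 := by
      intro h0
      have h1 : ψ 0 = 0 := by rw [← Matrix.one_mul (ψ 0), ← hg, Matrix.mul_assoc, h0, Matrix.mul_zero]
      rw [h1, Matrix.mul_zero] at hinv'
      have : Nonempty (Fin D.rk) := ⟨⟨0, D.rk_pos⟩⟩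
      exact zero_ne_one hinv'
    obtain ⟨w, hw0⟩ := D.exists_trace_word_ne_zero hne
    exact ⟨w, (h.trace_section hT hg' hw hψ w).2 hw0⟩
  · rintro ⟨w, hwk⟩
    -- The word `w` is inserted after the frame: commuting it past the word `k` produces exactly the
    -- phase `pairing k w` needed to match the multipliers.
    have e1 : ∀ k, Complex.exp (Complex.I / (2 * π) *
        linForm (diff D D' p p') (diff D D' q q') (period k)) • (g * D.word w * D.word k)
        = D'.word k * (g * D.word w) := by
      intro k
      rw [hwk, hw, Matrix.smul_mul, Matrix.mul_assoc _ g', ← Matrix.mul_assoc g', hg',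
        Matrix.one_mul, Matrix.mul_assoc, Matrix.mul_assoc, D.word_mul_word k w, Matrix.mul_smul,
        smul_smul, ← Complex.exp_add]
      congr 2
      push_cast
      ring
    have e2 : (g * D.word w) * ((D.word w)ᴴ * g') = 1 := by
      rw [Matrix.mul_assoc, ← Matrix.mul_assoc (D.word w), word_mul_star, Matrix.one_mul, hg]
    have e3 : ((D.word w)ᴴ * g') * (g * D.word w) = 1 := by
      rw [Matrix.mul_assoc, ← Matrix.mul_assoc g', hg', Matrix.one_mul, star_mul_word]
    have e4 : ∀ k, Complex.exp (Complex.I / (2 * π) *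
        linForm (diff D' D p' p) (diff D' D q' q) (period k)) • ((D.word w)ᴴ * g' * D'.word k)
        = D.word k * ((D.word w)ᴴ * g') := by
      intro k
      have h1 := congrArg (fun M => ((D.word w)ᴴ * g') * M * ((D.word w)ᴴ * g')) (e1 k)
      simp only [Matrix.mul_smul, Matrix.smul_mul] at h1
      rw [← Matrix.mul_assoc _ (g * D.word w), e3, Matrix.one_mul, ← Matrix.mul_assoc _ (D'.word k),
        Matrix.mul_assoc _ (g * D.word w), e2, Matrix.mul_one] at h1
      rw [← h1, smul_smul, ← Complex.exp_add, diff_symm D D' p, diff_symm D D' q,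
        linForm_neg]
      simp
    refine ⟨_, _, h.isHolHom_exp _ e1, h.symm.isHolHom_exp _ e4, fun u => ?_⟩
    have h5 : ∀ a b : ℝ, a + b = 0 → Complex.exp (Complex.I / (2 * π) * a)
        * Complex.exp (Complex.I / (2 * π) * b) = 1 := by
      intro a b hab
      rw [← Complex.exp_add, ← mul_add, ← Complex.ofReal_add, hab]
      simp
    constructor
    · change (Complex.exp _ • (g * D.word w)) * (Complex.exp _ • ((D.word w)ᴴ * g')) = 1
      rw [Matrix.smul_mul, Matrix.mul_smul, e2, smul_smul, h5, one_smul]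
      rw [diff_symm D D' p, diff_symm D D' q, linForm_neg, add_neg_cancel]
    · change (Complex.exp _ • ((D.word w)ᴴ * g')) * (Complex.exp _ • (g * D.word w)) = 1
      rw [Matrix.smul_mul, Matrix.mul_smul, e3, smul_smul, h5, one_smul]
      rw [diff_symm D D' p, diff_symm D D' q, linForm_neg, neg_add_cancel]

/-! ### The slope is an invariant -/

/-- Taking determinants gives a nonvanishing scalar function whose multiplier along `X_j` is, up to
a constant, the exponential of `𝐢 r'` times the difference of the two exponents, and whose
multipliers along `Y_i` are constant. By `multiplier_invariant` this difference does not change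
along `Y_i`, which equates the `(i, j)` entries of the slopes. -/
theorem sameSlope_of_isomorphic {D D' : TransData n} {T : Matrix (Fin n) (Fin n) ℂ}
    {μ μ' : Fin n → ℂ} (h : TorusBundle.Isomorphic T (D.bundle μ) (D'.bundle μ')) :
    SameSlope D D' := by
  obtain ⟨ψ, χ, hψ, -, hinv⟩ := h
  have hsm := hψ.smooth
  have heq := hψ.equivariant
  change Cover n → Matrix (Fin D'.rk) (Fin D.rk) ℂ at ψ
  change Cover n → Matrix (Fin D.rk) (Fin D'.rk) ℂ at χ
  change ∀ k u, ψ (u + period k) * D.trans k u = D'.trans k u * ψ u at heq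
  have h1 : ∀ u, ψ u * χ u = 1 := fun u => (hinv u).1
  have h2 : ∀ u, χ u * ψ u = 1 := fun u => (hinv u).2
  -- The ranks are not known to agree, so `ψ u` need not be square by type; the constant factor `χ
  -- 0` makes it so.
  set f : Cover n → ℂ := fun u => (χ 0 * ψ u).det with hf
  have hcont : Continuous f := by
    have : Continuous ψ := continuous_pi fun a => continuous_pi fun b => (hsm a b).continuous
    exact (continuous_const.matrix_mul this).matrix_det
  have hf0 : ∀ u, f u ≠ 0 := by
    intro u hu
    have h3 : (χ 0 * ψ u) * (χ u * ψ 0) = 1 := by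
      rw [Matrix.mul_assoc, ← Matrix.mul_assoc (ψ u), h1, Matrix.one_mul, h2]
    have h4 := congrArg Matrix.det h3
    rw [Matrix.det_mul, Matrix.det_one] at h4
    rw [hf] at hu
    simp only at hu
    rw [hu, zero_mul] at h4
    exact zero_ne_one h4
  have hword : ∀ k, (D.word k).det ≠ 0 := by
    intro k h0
    have h4 := congrArg Matrix.det (D.word_mul_star k)
    rw [Matrix.det_mul, Matrix.det_one, h0, zero_mul] at h4
    exact zero_ne_one h4
  have hfeq : ∀ k u, f (u + period k) = (χ 0 * D'.word k * ψ 0).det / (D.word k).det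
      * Complex.exp (Complex.I * (D.rk * (D'.expo k u - D.expo k u) : ℝ)) * f u := by
    intro k u
    have h3 : (χ 0 * ψ (u + period k)) * D.trans k u
        = (χ 0 * D'.trans k u * ψ 0) * (χ 0 * ψ u) := by
      calc _ = χ 0 * (D'.trans k u * (ψ 0 * χ 0) * ψ u) := by
            rw [h1, Matrix.mul_one, Matrix.mul_assoc, heq]
        _ = _ := by simp only [Matrix.mul_assoc]
    have h4 := congrArg Matrix.det h3
    rw [Matrix.det_mul, Matrix.det_mul (χ 0 * D'.trans k u * ψ 0)] at h4
    simp only [trans, Matrix.mul_smul, Matrix.smul_mul, Matrix.det_smul, Fintype.card_fin,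
      ← Complex.exp_nat_mul] at h4
    have hw := hword k
    have he : Complex.exp (Complex.I * (D.rk * (D'.expo k u - D.expo k u) : ℝ))
        = Complex.exp (D.rk * (Complex.I * D'.expo k u))
          / Complex.exp (D.rk * (Complex.I * D.expo k u)) := by
      rw [← Complex.exp_sub]
      congr 1
      push_cast
      ring
    rw [he]
    have hne := Complex.exp_ne_zero (D.rk * (Complex.I * D.expo k u))
    change f (u + period k) * _ = _ * f u at h4
    refine (eq_div_of_mul_eq (mul_ne_zero hne hw) h4).trans ?_
    rw [mul_comm (Complex.exp (D.rk * (Complex.I * D'.expo k u)))]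
    field_simp
  refine sameSlope_of_div_eq fun i j => ?_
  have hexpo : ∀ (D : TransData n) (u : Cover n), D.expo (Pi.single j 1, 0) u
      = (1 / (D.r : ℝ)) * ∑ i, (D.A i j : ℝ) * u.2 i := by
    intro D u
    have e1 : (fun i => ((Pi.single j 1 : Fin n → ℤ) i : ℝ)) = Pi.single j 1 := by
      ext i; by_cases hij : i = j
      · subst hij; simp
      · simp [hij]
    have e2 : (period ((Pi.single j 1, 0) : Deck n)).2 = 0 := by ext; simp [period]
    unfold expo
    rw [e1, e2, Matrix.mulVec_single_one, add_zero]
    rfl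
  have hinvar := multiplier_invariant hcont hf0 (a := period (Pi.single j 1, 0))
    (b := period (0, Pi.single i 1))
    (c₁ := (χ 0 * D'.word (Pi.single j 1, 0) * ψ 0).det / (D.word (Pi.single j 1, 0)).det)
    (c₂ := (χ 0 * D'.word (0, Pi.single i 1) * ψ 0).det / (D.word (0, Pi.single i 1)).det)
    (lam := fun u => D.rk * (D'.expo (Pi.single j 1, 0) u - D.expo (Pi.single j 1, 0) u))
    (continuous_const.mul ((D'.expo_smooth _).continuous.sub (D.expo_smooth _).continuous))
    (hfeq _) (fun u => by
      have e0 : ∀ D : TransData n, D.expo (0, Pi.single i 1) u = 0 := fun D => by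
        have h0 : (fun i : Fin n => ((0 : Fin n → ℤ) i : ℝ)) = 0 := by ext; simp
        unfold expo
        rw [h0]
        simp
      rw [hfeq, e0, e0]
      simp) 0
  simp only [hexpo] at hinvar
  have hrk : (D.rk : ℝ) ≠ 0 := by exact_mod_cast D.rk_pos.ne'
  have h5 := mul_left_cancel₀ hrk hinvar
  have hper : ∀ (D : TransData n), ∑ x, (D.A x j : ℝ) * (period ((0, Pi.single i 1) : Deck n)).2 x
      = D.A i j * (2 * π) := by
    intro D
    rw [Finset.sum_eq_single i]
    · simp [period]
    · intro b _ hb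
      simp [period, hb]
    · simp
  simp only [zero_add, hper, Prod.snd_zero, Pi.zero_apply, mul_zero, Finset.sum_const_zero,
    sub_zero] at h5
  have hpi : (2 * π : ℝ) ≠ 0 := by positivity
  have h6 : ((D'.A i j : ℝ) / D'.r - D.A i j / D.r) * (2 * π) = 0 := by
    rw [← h5]
    ring
  exact sub_eq_zero.1 ((mul_eq_zero.1 h6).resolve_right hpi)

/-! ### Comparison of multipliers -/

/-- `v ∈ 2π ((1/r) A ℤⁿ + ℤⁿ)` -/
def _root_.TorusMirror.InLattice (r : ℕ) (A : Matrix (Fin n) (Fin n) ℤ) (v : Fin n → ℝ) : Prop :=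
  ∃ m m₁ : Fin n → ℤ, ∀ i, v i = 2 * π * ((((A *ᵥ m) i : ℤ) : ℝ) / r + m₁ i)

theorem exp_I_eq_iff (a b : ℝ) : Complex.exp (Complex.I * a) = Complex.exp (Complex.I * b) ↔
    ∃ z : ℤ, a = b + 2 * π * z := by
  rw [Complex.exp_eq_exp_iff_exists_int]
  refine exists_congr fun z => ?_
  constructor
  · intro h
    have h1 : Complex.I * ((a : ℂ) - (b + 2 * π * z)) = 0 := by linear_combination h
    have h2 := sub_eq_zero.1 ((mul_eq_zero.1 h1).resolve_left Complex.I_ne_zero)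
    exact_mod_cast h2
  · intro h
    rw [h]
    push_cast
    ring

/-- Both sides are characters of the deck group, so they are compared on generators: the directions
`Y_i` give the condition on `α - y`, the directions `X_i` the one on `β + x`. The word `w = (m, l)`
contributes `2π A m / r` and `2π Aᵗ l / r`; the integers come from the ambiguity of the logarithm.
-/
theorem exists_word_iff (D : TransData n) (α β x y : Fin n → ℝ) :
    (∃ w, ∀ k : Deck n, Complex.exp (Complex.I / (2 * π) * linForm α β (period k))
      = Complex.exp (Complex.I * (∑ j, x j * k.1 j + ∑ j, y j * k.2 j + D.pairing k w : ℝ))) ↔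
    InLattice D.r D.A (α - y) ∧ InLattice D.r D.Aᵀ (β + x) := by
  have h0 : ∀ k : Deck n, Complex.I / (2 * π) * linForm α β (period k)
      = Complex.I * ((∑ i, α i * k.2 i - ∑ i, β i * k.1 i : ℝ) : ℂ) := by
    intro k
    have hpi : (π : ℂ) ≠ 0 := by exact_mod_cast Real.pi_ne_zero
    have h1 : linForm α β (period k) = 2 * π * (∑ i, α i * k.2 i - ∑ i, β i * k.1 i) := by
      rw [linForm_apply, mul_sub, Finset.mul_sum, Finset.mul_sum]
      simp only [dotProduct, period]
      congr 1 <;> exact Finset.sum_congr rfl fun i _ => by ring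
    rw [h1]
    push_cast
    field_simp
  simp only [h0, exp_I_eq_iff]
  have hsingle : ∀ (a : Fin n → ℝ) (i : Fin n),
      ∑ j, a j * ((Pi.single i 1 : Fin n → ℤ) j : ℝ) = a i := by
    intro a i
    rw [Finset.sum_eq_single i]
    · simp
    · intro b _ hb
      simp [hb]
    · simp
  constructor
  · rintro ⟨w, hw⟩
    refine ⟨?_, ?_⟩
    · choose z hz using fun i => hw (0, Pi.single i 1)
      refine ⟨w.1, z, fun i => ?_⟩
      have h1 := hz i
      simp only [hsingle, pairing, Pi.zero_apply, Int.cast_zero, mul_zero, Finset.sum_const_zero,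
        sub_zero, zero_add, dotProduct_single, mul_one, Matrix.mulVec_zero, zero_dotProduct] at h1
      rw [Pi.sub_apply, h1]
      ring
    · choose z hz using fun i => hw (Pi.single i 1, 0)
      refine ⟨w.2, fun i => -z i, fun i => ?_⟩
      have h1 := hz i
      have e : (D.A *ᵥ Pi.single i 1) ⬝ᵥ w.2 = (D.Aᵀ *ᵥ w.2) i := by
        rw [Matrix.mulVec_single_one]; rfl
      simp only [hsingle, pairing, e, Pi.zero_apply, Int.cast_zero, mul_zero,
        Finset.sum_const_zero, zero_sub, add_zero, dotProduct_zero] at h1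
      rw [Pi.add_apply]
      push_cast
      linear_combination -h1
  · rintro ⟨⟨m, m₁, hm⟩, l, l₁, hl⟩
    refine ⟨(m, l), fun k => ⟨∑ i, m₁ i * k.2 i - ∑ i, l₁ i * k.1 i, ?_⟩⟩
    have e : (D.A *ᵥ k.1) ⬝ᵥ l = ∑ i, (D.Aᵀ *ᵥ l) i * k.1 i := by
      rw [dotProduct_comm, Matrix.dotProduct_mulVec, Matrix.mulVec_transpose]
      rfl
    have h1 : ∀ i, α i = y i + 2 * π * ((((D.A *ᵥ m) i : ℤ) : ℝ) / D.r + m₁ i) := fun i => by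
      rw [← hm, Pi.sub_apply]; ring
    have h2 : ∀ i, β i = -x i + 2 * π * ((((D.Aᵀ *ᵥ l) i : ℤ) : ℝ) / D.r + l₁ i) := fun i => by
      rw [← hl, Pi.add_apply]; ring
    have hp : D.pairing k (m, l) = ∑ i, 2 * π / D.r * ((((D.A *ᵥ m) i : ℤ) : ℝ) * k.2 i)
        - ∑ i, 2 * π / D.r * ((((D.Aᵀ *ᵥ l) i : ℤ) : ℝ) * k.1 i) := by
      rw [pairing, e, ← Finset.mul_sum, ← Finset.mul_sum, ← mul_sub]
      simp only [dotProduct, Int.cast_sum, Int.cast_mul]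
    simp only [hp, h1, h2]
    push_cast
    simp only [mul_sub, Finset.mul_sum]
    have s1 : ∑ i, (y i + 2 * π * ((((D.A *ᵥ m) i : ℤ) : ℝ) / D.r + m₁ i)) * (k.2 i : ℝ)
        = ∑ i, y i * k.2 i + ∑ i, 2 * π / D.r * ((((D.A *ᵥ m) i : ℤ) : ℝ) * k.2 i)
          + ∑ i, 2 * π * ((m₁ i : ℝ) * k.2 i) := by
      rw [← Finset.sum_add_distrib, ← Finset.sum_add_distrib]
      exact Finset.sum_congr rfl fun i _ => by ring
    have s2 : ∑ i, (-x i + 2 * π * ((((D.Aᵀ *ᵥ l) i : ℤ) : ℝ) / D.r + l₁ i)) * (k.1 i : ℝ)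
        = -∑ i, x i * k.1 i + ∑ i, 2 * π / D.r * ((((D.Aᵀ *ᵥ l) i : ℤ) : ℝ) * k.1 i)
          + ∑ i, 2 * π * ((l₁ i : ℝ) * k.1 i) := by
      rw [← Finset.sum_neg_distrib, ← Finset.sum_add_distrib, ← Finset.sum_add_distrib]
      exact Finset.sum_congr rfl fun i _ => by ring
    rw [s1, s2]
    ring

end TransData

section

variable {n : ℕ}

/-! ### Holomorphic bundles and Lagrangian submanifolds -/

theorem isSymm_transpose_mul_iff {R : Type*} [CommRing R] (A W : Matrix (Fin n) (Fin n) R) :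
    (Aᵀ * W).IsSymm ↔ ∀ v w, (A *ᵥ v) ⬝ᵥ (W *ᵥ w) = (A *ᵥ w) ⬝ᵥ (W *ᵥ v) := by
  have h1 : ∀ v w, (A *ᵥ v) ⬝ᵥ (W *ᵥ w) = v ⬝ᵥ ((Aᵀ * W) *ᵥ w) := fun v w => by
    rw [← Matrix.mulVec_mulVec, Matrix.dotProduct_mulVec v, Matrix.vecMul_transpose]
  simp only [h1]
  constructor
  · intro h v w
    rw [Matrix.dotProduct_mulVec, ← Matrix.mulVec_transpose, h.eq, dotProduct_comm]
  · intro h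
    refine Matrix.ext fun i j => ?_
    simpa using h (Pi.single j 1) (Pi.single i 1)

theorem ofReal_mulVec_dotProduct (A : Matrix (Fin n) (Fin n) ℤ) (a b : Fin n → ℝ) :
    (((toR A *ᵥ a) ⬝ᵥ b : ℝ) : ℂ) = (toC A *ᵥ fun i => (a i : ℂ)) ⬝ᵥ fun i => (b i : ℂ) := by
  simp [Matrix.mulVec, dotProduct]

/-- The term with `μ` is constant and drops out, so the curvature depends on the slope alone. -/
theorem TransData.curvature_bundle (D : TransData n) (μ : Fin n → ℂ) (u v w : Cover n) :
    (D.bundle μ).curvature u v w = -(Complex.I / (2 * π)) * (1 / (D.r : ℂ))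
      * (((toR D.A *ᵥ v.1) ⬝ᵥ w.2 - (toR D.A *ᵥ w.1) ⬝ᵥ v.2 : ℝ) : ℂ) := by
  have key : ∀ v w : Cover n, fderiv ℝ (fun x => (D.bundle μ).form x w) u v
      = -(Complex.I / (2 * π)) * (1 / (D.r : ℂ)) * (((toR D.A *ᵥ v.1) ⬝ᵥ w.2 : ℝ) : ℂ) := by
    intro v w
    set ℓ : Cover n →ₗ[ℝ] ℝ :=
      dotProductBilin ℝ ℝ w.2 ∘ₗ (toR D.A).mulVecLin ∘ₗ LinearMap.fst ℝ _ _ with hl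
    have hl' : ∀ x, ℓ x = (toR D.A *ᵥ x.1) ⬝ᵥ w.2 := fun x =>
      dotProduct_comm w.2 (toR D.A *ᵥ x.1)
    have h1 : (fun x => (D.bundle μ).form x w) = fun x =>
        -(Complex.I / (2 * π)) * (1 / (D.r : ℂ)) * ((ℓ x : ℝ) : ℂ)
          + -(Complex.I / (2 * π)) * ∑ i, (1 / (D.r : ℂ)) * μ i * (w.2 i : ℂ) := by
      funext x
      rw [D.form_apply, hl', dotProduct, Complex.ofReal_sum, mul_assoc, ← mul_add]
      congr 1
      rw [Finset.mul_sum, ← Finset.sum_add_distrib]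
      refine Finset.sum_congr rfl fun i _ => ?_
      rw [Complex.ofReal_mul]
      ring
    have h2 : HasFDerivAt (fun x => (D.bundle μ).form x w)
        ((-(Complex.I / (2 * π)) * (1 / (D.r : ℂ))) •
          Complex.ofRealCLM.comp (LinearMap.toContinuousLinearMap ℓ)) u := by
      rw [h1]
      exact ((Complex.ofRealCLM.comp
        (LinearMap.toContinuousLinearMap ℓ)).hasFDerivAt.const_mul _).add_const _
    rw [h2.fderiv]
    simp [← hl']
  rw [TorusBundle.curvature, key, key, Complex.ofReal_sub]
  ring

/-- A vector of type `(0,1)` is determined by its `y`-component `η ∈ ℂⁿ`, its `x`-component being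
`-T η`. In the coordinates `(X, Y)` it becomes `(-η, (δ - T) η)`, so the `(0,2)`-part of the
curvature is a nonzero multiple of the antisymmetrization of `(A η₁)ᵗ (T - δ) η₂`. -/
theorem TransData.isHolomorphic_pullback_iff (D : TransData n) (μ : Fin n → ℂ)
    (T : Matrix (Fin n) (Fin n) ℂ) (δ : Matrix (Fin n) (Fin n) ℤ) :
    TorusBundle.IsHolomorphic T ((D.bundle μ).pullback δ) ↔
      ((toC D.A)ᵀ * (T - toC δ)).IsSymm := by
  rw [isSymm_transpose_mul_iff]
  let z : (Fin n → ℝ) → (Fin n → ℝ) → Fin n → ℂ := fun a b =>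
    (fun i => (a i : ℂ)) + Complex.I • fun i => (b i : ℂ)
  have hY : ∀ v w : Cover n, IsType01 T v w →
      z (phi δ v).2 (phi δ w).2 = (toC δ - T) *ᵥ z v.2 w.2 := by
    intro v w h
    have e : ∀ v : Cover n, (fun i => ((phi δ v).2 i : ℂ))
        = (fun i => (v.1 i : ℂ)) + toC δ *ᵥ fun i => (v.2 i : ℂ) := fun v => by
      ext i
      simp [phi_apply, Matrix.mulVec, dotProduct]
    rw [IsType01, zcoord, zcoord] at h
    simp only [z, e, Matrix.sub_mulVec, Matrix.mulVec_add, Matrix.mulVec_smul]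
    rw [← sub_eq_zero, ← h]
    simp only [smul_add, smul_sub]
    abel
  have hX : ∀ v w : Cover n, z (phi δ v).1 (phi δ w).1 = -z v.2 w.2 := by
    intro v w
    ext i
    simp [z, phi_apply]
    ring
  have hbil : ∀ a b c d : Fin n → ℝ, (toC D.A *ᵥ z a b) ⬝ᵥ z c d
      = (((toR D.A *ᵥ a) ⬝ᵥ c : ℝ) : ℂ) - (((toR D.A *ᵥ b) ⬝ᵥ d : ℝ) : ℂ)
        + Complex.I * ((((toR D.A *ᵥ a) ⬝ᵥ d : ℝ) : ℂ) + (((toR D.A *ᵥ b) ⬝ᵥ c : ℝ) : ℂ)) := by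
    intro a b c d
    simp only [ofReal_mulVec_dotProduct, z, Matrix.mulVec_add, Matrix.mulVec_smul, dotProduct_add,
      add_dotProduct, dotProduct_smul, smul_dotProduct, smul_eq_mul]
    linear_combination ((toC D.A *ᵥ fun i => (b i : ℂ)) ⬝ᵥ fun i => (d i : ℂ)) * Complex.I_mul_I
  have hcurv : ∀ u v₁ w₁ v₂ w₂ : Cover n, IsType01 T v₁ w₁ → IsType01 T v₂ w₂ →
      ((D.bundle μ).pullback δ).curvature u v₁ v₂ - ((D.bundle μ).pullback δ).curvature u w₁ w₂
      + Complex.I * (((D.bundle μ).pullback δ).curvature u v₁ w₂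
        + ((D.bundle μ).pullback δ).curvature u w₁ v₂)
      = -(Complex.I / (2 * π)) * (1 / (D.r : ℂ)) *
        ((toC D.A *ᵥ z v₁.2 w₁.2) ⬝ᵥ ((T - toC δ) *ᵥ z v₂.2 w₂.2)
          - (toC D.A *ᵥ z v₂.2 w₂.2) ⬝ᵥ ((T - toC δ) *ᵥ z v₁.2 w₁.2)) := by
    intro u v₁ w₁ v₂ w₂ h₁ h₂
    have hneg : ∀ x : Fin n → ℂ, (T - toC δ) *ᵥ x = -((toC δ - T) *ᵥ x) := fun x => by
      rw [← Matrix.neg_mulVec, neg_sub]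
    have e1 := hbil (phi δ v₁).1 (phi δ w₁).1 (phi δ v₂).2 (phi δ w₂).2
    have e2 := hbil (phi δ v₂).1 (phi δ w₂).1 (phi δ v₁).2 (phi δ w₁).2
    rw [hX, hY _ _ h₂, Matrix.mulVec_neg, neg_dotProduct] at e1
    rw [hX, hY _ _ h₁, Matrix.mulVec_neg, neg_dotProduct] at e2
    simp only [TorusBundle.curvature_pullback, D.curvature_bundle, hneg, dotProduct_neg,
      Complex.ofReal_sub]
    linear_combination (-(-(Complex.I / (2 * π)) * (1 / (D.r : ℂ)))) * e1
      + (-(Complex.I / (2 * π)) * (1 / (D.r : ℂ))) * e2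
  constructor
  · intro h η₁ η₂
    -- Every `η` occurs, so vanishing on `(0,1)`-vectors gives symmetry on all of `ℂⁿ`.
    have hlift : ∀ η : Fin n → ℂ, ∃ v w : Cover n, IsType01 T v w ∧ z v.2 w.2 = η := by
      intro η
      have hz : ∀ x : Fin n → ℂ, z (fun i => (x i).re) (fun i => (x i).im) = x := fun x => by
        ext i
        simp only [z, Pi.add_apply, Pi.smul_apply, smul_eq_mul]
        rw [mul_comm]
        exact Complex.re_add_im _
      refine ⟨(fun i => ((-(T *ᵥ η)) i).re, fun i => (η i).re),
        (fun i => ((-(T *ᵥ η)) i).im, fun i => (η i).im), ?_, hz η⟩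
      rw [IsType01, zcoord, zcoord, smul_add, ← Matrix.mulVec_smul, add_add_add_comm,
        ← Matrix.mulVec_add]
      change z (fun i => ((-(T *ᵥ η)) i).re) (fun i => ((-(T *ᵥ η)) i).im)
        + T *ᵥ z (fun i => (η i).re) (fun i => (η i).im) = 0
      rw [hz, hz, neg_add_cancel]
    obtain ⟨v₁, w₁, h₁, rfl⟩ := hlift η₁
    obtain ⟨v₂, w₂, h₂, rfl⟩ := hlift η₂
    have h3 := h 0 v₁ w₁ v₂ w₂ h₁ h₂
    rw [hcurv 0 v₁ w₁ v₂ w₂ h₁ h₂] at h3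
    change _ • (1 : Matrix (Fin D.rk) (Fin D.rk) ℂ) = 0 at h3
    have : Nonempty (Fin D.rk) := ⟨⟨0, D.rk_pos⟩⟩
    have h4 := (smul_eq_zero.1 h3).resolve_right one_ne_zero
    have hr : (D.r : ℂ) ≠ 0 := by exact_mod_cast D.r_pos.ne'
    have hpi : (π : ℂ) ≠ 0 := by exact_mod_cast Real.pi_ne_zero
    have h5 : -(Complex.I / (2 * π)) * (1 / (D.r : ℂ)) ≠ 0 :=
      mul_ne_zero (neg_ne_zero.2 (div_ne_zero Complex.I_ne_zero (mul_ne_zero two_ne_zero hpi)))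
        (one_div_ne_zero hr)
    exact sub_eq_zero.1 ((mul_eq_zero.1 h4).resolve_left h5)
  · intro h u v₁ w₁ v₂ w₂ h₁ h₂
    rw [hcurv u v₁ w₁ v₂ w₂ h₁ h₂, h, sub_self, mul_zero, zero_smul]

namespace AffData

theorem twoForm_tangent (a : AffData n) (W : Matrix (Fin n) (Fin n) ℝ) (y v w : Fin n → ℝ) :
    twoForm W (a.tangent y v) (a.tangent y w)
      = -(1 / (a.r : ℝ)) * ((toR a.A *ᵥ v) ⬝ᵥ (W *ᵥ w) - (toR a.A *ᵥ w) ⬝ᵥ (W *ᵥ v)) := by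
  simp only [twoForm, tangent_eq, smul_dotProduct, smul_eq_mul]
  ring

theorem curvature_eq_zero (a : AffData n) (y v w : Fin n → ℝ) : a.curvature y v w = 0 := by
  simp [curvature, connForm, tangent_eq]

theorem r_ne (a : AffData n) : (a.r : ℝ) ≠ 0 := by exact_mod_cast a.r_pos.ne'

/-- The connection form has constant coefficients, so the curvature is zero and the B-field must
restrict to zero as well. The two real conditions are the imaginary and real parts of one complex
symmetry, the same as for holomorphic bundles. -/
theorem isFukObj_iff (a : AffData n) (τ : Matrix (Fin n) (Fin n) ℂ) :
    a.IsFukObj τ ↔ ((toC a.A)ᵀ * τ).IsSymm := by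
  have h0 : ((toC a.A)ᵀ * τ).IsSymm ↔ ((toR a.A)ᵀ * τ.map Complex.im).IsSymm ∧
      ((toR a.A)ᵀ * τ.map Complex.re).IsSymm := by
    have hre : ∀ i j, (((toC a.A)ᵀ * τ) i j).re = ((toR a.A)ᵀ * τ.map Complex.re) i j :=
      fun i j => by simp [Matrix.mul_apply]
    have him : ∀ i j, (((toC a.A)ᵀ * τ) i j).im = ((toR a.A)ᵀ * τ.map Complex.im) i j :=
      fun i j => by simp [Matrix.mul_apply]
    constructor
    · intro h
      exact ⟨Matrix.ext fun i j => by rw [Matrix.transpose_apply, ← him, ← him, h.apply],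
        Matrix.ext fun i j => by rw [Matrix.transpose_apply, ← hre, ← hre, h.apply]⟩
    · rintro ⟨h, h'⟩
      refine Matrix.ext fun i j => ?_
      rw [Matrix.transpose_apply]
      refine Complex.ext ?_ ?_
      · rw [hre, hre, h'.apply]
      · rw [him, him, h.apply]
  rw [h0, isSymm_transpose_mul_iff, isSymm_transpose_mul_iff]
  have hr := a.r_ne
  constructor
  · rintro ⟨h1, h2⟩
    refine ⟨fun v w => ?_, fun v w => ?_⟩
    · have h3 := h1 0 v w
      rw [twoForm_tangent] at h3
      exact sub_eq_zero.1 ((mul_eq_zero.1 h3).resolve_left (neg_ne_zero.2 (one_div_ne_zero hr)))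
    · have h3 := h2 0 v w
      rw [curvature_eq_zero, twoForm_tangent] at h3
      have h4 := (mul_eq_zero.1 h3.symm).resolve_left Complex.two_pi_I_ne_zero
      exact sub_eq_zero.1 ((mul_eq_zero.1 (Complex.ofReal_eq_zero.1 h4)).resolve_left
        (neg_ne_zero.2 (one_div_ne_zero hr)))
  · rintro ⟨h1, h2⟩
    refine ⟨fun y v w => ?_, fun y v w => ?_⟩
    · rw [twoForm_tangent, h1 v w, sub_self, mul_zero]
    · rw [twoForm_tangent, h2 v w, curvature_eq_zero]
      simp

/-! ### Isomorphism classes of affine objects -/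

theorem point_eq_point_iff (a b : AffData n) (y z : Fin n → ℝ) :
    a.point y = b.point z ↔ ∃ m₁ m₂ : Fin n → ℤ,
      (∀ i, (b.param z).1 i = (a.param y).1 i + m₁ i * (2 * π)) ∧
      ∀ i, z i = y i + m₂ i * (2 * π) := by
  constructor
  · intro h
    choose m₁ h₁ using fun i => coe_eq_coe (congrFun (congrArg Prod.fst h) i)
    choose m₂ h₂ using fun i => coe_eq_coe (congrFun (congrArg Prod.snd h) i)
    exact ⟨m₁, m₂, h₁, h₂⟩
  · rintro ⟨m₁, m₂, h₁, h₂⟩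
    refine Prod.ext (funext fun i => ?_) (funext fun i => ?_)
    · change (((a.param y).1 i : ℝ) : AddCircle (2 * π)) = (((b.param z).1 i : ℝ) : AddCircle (2 * π))
      rw [h₁, coe_add_period]
    · change ((y i : ℝ) : AddCircle (2 * π)) = ((z i : ℝ) : AddCircle (2 * π))
      rw [h₂, coe_add_period]

theorem param_fst (a : AffData n) (y : Fin n → ℝ) (i : Fin n) :
    (a.param y).1 i = -((toR a.A *ᵥ y) i / a.r) + a.p i / a.r := by
  simp only [param, Pi.add_apply, Pi.smul_apply, smul_eq_mul]
  ring

theorem toR_mulVec_intCast (A : Matrix (Fin n) (Fin n) ℤ) (m : Fin n → ℤ) (i : Fin n) :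
    (toR A *ᵥ fun j => (m j : ℝ)) i = ((A *ᵥ m) i : ℤ) := by
  simp [Matrix.mulVec, dotProduct]

/-- The value of `a.param` after a translation by a period. -/
theorem param_fst_add (a : AffData n) (y : Fin n → ℝ) (m : Fin n → ℤ) (i : Fin n) :
    (a.param (y + (2 * π) • fun j => (m j : ℝ))).1 i
      = (a.param y).1 i - 2 * π * (((a.A *ᵥ m) i : ℤ) : ℝ) / a.r := by
  rw [param_fst, param_fst, Matrix.mulVec_add, Matrix.mulVec_smul, Pi.add_apply, Pi.smul_apply,
    toR_mulVec_intCast, smul_eq_mul]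
  ring

theorem slope_div_eq_of_L_eq {a b : AffData n} (h : a.L = b.L) (i j : Fin n) :
    (b.A i j : ℝ) / b.r = (a.A i j : ℝ) / a.r := by
  have h1 := congrFun (slope_eq_of_L_eq h (Pi.single j 1)) i
  rw [Matrix.mulVec_single_one, Matrix.mulVec_single_one] at h1
  simp only [Pi.smul_apply, smul_eq_mul, Matrix.col_apply, Matrix.map_apply] at h1
  linear_combination h1

/-- Affine submanifolds of equal slope coincide as soon as they share a point. Moving the parameter
by `2πm` moves `x` by `-2π A m / r`, and `x` itself counts modulo `2π`; hence the lattice. -/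
theorem L_eq_iff (a b : AffData n) : a.L = b.L ↔
    (∀ i j, (b.A i j : ℝ) / b.r = (a.A i j : ℝ) / a.r) ∧
      InLattice a.r a.A (fun i => b.p i / b.r - a.p i / a.r) := by
  constructor
  · intro h
    refine ⟨slope_div_eq_of_L_eq h, ?_⟩
    obtain ⟨c, hc⟩ := exists_shift h
    obtain ⟨m₁, m₂, h₁, h₂⟩ := (point_eq_point_iff _ _ _ _).1 (hc 0)
    have hcm : (0 : Fin n → ℝ) + c = 0 + (2 * π) • fun j => (m₂ j : ℝ) := by
      funext i
      rw [h₂]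
      simp [mul_comm]
    refine ⟨-m₂, -m₁, fun i => ?_⟩
    have h3 := h₁ i
    rw [hcm, param_fst_add, param_fst, param_fst, Matrix.mulVec_zero, Matrix.mulVec_zero] at h3
    simp only [Pi.zero_apply, zero_div, neg_zero, zero_add] at h3
    rw [Matrix.mulVec_neg]
    simp only [Pi.neg_apply]
    push_cast
    linear_combination -h3
  · rintro ⟨hs, m, m₁, hm⟩
    have hmul : ∀ (y : Fin n → ℝ) i, (toR b.A *ᵥ y) i / b.r = (toR a.A *ᵥ y) i / a.r := by
      intro y i
      simp only [Matrix.mulVec, dotProduct, Finset.sum_div, Matrix.map_apply]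
      exact Finset.sum_congr rfl fun j _ => by linear_combination y j * hs i j
    have hp : ∀ y, b.point y = a.point (y + (2 * π) • fun j => ((-m) j : ℝ)) := by
      intro y
      refine (point_eq_point_iff _ _ _ _).2 ⟨-m₁, -m, fun i => ?_, fun i => ?_⟩
      · have h1 := hm i
        have h2 := param_fst_add a y (-m) i
        simp only [Pi.neg_apply, Int.cast_neg, Matrix.mulVec_neg] at h2 ⊢
        rw [h2, param_fst, param_fst, hmul]
        linear_combination -h1
      · simp [mul_comm]
    ext x
    constructor
    · rintro ⟨y, rfl⟩
      exact ⟨y - (2 * π) • fun j => ((-m) j : ℝ), by rw [hp, sub_add_cancel]⟩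
    · rintro ⟨y, rfl⟩
      exact ⟨_, (hp y).symm⟩

theorem connForm_sub (a b : AffData n) (y v : Fin n → ℝ) :
    b.connForm (a.tangent y v) - a.connForm (a.tangent y v)
      = Complex.I / (2 * π) * ((∑ i, (b.q i / b.r - a.q i / a.r) * v i : ℝ) : ℂ) := by
  have h : ∑ i, (b.q i / b.r - a.q i / a.r) * v i
      = 1 / (b.r : ℝ) * (b.q ⬝ᵥ v) - 1 / (a.r : ℝ) * (a.q ⬝ᵥ v) := by
    simp only [dotProduct, Finset.mul_sum, ← Finset.sum_sub_distrib]
    exact Finset.sum_congr rfl fun i _ => by ring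
  rw [h, connForm, connForm, tangent_eq]
  push_cast
  ring

theorem hasFDerivAt_exp_dotProduct (c : ℂ) (β : Fin n → ℝ) (y : Fin n → ℝ) :
    HasFDerivAt (fun y : Fin n → ℝ => Complex.exp (c * ((∑ i, β i * y i : ℝ) : ℂ)))
      (Complex.exp (c * ((∑ i, β i * y i : ℝ) : ℂ)) • (c • Complex.ofRealCLM.comp
        (LinearMap.toContinuousLinearMap (dotProductBilin ℝ ℝ β)))) y := by
  have h1 : HasFDerivAt (fun y : Fin n → ℝ => c * ((∑ i, β i * y i : ℝ) : ℂ))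
      (c • Complex.ofRealCLM.comp (LinearMap.toContinuousLinearMap (dotProductBilin ℝ ℝ β))) y :=
    (Complex.ofRealCLM.comp (LinearMap.toContinuousLinearMap
      (dotProductBilin ℝ ℝ β))).hasFDerivAt.const_mul c
  exact h1.cexp

theorem contDiff_exp_dotProduct (c : ℂ) (β : Fin n → ℝ) :
    ContDiff ℝ ∞ (fun y : Fin n → ℝ => Complex.exp (c * ((∑ i, β i * y i : ℝ) : ℂ))) :=
  (contDiff_const.mul (Complex.ofRealCLM.contDiff.comp
    (LinearMap.toContinuousLinearMap (dotProductBilin ℝ ℝ β)).contDiff)).cexp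

/-- The line bundles with connection are isomorphic if and only if the difference of the connections
has trivial holonomy. -/
theorem lineBundle_iso_iff (a b : AffData n) :
    (∃ f : Torus n → ℂ, ContDiff ℝ ∞ (fun y => f (a.point y)) ∧ (∀ y, f (a.point y) ≠ 0) ∧
      ∀ y v, fderiv ℝ (fun x => f (a.point x)) y v
        + (b.connForm (a.tangent y v) - a.connForm (a.tangent y v)) * f (a.point y) = 0) ↔
    InLattice a.r a.Aᵀ (fun i => b.q i / b.r - a.q i / a.r) := by
  set β : Fin n → ℝ := fun i => b.q i / b.r - a.q i / a.r with hβ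
  have hconn : ∀ y v, b.connForm (a.tangent y v) - a.connForm (a.tangent y v)
      = Complex.I / (2 * π) * ((∑ i, β i * v i : ℝ) : ℂ) := connForm_sub a b
  simp only [hconn]
  have hpi : (2 * π : ℝ) ≠ 0 := by positivity
  have hr := a.r_ne
  constructor
  · rintro ⟨f, hsm, hne, hd⟩
    -- The explicit exponential solves the inverse equation, so its product with `f` has derivative
    -- zero.
    set E : (Fin n → ℝ) → ℂ := fun y =>
      Complex.exp (Complex.I / (2 * π) * ((∑ i, β i * y i : ℝ) : ℂ)) * f (a.point y) with hE
    have hEd : ∀ y, HasFDerivAt E _ y := fun y =>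
      (hasFDerivAt_exp_dotProduct (Complex.I / (2 * π)) β y).mul
        (hsm.differentiable (by simp) y).hasFDerivAt
    have hconst : ∀ y y', E y = E y' := by
      refine is_const_of_fderiv_eq_zero (𝕜 := ℝ) (fun y => (hEd y).differentiableAt) fun y => ?_
      rw [(hEd y).fderiv]
      ext v
      have e : dotProductBilin ℝ ℝ β v = ∑ i, β i * v i := rfl
      simp only [_root_.add_apply, _root_.smul_apply, smul_eq_mul,
        ContinuousLinearMap.comp_apply, Complex.ofRealCLM_apply,
        LinearMap.coe_toContinuousLinearMap', e, _root_.zero_apply]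
      linear_combination Complex.exp (Complex.I / (2 * π) * ((∑ i, β i * y i : ℝ) : ℂ)) * hd y v
    -- The translations of parameters by `2πm` that fix the points of the submanifold are those with
    -- `A m ∈ r ℤⁿ`. As `f` is a function on the submanifold, the exponential must be trivial on
    -- them, so `β / 2π` lies in the dual lattice.
    obtain ⟨l₀, l₁, hl⟩ := mem_dual_lattice a.r_pos a.A (fun i => β i / (2 * π)) (by
      intro m hm
      choose k hk using hm
      have hpt : a.point 0 = a.point (0 + (2 * π) • fun j => (m j : ℝ)) := by
        refine (point_eq_point_iff _ _ _ _).2 ⟨-k, m, fun i => ?_, fun i => ?_⟩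
        · rw [param_fst_add, hk]
          simp only [Pi.neg_apply]
          push_cast
          field_simp
          ring
        · simp [mul_comm]
      have h1 := hconst 0 (0 + (2 * π) • fun j => (m j : ℝ))
      simp only [hE] at h1
      rw [← hpt] at h1
      have h2 := mul_right_cancel₀ (hne 0) h1
      have e1 : ∑ i, β i * (0 : Fin n → ℝ) i = 0 := by simp
      have e2 : ∑ i, β i * (0 + (2 * π) • fun j => (m j : ℝ) : Fin n → ℝ) i
          = 2 * π * ∑ i, β i * m i := by
        rw [Finset.mul_sum]
        exact Finset.sum_congr rfl fun i _ => by simp; ring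
      rw [e1, e2] at h2
      have hpi' : (π : ℂ) ≠ 0 := by exact_mod_cast Real.pi_ne_zero
      have e3 : Complex.I / (2 * π) * ((2 * π * ∑ i, β i * m i : ℝ) : ℂ)
          = Complex.I * ((∑ i, β i * m i : ℝ) : ℂ) := by
        rw [Complex.ofReal_mul (2 * π)]
        push_cast
        field_simp
      have e4 : Complex.I / (2 * π) * ((0 : ℝ) : ℂ) = Complex.I * ((0 : ℝ) : ℂ) := by simp
      rw [e3, e4] at h2
      obtain ⟨z, hz⟩ := (TransData.exp_I_eq_iff _ _).1 h2.symm
      refine ⟨z, ?_⟩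
      have e5 : ∑ i, β i / (2 * π) * (m i : ℝ) = (∑ i, β i * m i) / (2 * π) := by
        rw [Finset.sum_div]
        exact Finset.sum_congr rfl fun i _ => by ring
      rw [e5, hz]
      field_simp
      ring)
    refine ⟨l₀, l₁, fun i => ?_⟩
    rw [← hl i]
    field_simp
  · rintro ⟨l, l₁, hl⟩
    -- Conversely, parameters of the same point differ by `2π m₂` with `A m₂ = -r m₁`. Then `βᵗ m₂`
    -- is an integral multiple of `2π`, and the exponential descends to the submanifold.
    have hfac : Function.FactorsThrough
        (fun y : Fin n → ℝ => Complex.exp (-(Complex.I / (2 * π)) * ((∑ i, β i * y i : ℝ) : ℂ)))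
        a.point := by
      intro y z hyz
      obtain ⟨m₁, m₂, h₁, h₂⟩ := (point_eq_point_iff _ _ _ _).1 hyz
      have hz : z = y + (2 * π) • fun j => (m₂ j : ℝ) := by
        funext i
        rw [h₂]
        simp [mul_comm]
      have hA : ∀ i, (((a.A *ᵥ m₂) i : ℤ) : ℝ) / a.r = -m₁ i := by
        intro i
        have h3 := h₁ i
        rw [hz, param_fst_add] at h3
        have h4 : ((((a.A *ᵥ m₂) i : ℤ) : ℝ) / a.r + m₁ i) * (2 * π) = 0 := by
          linear_combination -h3
        linarith [(mul_eq_zero.1 h4).resolve_right hpi]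
      have hsum : ∑ i, β i * m₂ i
          = 2 * π * ((-(∑ i, l i * m₁ i) + ∑ i, l₁ i * m₂ i : ℤ) : ℝ) := by
        have e1 : ∑ i, (((a.Aᵀ *ᵥ l) i : ℤ) : ℝ) * m₂ i = ∑ i, (l i : ℝ) * ((a.A *ᵥ m₂) i : ℤ) := by
          have : (a.Aᵀ *ᵥ l) ⬝ᵥ m₂ = l ⬝ᵥ (a.A *ᵥ m₂) := by
            rw [Matrix.dotProduct_mulVec, Matrix.mulVec_transpose]
          simp only [dotProduct] at this
          exact_mod_cast congrArg (Int.cast : ℤ → ℝ) this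
        have e2 : ∑ i, (l i : ℝ) * ((a.A *ᵥ m₂) i : ℤ) = -(a.r * ∑ i, (l i : ℝ) * m₁ i) := by
          rw [Finset.mul_sum, ← Finset.sum_neg_distrib]
          refine Finset.sum_congr rfl fun i _ => ?_
          have := hA i
          rw [div_eq_iff hr] at this
          rw [this]
          ring
        have e3 : ∑ i, β i * m₂ i = 2 * π * ((∑ i, (((a.Aᵀ *ᵥ l) i : ℤ) : ℝ) * m₂ i) / a.r
            + ∑ i, (l₁ i : ℝ) * m₂ i) := by
          rw [Finset.sum_div, ← Finset.sum_add_distrib, Finset.mul_sum]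
          exact Finset.sum_congr rfl fun i _ => by rw [hl]; ring
        rw [e3, e1, e2]
        push_cast
        field_simp
      set N : ℤ := -(∑ i, l i * m₁ i) + ∑ i, l₁ i * m₂ i
      have hzs : ∑ i, β i * z i = ∑ i, β i * y i + 2 * π * (2 * π * N) := by
        rw [← hsum, Finset.mul_sum, ← Finset.sum_add_distrib]
        exact Finset.sum_congr rfl fun i _ => by rw [h₂]; ring
      have hconv : ∀ s : ℝ, -(Complex.I / (2 * π)) * (s : ℂ)
          = Complex.I * ((-(s / (2 * π)) : ℝ) : ℂ) := fun s => by
        push_cast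
        ring
      simp only
      rw [hconv, hconv, TransData.exp_I_eq_iff]
      refine ⟨N, ?_⟩
      rw [hzs]
      field_simp
      ring
    -- Values off the submanifold play no role and are set to zero.
    set f := Function.extend a.point
      (fun y : Fin n → ℝ => Complex.exp (-(Complex.I / (2 * π)) * ((∑ i, β i * y i : ℝ) : ℂ))) 0
    have hf : ∀ y, f (a.point y)
        = Complex.exp (-(Complex.I / (2 * π)) * ((∑ i, β i * y i : ℝ) : ℂ)) := fun y =>
      hfac.extend_apply _ y
    refine ⟨f, ?_, fun y => ?_, fun y v => ?_⟩
    · simp only [hf]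
      exact contDiff_exp_dotProduct _ _
    · rw [hf]
      exact Complex.exp_ne_zero _
    · simp only [hf]
      rw [(hasFDerivAt_exp_dotProduct (-(Complex.I / (2 * π))) β y).fderiv]
      have e : dotProductBilin ℝ ℝ β v = ∑ i, β i * v i := rfl
      simp only [_root_.smul_apply, smul_eq_mul,
        ContinuousLinearMap.comp_apply, Complex.ofRealCLM_apply,
        LinearMap.coe_toContinuousLinearMap', e]
      ring

theorem isomorphic_iff (a b : AffData n) : Isomorphic a b ↔
    (∀ i j, (b.A i j : ℝ) / b.r = (a.A i j : ℝ) / a.r) ∧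
      InLattice a.r a.A (fun i => b.p i / b.r - a.p i / a.r) ∧
      InLattice a.r a.Aᵀ (fun i => b.q i / b.r - a.q i / a.r) := by
  rw [Isomorphic, L_eq_iff, lineBundle_iso_iff, and_assoc]

end AffData

/-! ### The mirror correspondence -/

section Mirror

variable {T : Matrix (Fin n) (Fin n) ℂ} {δ : Matrix (Fin n) (Fin n) ℤ}

/-- Both conditions are the symmetry of `Aᵗ (T - δ)`, which involves neither `p`, `q` nor the
angles. -/
theorem isFukObj_mirrorData (a : Angles n) (E : DGObj T δ) :
    (mirrorData a E).IsFukObj (T - toC δ) :=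
  ((mirrorData a E).isFukObj_iff _).2 ((E.data.isHolomorphic_pullback_iff _ T δ).1 E.hol)

/-- Either isomorphism forces equal slopes. Consistency then supplies a frame with phases `x = (ξ' -
ξ) / r'` and `y = (θ' - θ) / r'`, and the bundle criterion for `α - y` and `β + x` is the affine
criterion for the shifted parameters. -/
theorem isomorphic_mirrorData_iff (hδ : (T - toC δ).det ≠ 0) (hT : HasComplexStructure T)
    {a : Angles n} (ha : a.IsConsistent) (E E' : DGObj T δ) :
    TorusBundle.Isomorphic T E.bundle E'.bundle ↔
      AffData.Isomorphic (mirrorData a E) (mirrorData a E') := by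
  have key : TransData.SameSlope E.data E'.data → (TorusBundle.Isomorphic (Tprime T δ)
      (E.data.bundle (muOf (Tprime T δ) E.p E.q)) (E'.data.bundle (muOf (Tprime T δ) E'.p E'.q)) ↔
      AffData.Isomorphic (mirrorData a E) (mirrorData a E')) := by
    intro hs
    obtain ⟨g, g', hg, hg', hV, hU⟩ := ha E.data E'.data hs
    have hrk : (E'.data.rk : ℝ) = E.data.rk := by
      rw [TransData.rk_eq_of_inverse hg hg']
    rw [hs.isomorphic_iff (hasComplexStructure_Tprime hδ hT) hg hg'
      (TransData.word_eq_of_frame hg hg' hV hU), TransData.exists_word_iff, AffData.isomorphic_iff,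
      and_iff_right (show ∀ i j, ((mirrorData a E').A i j : ℝ) / (mirrorData a E').r
        = ((mirrorData a E).A i j : ℝ) / (mirrorData a E).r from hs.div_eq)]
    have hr := E.data.r_ne
    have hr' := E'.data.r_ne
    have hk : (E.data.rk : ℝ) ≠ 0 := by exact_mod_cast E.data.rk_pos.ne'
    -- The factor `r / r'` in the definition of `p(θ)` is what turns into `1 / r'` after division by
    -- `r`; equality of the two ranks allows the differences to be combined.
    have e1 : (fun i => (mirrorData a E').p i / ((mirrorData a E').r : ℝ)
        - (mirrorData a E).p i / ((mirrorData a E).r : ℝ))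
        = TransData.diff E.data E'.data E.p E'.p
          - fun k => (a.θ E'.data k - a.θ E.data k) / E.data.rk := by
      funext i
      simp only [mirrorData, TransData.diff, Pi.sub_apply, Pi.smul_apply, smul_eq_mul, hrk]
      field_simp
      ring
    have e2 : (fun i => (mirrorData a E').q i / ((mirrorData a E').r : ℝ)
        - (mirrorData a E).q i / ((mirrorData a E).r : ℝ))
        = TransData.diff E.data E'.data E.q E'.q
          + fun k => (a.ξ E'.data k - a.ξ E.data k) / E.data.rk := by
      funext i
      simp only [mirrorData, TransData.diff, Pi.add_apply, Pi.smul_apply, smul_eq_mul, hrk]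
      field_simp
      ring
    rw [e1, e2]
    rfl
  have hpull : TorusBundle.Isomorphic T E.bundle E'.bundle ↔
      TorusBundle.Isomorphic (Tprime T δ) (E.data.bundle (muOf (Tprime T δ) E.p E.q))
        (E'.data.bundle (muOf (Tprime T δ) E'.p E'.q)) :=
    TorusBundle.isomorphic_pullback_iff hδ
  rw [hpull]
  constructor
  · intro h
    exact (key (TransData.sameSlope_of_isomorphic h)).1 h
  · intro h
    exact (key (TransData.sameSlope_of_div_eq ((AffData.isomorphic_iff _ _).1 h).1)).2 h

theorem AffData.eq_of_fields {a b : AffData n} (hr : a.r = b.r) (hA : a.A = b.A)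
    (hp : a.p = b.p) (hq : a.q = b.q) : a = b := by
  cases a; cases b; cases hr; cases hA; cases hp; cases hq; rfl

/-- The object of `𝒟𝒢^φ` given by data for which the bundle is holomorphic: such a bundle is simple. -/
def DGObj.ofHol (hδ : (T - toC δ).det ≠ 0) (hT : HasComplexStructure T) (D : TransData n)
    (p q : Fin n → ℝ)
    (hol : TorusBundle.IsHolomorphic T ((D.bundle (muOf (Tprime T δ) p q)).pullback δ)) :
    DGObj T δ :=
  ⟨D, p, q, hol, (D.isSimple_bundle (hasComplexStructure_Tprime hδ hT) p q).pullback hδ⟩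

/-- Any triple for the given `(r, A)` will do: the shifts by its angles are undone in `p` and `q`,
while holomorphy depends only on `A` and simplicity is automatic. The given data are attained
exactly, not only up to isomorphism. -/
theorem exists_mirrorData_eq (hδ : (T - toC δ).det ≠ 0) (hT : HasComplexStructure T)
    (a : Angles n) (x : FukObj (T - toC δ)) : ∃ E : DGObj T δ, mirrorData a E = x.data := by
  obtain ⟨D, hr, hA⟩ := TransData.exists_transData x.data.r x.data.r_pos x.data.A
  have hol := (D.isHolomorphic_pullback_iff (muOf (Tprime T δ)
      (x.data.p + ((D.r : ℝ) / (D.rk : ℝ)) • a.θ D) (x.data.q - ((D.r : ℝ) / (D.rk : ℝ)) • a.ξ D)) T δ).2 (by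
    rw [hA]
    exact (AffData.isFukObj_iff _ _).1 x.isFukObj)
  exact ⟨DGObj.ofHol hδ hT D _ _ hol, AffData.eq_of_fields hr hA (add_sub_cancel_right _ _)
    (sub_add_cancel _ _)⟩

end Mirror

end

end TorusMirror

end

/-! ### The bijection on isomorphism classes -/

theorem theorem4p2 {n : ℕ} (T : Matrix (Fin n) (Fin n) ℂ)
    (hT : T.det = 0)
    (hIm : ∀ x : Fin n → ℝ, x ≠ 0 → 0 < x ⬝ᵥ (T.map Complex.im *ᵥ x))
    (δ : Matrix (Fin n) (Fin n) ℤ)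
    (hδ : (T - toC δ).det ≠ 0) :
    ∃ hmap : ∀ (a : Angles n) (E : DGObj T δ), (mirrorData a E).IsFukObj (T - toC δ),
      (∃ a : Angles n, a.IsConsistent) ∧
      ∀ a : Angles n, a.IsConsistent →
        ∃ F : Quotient (DGObj.isoSetoid T δ) → Quotient (FukObj.isoSetoid (T - toC δ)),
          (∀ E : DGObj T δ, F ⟦E⟧ = ⟦⟨mirrorData a E, hmap a E⟩⟧) ∧
          Function.Bijective F := by
  have hJ : HasComplexStructure T := hasComplexStructure_of_surjective (zcoord_surjective hIm)
  refine ⟨isFukObj_mirrorData, exists_isConsistent n, fun a ha => ?_⟩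
  have hiff := isomorphic_mirrorData_iff hδ hJ ha
  refine ⟨Quotient.map (fun E => ⟨mirrorData a E, isFukObj_mirrorData a E⟩)
    fun E E' h => (hiff E E').1 h, fun E => rfl, ?_, ?_⟩
  · intro x y
    refine Quotient.inductionOn₂ x y fun E E' h => ?_
    exact Quotient.sound ((hiff E E').2 (Quotient.exact h))
  · intro x
    refine Quotient.inductionOn x fun y => ?_
    obtain ⟨E, hE⟩ := exists_mirrorData_eq hδ hJ a y
    refine ⟨⟦E⟧, ?_⟩
    refine congrArg (Quotient.mk _) ?_
    cases y
    subst hE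
    rfl
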